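/- **Setting.** Let $\mathcal X\subseteq\mathcal S\times\mathcal A$ be a finite set of state-action pairs such that every state $s\in\mathcal S$ has at least one pair $(s,a)\in\mathcal X$; put $S=|\mathcal S|$. An episodic MDP with horizon $H\ge 1$ assigns to each $x\in\mathcal X$ a transition law $P(x)$ on $\mathcal S$ and a reward law $P_R(x)$ on $[0,1]$. In each episode $k=1,2,\dots$ an initial state $s_{k,1}$ is chosen arbitrarily (possibly adversarially, depending on the past), a deterministic time-dependent policy $\pi_k$ is played for $H$ steps with $x_{k,h}=(s_{k,h},\pi_k(s_{k,h},h))$, and $s_{k,h+1}\sim P(x_{k,h})$. Write $V^{\pi}_1(s)$ for the expected return of $\pi$ from $s$ and $V^\star_1(s)=\max_\pi V^\pi_1(s)$. Let $G$ be a directed graph on $\mathcal X$ without self-loops (the feedback graph). When $x_{k,h}$ is played, one observation $(y,r,s')$ is received for $y=x_{k,h}$ (its next state being $s_{k,h+1}$) and for each $y$ with an edge $x_{k,h}\to y$ in $G$; given everything that happened before the outcome of this step, $r$ has law $P_R(y)$ and $s'$ has law $P(y)$, while observations made in the same step may depend on each other. Let $M$ be the mas-number of $G$: the maximal size of a set of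 vertices whose induced subgraph has no directed cycle. Let $\hat S\le S$ be such that every $P(x)$ has at most $\hat S$ possible successor states, and let $\delta\in(0,1]$. **Algorithm.** For each $x$ keep the number $n(x)$ of observations of $x$, the empirical means $\hat r(x)$, $\widehat{r^2}(x)$ of the observed rewards and of their squares, and the empirical transition frequencies $\hat P(x)$, using all observations (side observations included); initially $n=\hat r=\widehat{r^2}=0$ and $\hat P(x)$ is a fixed point mass. Let $\phi(0)=1$ and, for $n\ge1$, $$\phi(n)=1\wedge\sqrt{\tfrac{0.52}{n}\Big(1.4\ln\ln(e\vee 2n)+\ln\tfrac{5.2\,|\mathcal X|(4\hat S+5H+7)}{\delta}\Big)}.$$ Before each episode $k$ compute, from the current model, $\widetilde V_{H+1}=\underline V_{H+1}=0$ and, for $h=H,\dots,1$ and $x=(s,a)\in\mathcal X$, $$\psi_h(x)=4\Big(\sqrt{\widehat{r^2}(x)-\hat r(x)^2}+\sqrt{\hat P(x)\widetilde V_{h+1}^2-(\hat P(x)\widetilde V_{h+1})^2}\Big)\phi(n(x))+53\hat S H^2\phi(n(x))^2+\tfrac1H\hat P(x)(\widetilde V_{h+1}-\underline V_{h+1}),$$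 $$\widetilde Q_h(x)=0\vee\big(\hat r(x)+\hat P(x)\widetilde V_{h+1}+\psi_h(x)\big)\wedge(H-h+1),\qquad \underline Q_h(x)=0\vee\big(\hat r(x)+\hat P(x)\underline V_{h+1}-\psi_h(x)\big)\wedge(H-h+1),$$ $\pi_k(s,h)\in\operatorname{argmax}_a\widetilde Q_h(s,a)$ (ties broken arbitrarily, without knowledge of the future), $\widetilde V_h(s)=\widetilde Q_h(s,\pi_k(s,h))$ and $\underline V_h(s)=\underline Q_h(s,\pi_k(s,h))$. Denote the results by $\widetilde V_{k,h},\underline V_{k,h}$; the certificate of episode $k$ is $[\underline V_{k,1}(s_{k,1}),\widetilde V_{k,1}(s_{k,1})]$. Then play $\pi_k$ and update the model. **Theorem.** There is an absolute constant $C>0$ such that, for every MDP, feedback graph $G$, $H$, $\hat S$, $\delta$ and choice of initial states as above, with probability at least $1-\delta$ the following hold simultaneously: for all $k$, $\underline V_{k,1}(s_{k,1})\le V^{\pi_k}_1(s_{k,1})\le V^\star_1(s_{k,1})\le\widetilde V_{k,1}(s_{k,1})$; and for all $T$, both the cumulative certificate size $\sum_{k=1}^T(\widetilde V_{k,1}(s_{k,1})-\underline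 V_{k,1}(s_{k,1}))$ and the regret $R(T)=\sum_{k=1}^T(V^\star_1(s_{k,1})-V^{\pi_k}_1(s_{k,1}))$ are at most $$C\Big(\sqrt{MH^2T}\;\ln\tfrac{e|\mathcal X|HT}{\delta}+M\hat SH^2\ln^3\tfrac{e|\mathcal X|HT}{\delta}\Big),$$ that is, $\widetilde O(\sqrt{MH^2T}+M\hat SH^2)$. -/

import Mathlib

open MeasureTheory

noncomputable section

namespace FeedbackRL

universe u v w

variable {S : Type u} {A : Type v}

/-! ### Tabular episodic MDPs

The state-action space is a finite set `X` of pairs `(s, a)`. Time steps within an episode are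
numbered `0, …, H - 1`, episodes are numbered `0, 1, 2, …`. -/

/-- Transition law `P x` and reward law `PR x` (carried by `[0, 1]`) of every pair `x ∈ X`. -/
structure MDP (X : Finset (S × A)) where
  P : X → PMF S
  PR : X → Measure ℝ
  PR_prob : ∀ x, IsProbabilityMeasure (PR x)
  PR_bdd : ∀ x, PR x (Set.Icc 0 1)ᶜ = 0

/-- Deterministic, time-dependent policies; only the steps `h < H` matter. -/
def Policy (X : Finset (S × A)) := ℕ → (s : S) → {a : A // (s, a) ∈ X}

/-- The pair `(s, π(s, h))`. -/
def Policy.pair {X : Finset (S × A)} (π : Policy X) (h : ℕ) (s : S) : X :=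
  ⟨(s, (π h s).1), (π h s).2⟩

/-- Expected immediate reward. -/
def MDP.meanReward {X : Finset (S × A)} (M : MDP X) (x : X) : ℝ := ∫ r, r ∂(M.PR x)

/-- Law of the state at step `h` of an episode started in `s` and played with `π`. -/
def MDP.stateLaw {X : Finset (S × A)} (M : MDP X) (π : Policy X) (s : S) : ℕ → PMF S
  | 0 => PMF.pure s
  | h + 1 => (M.stateLaw π s h).bind fun s' => M.P (π.pair h s')

/-- Expected return of `π` over an episode of length `H` started in `s`. -/
def MDP.value {X : Finset (S × A)} [Fintype S] (M : MDP X) (H : ℕ) (π : Policy X) (s : S) : ℝ :=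
  ∑ h ∈ Finset.range H, ∑ s', (M.stateLaw π s h s').toReal * M.meanReward (π.pair h s')

/-- Optimal expected return from `s`. -/
def MDP.optValue {X : Finset (S × A)} [Fintype S] (M : MDP X) (H : ℕ) (s : S) : ℝ :=
  ⨆ π : Policy X, M.value H π s

/-! ### Feedback graphs -/

/-- `V` induces a subgraph without directed cycles. -/
def IsAcyclicOn {W : Type w} (G : Digraph W) (V : Finset W) : Prop :=
  ∀ v ∈ V, ¬ Relation.TransGen (fun a b => a ∈ V ∧ b ∈ V ∧ G.Adj a b) v v

open Classical in
/-- Size of a maximum acyclic (vertex-induced) subgraph. -/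
def masNumber {W : Type w} [Fintype W] (G : Digraph W) : ℕ :=
  ((Finset.univ : Finset (Finset W)).filter (IsAcyclicOn G)).sup Finset.card

/-- Playing `x` reveals an observation of `y`; self-loops are implicit. -/
def Observes {W : Type w} (G : Digraph W) (x y : W) : Prop := y = x ∨ G.Adj x y

/-! ### Empirical model -/

/-- Number of observations, empirical first and second reward moments, transition frequencies. -/
structure Stats (X : Finset (S × A)) where
  n : X → ℕ
  r : X → ℝ
  r2 : X → ℝ
  P : X → S → ℝ

open Classical in
/-- No observations; the transition estimates are the point mass at a reference state `s₀`. -/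
def Stats.init {X : Finset (S × A)} (s₀ : S) : Stats X where
  n _ := 0
  r _ := 0
  r2 _ := 0
  P _ s := if s = s₀ then 1 else 0

/-- Running average `(n - 1) / n * old + 1 / n * new`, where `n` is the updated count. -/
def runAvg (n : ℕ) (old new : ℝ) : ℝ := ((n : ℝ) - 1) / n * old + 1 / n * new

open Classical in
/-- Update of the model with the observations received when `x` is played: for each observed `y`,
the reward sample `R y` and the successor sample `N y`. -/
def Stats.observe {X : Finset (S × A)} (st : Stats X) (G : Digraph X) (x : X)
    (R : X → ℝ) (N : X → S) : Stats X where
  n y := if Observes G x y then st.n y + 1 else st.n y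
  r y := if Observes G x y then runAvg (st.n y + 1) (st.r y) (R y) else st.r y
  r2 y := if Observes G x y then runAvg (st.n y + 1) (st.r2 y) (R y ^ 2) else st.r2 y
  P y s := if Observes G x y then runAvg (st.n y + 1) (st.P y s) (if s = N y then 1 else 0)
    else st.P y s

/-- Model after the first `h` steps of an episode, started from the model `st`; `x h` is the pair
played at step `h`. -/
def Stats.run {X : Finset (S × A)} (st : Stats X) (G : Digraph X) (x : ℕ → X)
    (R : ℕ → X → ℝ) (N : ℕ → X → S) : ℕ → Stats X
  | 0 => st
  | h + 1 => (st.run G x R N h).observe G (x h) (R h) (N h)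

/-- Model at the start of episode `k`. -/
def statsAt {X : Finset (S × A)} (H : ℕ) (G : Digraph X) (s₀ : S) (x : ℕ → ℕ → X)
    (R : ℕ → ℕ → X → ℝ) (N : ℕ → ℕ → X → S) : ℕ → Stats X
  | 0 => Stats.init s₀
  | k + 1 => (statsAt H G s₀ x R N k).run G (x k) (R k) (N k) H

/-! ### Optimistic planning -/

/-- Width function `φ` of the confidence bounds, with `φ(0) = 1`; `card` is `|X|` and `Shat` the
known bound on the number of successor states. -/
def phi (card H Shat : ℕ) (δ : ℝ) (n : ℕ) : ℝ :=
  if n = 0 then 1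
  else min 1 (Real.sqrt (0.52 / n * (1.4 * Real.log (Real.log (max (Real.exp 1) (2 * n)))
    + Real.log (5.2 * card * (4 * Shat + 5 * H + 7) / δ))))

/-- `P̂(x) f`. -/
def Stats.expect {X : Finset (S × A)} [Fintype S] (st : Stats X) (x : X) (f : S → ℝ) : ℝ :=
  ∑ s, st.P x s * f s

/-- Reward bonus `ψ`; `V.1`, `V.2` are the upper and lower value bounds of the next step. -/
def bonus {X : Finset (S × A)} [Fintype S] (H Shat : ℕ) (δ : ℝ) (st : Stats X)
    (V : (S → ℝ) × (S → ℝ)) (x : X) : ℝ :=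
  4 * (Real.sqrt (st.r2 x - st.r x ^ 2)
      + Real.sqrt (st.expect x (fun s => V.1 s ^ 2) - st.expect x V.1 ^ 2))
    * phi X.card H Shat δ (st.n x)
  + 53 * Shat * H ^ 2 * phi X.card H Shat δ (st.n x) ^ 2
  + 1 / H * st.expect x (fun s => V.1 s - V.2 s)

/-- Upper bound on `Q` with `j` steps to go, clipped to `[0, j]`. -/
def upperQ {X : Finset (S × A)} [Fintype S] (H Shat : ℕ) (δ : ℝ) (st : Stats X) (j : ℕ)
    (V : (S → ℝ) × (S → ℝ)) (x : X) : ℝ :=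
  max 0 (min (st.r x + st.expect x V.1 + bonus H Shat δ st V x) j)

/-- Lower bound on `Q` with `j` steps to go, clipped to `[0, j]`. -/
def lowerQ {X : Finset (S × A)} [Fintype S] (H Shat : ℕ) (δ : ℝ) (st : Stats X) (j : ℕ)
    (V : (S → ℝ) × (S → ℝ)) (x : X) : ℝ :=
  max 0 (min (st.r x + st.expect x V.2 - bonus H Shat δ st V x) j)

/-- Upper and lower value bounds with `j` steps to go (that is, at step `H - j`) along `π`. -/
def valueBounds {X : Finset (S × A)} [Fintype S] (H Shat : ℕ) (δ : ℝ) (st : Stats X)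
    (π : Policy X) : ℕ → (S → ℝ) × (S → ℝ)
  | 0 => (fun _ => 0, fun _ => 0)
  | j + 1 =>
    (fun s => upperQ H Shat δ st (j + 1) (valueBounds H Shat δ st π j) (π.pair (H - (j + 1)) s),
     fun s => lowerQ H Shat δ st (j + 1) (valueBounds H Shat δ st π j) (π.pair (H - (j + 1)) s))

/-- `π` is an output of the planning routine on the model `st`: at every step it picks an action
of maximal upper bound (ties are broken arbitrarily). -/
def IsGreedy {X : Finset (S × A)} [Fintype S] (H Shat : ℕ) (δ : ℝ) (st : Stats X)
    (π : Policy X) : Prop :=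
  ∀ j < H, ∀ (s : S) (a : A) (ha : (s, a) ∈ X),
    upperQ H Shat δ st (j + 1) (valueBounds H Shat δ st π j) ⟨(s, a), ha⟩ ≤
      upperQ H Shat δ st (j + 1) (valueBounds H Shat δ st π j) (π.pair (H - (j + 1)) s)

/-! ### Interaction of the algorithm with the MDP -/

/-- A run of the algorithm on the MDP `M` with feedback graph `G`, on a probability space `(Ω, μ)`.
`𝓕 (k * H + h)` is the information available in episode `k` when the action of step `h` is taken,
before its outcome is seen. The initial state `state k 0` may depend arbitrarily on the past (and
on further randomness). `reward k h y`, `next k h y` is the observation of `y` received at step `h`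
of episode `k`; it is only used, and only restricted, if `y` is observed then. Given the past it has
marginal laws `PR y` and `P y`; simultaneous observations may depend on each other. -/
structure Run {X : Finset (S × A)} [Fintype S] (M : MDP X) (G : Digraph X) (H Shat : ℕ) (δ : ℝ)
    (s₀ : S) {Ω : Type w} [mΩ : MeasurableSpace Ω] (μ : Measure Ω) where
  𝓕 : Filtration ℕ mΩ
  policy : ℕ → Ω → Policy X
  state : ℕ → ℕ → Ω → S
  reward : ℕ → ℕ → X → Ω → ℝ
  next : ℕ → ℕ → X → Ω → S
  policy_meas : ∀ k, ∀ h < H, ∀ (s : S) (a : A),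
    MeasurableSet[𝓕 (k * H)] {ω | (policy k ω h s).1 = a}
  state_meas : ∀ k, ∀ h < H, ∀ s : S, MeasurableSet[𝓕 (k * H + h)] {ω | state k h ω = s}
  reward_meas : ∀ k, ∀ h < H, ∀ y, Measurable[𝓕 (k * H + h + 1)] (reward k h y)
  next_meas : ∀ k, ∀ h < H, ∀ y, ∀ s : S, MeasurableSet[𝓕 (k * H + h + 1)] {ω | next k h y ω = s}
  reward_law : ∀ k, ∀ h < H, ∀ y, ∀ F : Set Ω, MeasurableSet[𝓕 (k * H + h)] F →
    (∀ ω ∈ F, Observes G ((policy k ω).pair h (state k h ω)) y) →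
    ∀ B : Set ℝ, MeasurableSet B → μ (F ∩ reward k h y ⁻¹' B) = μ F * M.PR y B
  next_law : ∀ k, ∀ h < H, ∀ y, ∀ F : Set Ω, MeasurableSet[𝓕 (k * H + h)] F →
    (∀ ω ∈ F, Observes G ((policy k ω).pair h (state k h ω)) y) →
    ∀ s : S, μ (F ∩ {ω | next k h y ω = s}) = μ F * M.P y s
  state_succ : ∀ k h, h + 1 < H → ∀ ω,
    state k (h + 1) ω = next k h ((policy k ω).pair h (state k h ω)) ω
  greedy : ∀ k ω, IsGreedy H Shat δ
    (statsAt H G s₀ (fun i h => (policy i ω).pair h (state i h ω))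
      (fun i h y => reward i h y ω) (fun i h y => next i h y ω) k)
    (policy k ω)

namespace Run

variable {X : Finset (S × A)} [Fintype S] {M : MDP X} {G : Digraph X} {H Shat : ℕ} {δ : ℝ}
  {s₀ : S} {Ω : Type w} [mΩ : MeasurableSpace Ω] {μ : Measure Ω}

/-- Model of the algorithm at the start of episode `k`. -/
def stats (ρ : Run M G H Shat δ s₀ μ) (k : ℕ) (ω : Ω) : Stats X :=
  statsAt H G s₀ (fun i h => (ρ.policy i ω).pair h (ρ.state i h ω))
    (fun i h y => ρ.reward i h y ω) (fun i h y => ρ.next i h y ω) k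

/-- Upper end of the certificate of episode `k`. -/
def upper (ρ : Run M G H Shat δ s₀ μ) (k : ℕ) (ω : Ω) : ℝ :=
  (valueBounds H Shat δ (ρ.stats k ω) (ρ.policy k ω) H).1 (ρ.state k 0 ω)

/-- Lower end of the certificate of episode `k`. -/
def lower (ρ : Run M G H Shat δ s₀ μ) (k : ℕ) (ω : Ω) : ℝ :=
  (valueBounds H Shat δ (ρ.stats k ω) (ρ.policy k ω) H).2 (ρ.state k 0 ω)

/-- Expected return, from the initial state of episode `k`, of the policy played in it. -/
def playedValue (ρ : Run M G H Shat δ s₀ μ) (k : ℕ) (ω : Ω) : ℝ :=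
  M.value H (ρ.policy k ω) (ρ.state k 0 ω)

/-- Optimal expected return from the initial state of episode `k`. -/
def bestValue (ρ : Run M G H Shat δ s₀ μ) (k : ℕ) (ω : Ω) : ℝ :=
  M.optValue H (ρ.state k 0 ω)

/-- Cumulative certificate size of the first `T` episodes. -/
def certSize (ρ : Run M G H Shat δ s₀ μ) (T : ℕ) (ω : Ω) : ℝ :=
  ∑ k ∈ Finset.range T, (ρ.upper k ω - ρ.lower k ω)

/-- Regret of the first `T` episodes. -/
def regret (ρ : Run M G H Shat δ s₀ μ) (T : ℕ) (ω : Ω) : ℝ :=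
  ∑ k ∈ Finset.range T, (ρ.bestValue k ω - ρ.playedValue k ω)

end Run

/-- `√(M H² T) L + M Ŝ H² L³` with `L = ln (e |X| H T / δ)`. -/
def boundRate (mas card H Shat : ℕ) (δ : ℝ) (T : ℕ) : ℝ :=
  Real.sqrt (mas * H ^ 2 * T) * Real.log (Real.exp 1 * card * H * T / δ)
    + mas * Shat * H ^ 2 * Real.log (Real.exp 1 * card * H * T / δ) ^ 3

end FeedbackRL

end

/-!
Ville's inequality for exponential supermartingales, peeled over dyadic ranges of the number of
observations, gives Bernstein bounds of width `φ` that hold at all times. On the event that they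
hold, induction on the number of steps to go shows that the planned bounds enclose the optimal and
the played value: the bonus dominates the errors of the model, its `1 / H` part paying for the
unknown variance of the optimal value.

The gap between the bounds at one step is at most `1 + 7 / H` times the expected gap at the next one
plus a cost of order `(1 + σ) φ + Ŝ H² φ²`, where `σ` is the standard deviation of the next value of
the played policy. Over an episode the factors multiply to a constant, so that the certificates sum
to a multiple of the total cost. The squared values telescope along an episode, so the variances
`σ²` sum to at most a multiple of `H² T` and a logarithm. The feedback graph enters through the
squares `φ²`. Consider the times at which the played pair has been observed less than `m` times:
the pair played at the last of them is observed at no more than `m` of them. Removing these and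
repeating leaves one pair per round, and these pairs form an acyclic set, so that there are at most
`m M` such times. Hence the `φ²` sum to `M` up to logarithms, and the Cauchy–Schwarz inequality
yields the rate.
-/

noncomputable section

namespace FeedbackRL

variable {S A : Type*}

section Weights

variable {ι : Type*} [Fintype ι] {p q w f g : ι → ℝ}

lemma dotProduct_const (hp : p ∈ stdSimplex ℝ ι) (c : ℝ) : (p ⬝ᵥ fun _ => c) = c := by
  simp [dotProduct, ← Finset.sum_mul, hp.2]

lemma dotProduct_le_of_forall_le (hp : p ∈ stdSimplex ℝ ι) {B : ℝ} (h : ∀ i, f i ≤ B) :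
    p ⬝ᵥ f ≤ B :=
  (dotProduct_le_dotProduct_of_nonneg_left h hp.1).trans_eq (dotProduct_const hp B)

lemma dotProduct_mem_Icc_zero (hp : p ∈ stdSimplex ℝ ι) {B : ℝ} (hf : ∀ i, f i ∈ Set.Icc 0 B) :
    p ⬝ᵥ f ∈ Set.Icc 0 B :=
  ⟨dotProduct_nonneg_of_nonneg hp.1 fun i => (hf i).1,
    dotProduct_le_of_forall_le hp fun i => (hf i).2⟩

/-- Variance of `f` under the weights `p`, in the form in which the algorithm computes it. -/
def wvar (p f : ι → ℝ) : ℝ := p ⬝ᵥ f ^ 2 - (p ⬝ᵥ f) ^ 2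

/-- Standard deviation of `f` under the weights `p`. -/
def wsd (p f : ι → ℝ) : ℝ := √(wvar p f)

lemma wsd_nonneg : 0 ≤ wsd p f := Real.sqrt_nonneg _

lemma dotProduct_sub_const_sq (hp : p ∈ stdSimplex ℝ ι) (c : ℝ) :
    (p ⬝ᵥ fun i => (f i - c) ^ 2) = wvar p f + (p ⬝ᵥ f - c) ^ 2 := by
  have hexpand : (fun i => (f i - c) ^ 2) = f ^ 2 - (2 * c) • f + fun _ => c ^ 2 := by
    ext i
    simp only [Pi.add_apply, Pi.sub_apply, Pi.pow_apply, Pi.smul_apply, smul_eq_mul]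
    ring
  rw [hexpand, dotProduct_add, dotProduct_sub, dotProduct_smul, dotProduct_const hp, wvar,
    smul_eq_mul]
  ring

lemma wvar_le_dotProduct_sub_const_sq (hp : p ∈ stdSimplex ℝ ι) (c : ℝ) :
    wvar p f ≤ p ⬝ᵥ fun i => (f i - c) ^ 2 :=
  (le_add_of_nonneg_right (sq_nonneg _)).trans_eq (dotProduct_sub_const_sq hp c).symm

lemma wvar_eq_dotProduct_sub_sq (hp : p ∈ stdSimplex ℝ ι) :
    wvar p f = p ⬝ᵥ fun i => (f i - p ⬝ᵥ f) ^ 2 := by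
  rw [dotProduct_sub_const_sq hp, sub_self, zero_pow two_ne_zero, add_zero]

lemma wvar_nonneg (hp : p ∈ stdSimplex ℝ ι) : 0 ≤ wvar p f := by
  rw [wvar_eq_dotProduct_sub_sq hp]
  exact dotProduct_nonneg_of_nonneg hp.1 fun _ => sq_nonneg _

lemma sq_wsd (hp : p ∈ stdSimplex ℝ ι) : wsd p f ^ 2 = wvar p f := Real.sq_sqrt (wvar_nonneg hp)

lemma dotProduct_mul_le_sqrt_mul_sqrt (hp : 0 ≤ p) :
    p ⬝ᵥ (f * g) ≤ √(p ⬝ᵥ f ^ 2) * √(p ⬝ᵥ g ^ 2) := by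
  have hsq (i : ι) : √(p i) ^ 2 = p i := Real.sq_sqrt (hp i)
  calc p ⬝ᵥ (f * g) = ∑ i, √(p i) * f i * (√(p i) * g i) :=
        Finset.sum_congr rfl fun i _ => by
          rw [Pi.mul_apply]; linear_combination -(f i * g i) * hsq i
    _ ≤ √(∑ i, (√(p i) * f i) ^ 2) * √(∑ i, (√(p i) * g i) ^ 2) :=
        Real.sum_mul_le_sqrt_mul_sqrt ..
    _ = √(p ⬝ᵥ f ^ 2) * √(p ⬝ᵥ g ^ 2) := by simp only [mul_pow, hsq]; rfl

lemma sqrt_dotProduct_add_sq_le (hp : 0 ≤ p) :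
    √(p ⬝ᵥ (f + g) ^ 2) ≤ √(p ⬝ᵥ f ^ 2) + √(p ⬝ᵥ g ^ 2) := by
  have hf : √(p ⬝ᵥ f ^ 2) ^ 2 = p ⬝ᵥ f ^ 2 :=
    Real.sq_sqrt (dotProduct_nonneg_of_nonneg hp fun i => sq_nonneg (f i))
  have hg : √(p ⬝ᵥ g ^ 2) ^ 2 = p ⬝ᵥ g ^ 2 :=
    Real.sq_sqrt (dotProduct_nonneg_of_nonneg hp fun i => sq_nonneg (g i))
  refine Real.sqrt_le_iff.2 ⟨by positivity, ?_⟩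
  rw [show (f + g) ^ 2 = f ^ 2 + g ^ 2 + (2 : ℝ) • (f * g) by
      ext; simp only [Pi.add_apply, Pi.pow_apply, Pi.smul_apply, Pi.mul_apply, smul_eq_mul]; ring,
    dotProduct_add, dotProduct_add, dotProduct_smul, smul_eq_mul]
  linarith [dotProduct_mul_le_sqrt_mul_sqrt hp (f := f) (g := g)]

lemma wsd_le_wsd_add (hp : p ∈ stdSimplex ℝ ι) :
    wsd p f ≤ wsd p g + √(p ⬝ᵥ (f - g) ^ 2) := by
  have hsum : (fun i => (f i - p ⬝ᵥ g) ^ 2) = ((fun i => g i - p ⬝ᵥ g) + (f - g)) ^ 2 := by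
    ext i
    simp only [Pi.pow_apply, Pi.add_apply, Pi.sub_apply]
    ring
  calc wsd p f ≤ √(p ⬝ᵥ fun i => (f i - p ⬝ᵥ g) ^ 2) :=
        Real.sqrt_le_sqrt (wvar_le_dotProduct_sub_const_sq hp _)
    _ ≤ √(p ⬝ᵥ (fun i => g i - p ⬝ᵥ g) ^ 2) + √(p ⬝ᵥ (f - g) ^ 2) :=
        hsum ▸ sqrt_dotProduct_add_sq_le hp.1
    _ = wsd p g + √(p ⬝ᵥ (f - g) ^ 2) := by rw [wsd, wvar_eq_dotProduct_sub_sq hp]; rfl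

lemma dotProduct_sq_le_mul_dotProduct (hp : 0 ≤ p) {B : ℝ} (hf : ∀ i, f i ∈ Set.Icc 0 B) :
    p ⬝ᵥ f ^ 2 ≤ B * (p ⬝ᵥ f) := by
  rw [← smul_eq_mul, ← dotProduct_smul]
  refine dotProduct_le_dotProduct_of_nonneg_left (fun i => ?_) hp
  rw [Pi.pow_apply, Pi.smul_apply, smul_eq_mul, sq]
  exact mul_le_mul_of_nonneg_right (hf i).2 (hf i).1

lemma sum_sqrt_mul_le_sqrt (hw : 0 ≤ w) (T : Finset ι) :
    ∑ i ∈ T, √(w i) * f i ≤ √(T.card * (w ⬝ᵥ f ^ 2)) := by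
  refine Real.le_sqrt_of_sq_le (sq_sum_le_card_mul_sum_sq.trans ?_)
  gcongr
  simp only [mul_pow, Real.sq_sqrt (hw _)]
  exact Finset.sum_le_univ_sum_of_nonneg fun i => mul_nonneg (hw i) (sq_nonneg _)

lemma mul_sqrt_mul_le {t c y H : ℝ} (hc : 0 ≤ c) (hy : 0 ≤ y) (hH : 0 < H) :
    t * √(c * y) ≤ 1 / H * y + t ^ 2 / 4 * c * H := by
  have hsq : 0 ≤ (2 * √y - t * √c * H) ^ 2 / (4 * H) := by positivity
  have hexpand : (2 * √y - t * √c * H) ^ 2 / (4 * H)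
      = 1 / H * √y ^ 2 + t ^ 2 / 4 * √c ^ 2 * H - t * (√c * √y) := by
    field_simp
    ring
  rw [Real.sq_sqrt hc, Real.sq_sqrt hy] at hexpand
  rw [Real.sqrt_mul hc]
  linarith

lemma mul_wsd_le_mul_wsd_add (hp : p ∈ stdSimplex ℝ ι) {d : ι → ℝ} {B H t : ℝ} (hB : 0 ≤ B)
    (hd : ∀ i, d i ∈ Set.Icc 0 B) (hfg : ∀ i, |f i - g i| ≤ d i) (ht : 0 ≤ t) (hH : 0 < H) :
    t * wsd p f ≤ t * wsd p g + (1 / H * (p ⬝ᵥ d) + t ^ 2 / 4 * B * H) := by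
  have hsq : p ⬝ᵥ (f - g) ^ 2 ≤ B * (p ⬝ᵥ d) :=
    (dotProduct_le_dotProduct_of_nonneg_left (fun i => sq_le_sq.2 <|
      (hfg i).trans (le_abs_self _)) hp.1).trans (dotProduct_sq_le_mul_dotProduct hp.1 hd)
  calc t * wsd p f ≤ t * (wsd p g + √(B * (p ⬝ᵥ d))) := by
        gcongr
        exact (wsd_le_wsd_add hp).trans (add_le_add_right (Real.sqrt_le_sqrt hsq) _)
    _ = t * wsd p g + t * √(B * (p ⬝ᵥ d)) := mul_add _ _ _
    _ ≤ _ := by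
        gcongr
        exact mul_sqrt_mul_le hB (dotProduct_nonneg_of_nonneg hp.1 fun i => (hd i).1) hH

/-- `q` deviates from `p` by at most `a √w φ + b φ²` on a set of at most `K` points, and agrees with
it elsewhere. This is the shape of a Bernstein confidence region for `p`; the variance proxy `w`
is `p` or `q`. -/
structure DevBound (p q w : ι → ℝ) (a b φ : ℝ) (K : ℕ) : Prop where
  nonneg : 0 ≤ w
  abs_sub_le : ∀ i, |q i - p i| ≤ a * √(w i) * φ + b * φ ^ 2
  ncard_le : {i | q i ≠ p i}.ncard ≤ K

namespace DevBound

variable {a b φ B : ℝ} {K : ℕ}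

lemma abs_dotProduct_sub_le (h : DevBound p q w a b φ K) (ha : 0 ≤ a) (hb : 0 ≤ b) (hφ : 0 ≤ φ)
    (hB : 0 ≤ B) (hf : ∀ i, f i ∈ Set.Icc 0 B) :
    |q ⬝ᵥ f - p ⬝ᵥ f| ≤ a * φ * √(K * (w ⬝ᵥ f ^ 2)) + b * K * B * φ ^ 2 := by
  classical
  set T : Finset ι := {i | q i ≠ p i} with hT
  have hTK : (T.card : ℝ) ≤ K := by
    rw [hT, ← Set.ncard_coe_finset, Finset.coe_filter_univ]
    exact_mod_cast h.ncard_le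
  have hw : 0 ≤ w ⬝ᵥ f ^ 2 := dotProduct_nonneg_of_nonneg h.nonneg fun i => sq_nonneg _
  calc |q ⬝ᵥ f - p ⬝ᵥ f| = |∑ i ∈ T, (q i - p i) * f i| := by
        rw [← sub_dotProduct, hT, Finset.sum_filter]
        refine congrArg _ (Finset.sum_congr rfl fun i _ => ?_)
        by_cases e : q i = p i <;> simp [e]
    _ ≤ ∑ i ∈ T, (a * φ * (√(w i) * f i) + b * φ ^ 2 * B) := by
        refine (Finset.abs_sum_le_sum_abs _ _).trans (Finset.sum_le_sum fun i _ => ?_)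
        rw [abs_mul, abs_of_nonneg (hf i).1]
        have hfirst := mul_le_mul_of_nonneg_right (h.abs_sub_le i) (hf i).1
        have hsecond : b * φ ^ 2 * f i ≤ b * φ ^ 2 * B := by gcongr; exact (hf i).2
        linarith
    _ = a * φ * ∑ i ∈ T, √(w i) * f i + T.card * (b * φ ^ 2 * B) := by
        rw [Finset.sum_add_distrib, Finset.sum_const, nsmul_eq_mul, ← Finset.mul_sum]
    _ ≤ a * φ * √(T.card * (w ⬝ᵥ f ^ 2)) + T.card * (b * φ ^ 2 * B) := by
        gcongr; exact sum_sqrt_mul_le_sqrt h.nonneg T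
    _ ≤ a * φ * √(K * (w ⬝ᵥ f ^ 2)) + K * (b * φ ^ 2 * B) := by gcongr
    _ = _ := by ring

-- AM-GM turns the first-order part of the deviation into a small multiple of the expectation.
lemma abs_dotProduct_sub_le_absorb {H : ℝ} (h : DevBound p q w a b φ K) (ha : 0 ≤ a) (hb : 0 ≤ b)
    (hφ : 0 ≤ φ) (hB : 0 ≤ B) (hf : ∀ i, f i ∈ Set.Icc 0 B) (hH : 0 < H) :
    |q ⬝ᵥ f - p ⬝ᵥ f| ≤ 1 / H * (w ⬝ᵥ f) + (a ^ 2 / 4 * H + b) * (K * B * φ ^ 2) := by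
  have hwf : 0 ≤ w ⬝ᵥ f := dotProduct_nonneg_of_nonneg h.nonneg fun i => (hf i).1
  calc |q ⬝ᵥ f - p ⬝ᵥ f| ≤ a * φ * √(K * (w ⬝ᵥ f ^ 2)) + b * K * B * φ ^ 2 :=
        h.abs_dotProduct_sub_le ha hb hφ hB hf
    _ ≤ a * φ * √(K * B * (w ⬝ᵥ f)) + b * K * B * φ ^ 2 := by
        rw [mul_assoc (K : ℝ)]
        gcongr
        exact dotProduct_sq_le_mul_dotProduct h.nonneg hf
    _ ≤ 1 / H * (w ⬝ᵥ f) + (a * φ) ^ 2 / 4 * (K * B) * H + b * K * B * φ ^ 2 := by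
        gcongr; exact mul_sqrt_mul_le (by positivity) hwf hH
    _ = _ := by ring

-- Apply the deviation bound to the squared distance of `f` from its `p`-mean: the fourth moment is
-- at most `B²` times the variance, so the resulting bound is a perfect square in `wsd p f`.
lemma wsd_le {c : ℝ} (h : DevBound p q p a b φ K) (ha : 0 ≤ a) (hb : 0 ≤ b) (hφ : 0 ≤ φ)
    (hB : 0 ≤ B) (hf : ∀ i, f i ∈ Set.Icc 0 B) (hp : p ∈ stdSimplex ℝ ι)
    (hq : q ∈ stdSimplex ℝ ι) (hc : 0 ≤ c) (hca : a ≤ 2 * c) (hcb : b ≤ c ^ 2) :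
    wsd q f ≤ wsd p f + c * √K * B * φ := by
  set g : ι → ℝ := fun i => (f i - p ⬝ᵥ f) ^ 2
  obtain ⟨hpf₀, hpfB⟩ := dotProduct_mem_Icc_zero hp hf
  have hgB (i : ι) : g i ∈ Set.Icc 0 (B ^ 2) :=
    ⟨sq_nonneg _, sq_le_sq' (by linarith [(hf i).1]) (by linarith [(hf i).2])⟩
  have hpg : p ⬝ᵥ g = wsd p f ^ 2 := by rw [sq_wsd hp, wvar_eq_dotProduct_sub_sq hp]
  have hsd : 0 ≤ wsd p f := wsd_nonneg
  have hfourth : √(K * (p ⬝ᵥ g ^ 2)) ≤ √K * B * wsd p f := by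
    refine Real.sqrt_le_iff.2 ⟨by positivity, ?_⟩
    rw [mul_pow, mul_pow, Real.sq_sqrt (Nat.cast_nonneg _), mul_assoc, ← hpg]
    gcongr
    exact dotProduct_sq_le_mul_dotProduct hp.1 hgB
  refine Real.sqrt_le_iff.2 ⟨by positivity, ?_⟩
  calc wvar q f ≤ q ⬝ᵥ g := wvar_le_dotProduct_sub_const_sq hq _
    _ ≤ p ⬝ᵥ g + (a * φ * √(K * (p ⬝ᵥ g ^ 2)) + b * K * B ^ 2 * φ ^ 2) := by
        linarith [(abs_le.1 (h.abs_dotProduct_sub_le ha hb hφ (sq_nonneg B) hgB)).2]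
    _ ≤ wsd p f ^ 2 + (2 * c * φ * (√K * B * wsd p f) + c ^ 2 * √K ^ 2 * B ^ 2 * φ ^ 2) := by
        rw [hpg, Real.sq_sqrt (Nat.cast_nonneg K)]
        gcongr
    _ = _ := by ring

end DevBound

end Weights

lemma le_add_of_sq_le_sq_add {x y a b c : ℝ} (hx : x ^ 2 ≤ y ^ 2 + a * x + b) (hy : 0 ≤ y)
    (hac : a ≤ 2 * c) (hb : b ≤ c * (c - a)) : x ≤ y + c := by
  by_contra! hlt
  nlinarith [mul_pos (sub_pos.2 hlt) (sub_pos.2 hlt)]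

lemma DevBound.symm {ι : Type*} {p q : ι → ℝ} {a b b' c φ : ℝ} {K : ℕ}
    (h : DevBound p q p a b φ K) (hφ : 0 ≤ φ) (hq : 0 ≤ q) (ha : 0 ≤ a)
    (hac : a ≤ 2 * c) (hb : b ≤ c * (c - a)) (hb' : a * c + b ≤ b') :
    DevBound q p q a b' φ K where
  nonneg := hq
  ncard_le := by simpa only [ne_comm] using h.ncard_le
  abs_sub_le i := by
    have hsqrt : √(p i) ≤ √(q i) + c * φ := by
      refine le_add_of_sq_le_sq_add (a := a * φ) (b := b * φ ^ 2) ?_ (Real.sqrt_nonneg _)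
        (by nlinarith) (by nlinarith [mul_le_mul_of_nonneg_right hb (sq_nonneg φ)])
      rw [Real.sq_sqrt (h.nonneg i), Real.sq_sqrt (hq i)]
      linarith [(abs_le.1 (h.abs_sub_le i)).1]
    calc |p i - q i| = |q i - p i| := abs_sub_comm _ _
      _ ≤ a * √(p i) * φ + b * φ ^ 2 := h.abs_sub_le i
      _ ≤ a * (√(q i) + c * φ) * φ + b * φ ^ 2 := by gcongr
      _ = a * √(q i) * φ + (a * c + b) * φ ^ 2 := by ring
      _ ≤ a * √(q i) * φ + b' * φ ^ 2 := by gcongr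

section Digraph

variable {W : Type*} {G : Digraph W}

lemma IsAcyclicOn.card_le_masNumber [Fintype W] {V : Finset W} (h : IsAcyclicOn G V) :
    V.card ≤ masNumber G := by
  classical
  exact Finset.le_sup (f := Finset.card) (by simpa using h)

lemma isAcyclicOn_empty (G : Digraph W) : IsAcyclicOn G ∅ :=
  fun _ hv => absurd hv (Finset.notMem_empty _)

lemma IsAcyclicOn.insert_source [DecidableEq W] {V : Finset W} (h : IsAcyclicOn G V) {y : W}
    (hy : ∀ z ∈ insert y V, ¬ G.Adj z y) : IsAcyclicOn G (insert y V) := by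
  -- a walk never returns to `y`, so from its second vertex on it stays in `V`
  have walk_in_V (a b : W) (hab : Relation.TransGen
      (fun a b => a ∈ insert y V ∧ b ∈ insert y V ∧ G.Adj a b) a b) :
      b ≠ y ∧ (a ≠ y → Relation.TransGen (fun a b => a ∈ V ∧ b ∈ V ∧ G.Adj a b) a b) := by
    induction hab with
    | @single b hab =>
      obtain ⟨ha, hb, hadj⟩ := hab
      have hby : b ≠ y := fun e => hy a ha (e ▸ hadj)
      exact ⟨hby, fun hay =>
        .single ⟨Finset.mem_of_mem_insert_of_ne ha hay, Finset.mem_of_mem_insert_of_ne hb hby,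
          hadj⟩⟩
    | @tail b c _ hbc ih =>
      obtain ⟨hb, hc, hadj⟩ := hbc
      have hcy : c ≠ y := fun e => hy b hb (e ▸ hadj)
      exact ⟨hcy, fun hay => .tail (ih.2 hay) ⟨Finset.mem_of_mem_insert_of_ne hb ih.1,
        Finset.mem_of_mem_insert_of_ne hc hcy, hadj⟩⟩
  intro v hv hvv
  obtain ⟨hvy, hcycle⟩ := walk_in_V v v hvv
  exact h v (Finset.mem_of_mem_insert_of_ne hv hvy) (hcycle hvy)

lemma isAcyclicOn_singleton (hG : ∀ x, ¬ G.Adj x x) (x : W) : IsAcyclicOn G {x} := by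
  classical
  rw [← insert_empty_eq]
  refine (isAcyclicOn_empty G).insert_source fun z hz => ?_
  rw [insert_empty_eq, Finset.mem_singleton] at hz
  exact hz ▸ hG x

lemma one_le_masNumber [Fintype W] (hG : ∀ x, ¬ G.Adj x x) (x : W) : 1 ≤ masNumber G :=
  (isAcyclicOn_singleton hG x).card_le_masNumber

open Classical in
lemma card_filter_observes_le_succ_card_filter_lt (G : Digraph W) (x : ℕ → W) {I : Finset ℕ}
    {l : ℕ} (hl : ∀ i ∈ I, i ≤ l) :
    {j ∈ I | Observes G (x j) (x l)}.card ≤ {j ∈ I | j < l ∧ Observes G (x j) (x l)}.card + 1 := by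
  refine (Finset.card_le_card fun j hj => ?_).trans (Finset.card_insert_le l _)
  obtain ⟨hjI, hobs⟩ := Finset.mem_filter.1 hj
  rcases (hl j hjI).lt_or_eq with hjl | rfl
  · exact Finset.mem_insert_of_mem (Finset.mem_filter.2 ⟨hjI, hjl, hobs⟩)
  · exact Finset.mem_insert_self _ _

open Classical in
-- The vertex played at the last time `l` is added to the acyclic set found, by induction, among the
-- times at which it was not observed; at most `m` times are lost in this step.
lemma exists_acyclic_card_le (hG : ∀ x, ¬ G.Adj x x) (x : ℕ → W) (m : ℕ) (I : Finset ℕ)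
    (hI : ∀ i ∈ I, {j ∈ I | j < i ∧ Observes G (x j) (x i)}.card < m) :
    ∃ V : Finset W, IsAcyclicOn G V ∧ (∀ v ∈ V, ∃ i ∈ I, x i = v) ∧ I.card ≤ m * V.card := by
  induction I using Finset.strongInduction with
  | H I ih =>
    rcases I.eq_empty_or_nonempty with rfl | hne
    · exact ⟨∅, isAcyclicOn_empty G, by simp, by simp⟩
    set l := I.max' hne
    have hlI : l ∈ I := I.max'_mem hne
    set J : Finset ℕ := {j ∈ I | ¬ Observes G (x j) (x l)}
    have hJI : J ⊂ I := Finset.filter_ssubset.2 ⟨l, hlI, not_not.2 (Or.inl rfl)⟩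
    obtain ⟨V, hV, hVJ, hJcard⟩ := ih J hJI fun i hi =>
      (Finset.card_le_card (Finset.filter_subset_filter _ hJI.1)).trans_lt (hI i (hJI.1 hi))
    have hVobs (z : W) (hz : z ∈ V) : ¬ Observes G z (x l) := by
      obtain ⟨i, hi, rfl⟩ := hVJ z hz
      exact (Finset.mem_filter.1 hi).2
    refine ⟨insert (x l) V, hV.insert_source ?_, ?_, ?_⟩
    · exact Finset.forall_mem_insert .. |>.2 ⟨hG _, fun z hz h => hVobs z hz (Or.inr h)⟩
    · exact Finset.forall_mem_insert .. |>.2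
        ⟨⟨l, hlI, rfl⟩, fun v hv => (hVJ v hv).imp fun i hi => ⟨hJI.1 hi.1, hi.2⟩⟩
    · have hlV : x l ∉ V := fun h => hVobs _ h (Or.inl rfl)
      have hlost :=
        card_filter_observes_le_succ_card_filter_lt G x (l := l) fun i hi => I.le_max' i hi
      have hsplit : {j ∈ I | Observes G (x j) (x l)}.card + J.card = I.card :=
        Finset.card_filter_add_card_filter_not _
      rw [Finset.card_insert_of_notMem hlV, mul_add, mul_one]
      linarith [hI l hlI]

open Classical in
/-- Times at which `y` is observed among the first `t` plays of the sequence `x`. -/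
def obsTimes (G : Digraph W) (x : ℕ → W) (t : ℕ) (y : W) : Finset ℕ :=
  {i ∈ Finset.range t | Observes G (x i) y}

/-- Number of observations of `y` in the first `t` plays of the sequence `x`. -/
def obsCount (G : Digraph W) (x : ℕ → W) (t : ℕ) (y : W) : ℕ := (obsTimes G x t y).card

lemma mem_obsTimes {x : ℕ → W} {t i : ℕ} {y : W} :
    i ∈ obsTimes G x t y ↔ i < t ∧ Observes G (x i) y := by
  simp only [obsTimes, Finset.mem_filter, Finset.mem_range]

open Classical in
lemma obsTimes_succ (G : Digraph W) (x : ℕ → W) (t : ℕ) (y : W) :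
    obsTimes G x (t + 1) y
      = if Observes G (x t) y then insert t (obsTimes G x t y) else obsTimes G x t y := by
  rw [obsTimes, Finset.range_add_one, Finset.filter_insert, obsTimes]

lemma obsCount_le (G : Digraph W) (x : ℕ → W) (t : ℕ) (y : W) : obsCount G x t y ≤ t := by
  classical
  exact (Finset.card_filter_le _ _).trans_eq (Finset.card_range t)

lemma obsCount_succ_le (G : Digraph W) (x : ℕ → W) (t : ℕ) (y : W) :
    obsCount G x (t + 1) y ≤ obsCount G x t y + 1 := by
  classical
  rw [obsCount, obsTimes_succ]
  split_ifs
  · exact Finset.card_insert_le _ _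
  · exact Nat.le_succ _

lemma obsCount_add_le (G : Digraph W) (x : ℕ → W) (y : W) (t h : ℕ) :
    obsCount G x (t + h) y ≤ obsCount G x t y + h := by
  induction h with
  | zero => rfl
  | succ h ih => exact (obsCount_succ_le G x (t + h) y).trans (Nat.succ_le_succ ih)

lemma card_obsCount_lt_le [Fintype W] (hG : ∀ x, ¬ G.Adj x x) (x : ℕ → W) (m t : ℕ) :
    {i ∈ Finset.range t | obsCount G x i (x i) < m}.card ≤ m * masNumber G := by
  classical
  obtain ⟨V, hV, -, hcard⟩ := exists_acyclic_card_le hG x m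
    {i ∈ Finset.range t | obsCount G x i (x i) < m} fun i hi => by
      refine (Finset.card_le_card fun j hj => ?_).trans_lt (Finset.mem_filter.1 hi).2
      exact mem_obsTimes.2 (Finset.mem_filter.1 hj).2
  exact hcard.trans (Nat.mul_le_mul_left _ hV.card_le_masNumber)

lemma one_div_succ_eq_sum {n N : ℕ} (h : n ≤ N) :
    (1 : ℝ) / (n + 1) = ∑ m ∈ Finset.range N,
      (if n < m + 1 then (1 : ℝ) / ((m + 1) * (m + 2)) else 0) + 1 / (N + 1) := by
  induction N, h using Nat.le_induction with
  | base =>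
    rw [Finset.sum_eq_zero fun m hm => if_neg (by have := Finset.mem_range.1 hm; omega), zero_add]
  | succ N hN ih =>
    rw [Finset.sum_range_succ, if_pos (by omega), ih]
    push_cast
    field_simp
    ring

lemma sum_one_div_add_two_le_log (N : ℕ) :
    ∑ m ∈ Finset.range N, (1 : ℝ) / (m + 2) ≤ Real.log (N + 1) := by
  have h := harmonic_le_one_add_log (N + 1)
  rw [harmonic, Finset.sum_range_succ'] at h
  push_cast at h
  simp only [add_assoc, one_add_one_eq_two, inv_one] at h
  simp only [one_div]
  linarith

lemma sum_one_div_succ_le {ι : Type*} {s : Finset ι} {n : ι → ℕ} {N : ℕ} {K : ℝ}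
    (hn : ∀ i ∈ s, n i ≤ N) (hcard : ∀ m, ({i ∈ s | n i < m}.card : ℝ) ≤ m * K) (hK : 0 ≤ K) :
    ∑ i ∈ s, (1 : ℝ) / (n i + 1) ≤ K * Real.log (N + 1) + s.card / (N + 1) := by
  rw [Finset.sum_congr rfl fun i hi => one_div_succ_eq_sum (hn i hi), Finset.sum_add_distrib,
    Finset.sum_comm, Finset.sum_const, nsmul_eq_mul, mul_one_div]
  gcongr
  calc ∑ m ∈ Finset.range N, ∑ i ∈ s, (if n i < m + 1 then (1 : ℝ) / ((m + 1) * (m + 2)) else 0)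
      ≤ ∑ m ∈ Finset.range N, K * (1 / (m + 2)) := by
        refine Finset.sum_le_sum fun m _ => ?_
        rw [← Finset.sum_filter, Finset.sum_const, nsmul_eq_mul]
        have hm := hcard (m + 1)
        push_cast at hm
        calc _ ≤ (m + 1) * K * (1 / ((m + 1) * (m + 2))) := by gcongr
          _ = K * (1 / (m + 2)) := by field_simp
    _ ≤ K * Real.log (N + 1) := by
        rw [← Finset.mul_sum]
        gcongr
        exact sum_one_div_add_two_le_log N

lemma sum_one_div_obsCount_succ_le [Fintype W] (hG : ∀ x, ¬ G.Adj x x) (x : ℕ → W) (t : ℕ) :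
    ∑ i ∈ Finset.range t, (1 : ℝ) / (obsCount G x i (x i) + 1)
      ≤ masNumber G * Real.log (t + 1) + 1 := by
  refine (sum_one_div_succ_le (N := t) (K := masNumber G)
    (fun i hi => (obsCount_le G x i (x i)).trans (Finset.mem_range.1 hi).le)
    (fun m => mod_cast card_obsCount_lt_le hG x m t) (Nat.cast_nonneg _)).trans ?_
  rw [Finset.card_range]
  gcongr
  exact div_le_one_of_le₀ (by linarith) (by positivity)

end Digraph

section Ville

open scoped ENNReal

variable {Ω : Type*} [mΩ : MeasurableSpace Ω] {μ : Measure Ω}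

lemma lintegral_mul_le_of_setLIntegral_le {m : MeasurableSpace Ω} (hm : m ≤ mΩ) {g f : Ω → ℝ≥0∞}
    (hg : Measurable[mΩ] g) (h : ∀ F, MeasurableSet[m] F → ∫⁻ ω in F, g ω ∂μ ≤ μ F)
    (hf : Measurable[m] f) : ∫⁻ ω, f ω * g ω ∂μ ≤ ∫⁻ ω, f ω ∂μ := by
  have htrim : (μ.withDensity g).trim hm ≤ μ.trim hm := by
    refine Measure.le_iff.2 fun F hF => ?_
    rw [trim_measurableSet_eq hm hF, trim_measurableSet_eq hm hF, withDensity_apply _ (hm _ hF)]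
    exact h F hF
  calc ∫⁻ ω, f ω * g ω ∂μ = ∫⁻ ω, f ω ∂(μ.withDensity g) := by
        rw [lintegral_withDensity_eq_lintegral_mul _ hg (hf.mono hm le_rfl)]
        simp only [Pi.mul_apply, mul_comm]
    _ = ∫⁻ ω, f ω ∂((μ.withDensity g).trim hm) := (lintegral_trim hm hf).symm
    _ ≤ ∫⁻ ω, f ω ∂(μ.trim hm) := lintegral_mono' htrim le_rfl
    _ = ∫⁻ ω, f ω ∂μ := lintegral_trim hm hf

lemma setLIntegral_compl_add_mul_measure_le {s t : Set Ω} (hs : MeasurableSet s)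
    (ht : MeasurableSet t) (hst : s ⊆ t) {f : Ω → ℝ≥0∞} {c : ℝ≥0∞} (hf : ∀ ω ∈ t \ s, c ≤ f ω) :
    ∫⁻ ω in tᶜ, f ω ∂μ + c * μ t ≤ ∫⁻ ω in sᶜ, f ω ∂μ + c * μ s := by
  have hsplit : sᶜ ∩ t = t \ s ∧ sᶜ \ t = tᶜ :=
    ⟨Set.inter_comm _ _, by rw [Set.sdiff_eq, ← Set.compl_union, Set.union_eq_right.2 hst]⟩
  calc ∫⁻ ω in tᶜ, f ω ∂μ + c * μ t = ∫⁻ ω in tᶜ, f ω ∂μ + c * (μ (t \ s) + μ s) := by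
        rw [measure_sdiff_add_inter _ hs |>.symm, Set.inter_eq_right.2 hst]
    _ = ∫⁻ _ in t \ s, c ∂μ + ∫⁻ ω in tᶜ, f ω ∂μ + c * μ s := by rw [setLIntegral_const]; ring
    _ ≤ ∫⁻ ω in t \ s, f ω ∂μ + ∫⁻ ω in tᶜ, f ω ∂μ + c * μ s := by
        gcongr ?_ + _ + _
        exact setLIntegral_mono' (ht.diff hs) hf
    _ = ∫⁻ ω in sᶜ, f ω ∂μ + c * μ s := by
        rw [← lintegral_inter_add_sdiff _ sᶜ ht, hsplit.1, hsplit.2]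

-- The process is stopped when it first reaches `c`: `∫ W` over the paths still below `c`, plus `c`
-- times the measure of the others, does not increase in time.
lemma mul_measure_exists_le_of_supermartingale (𝓕 : Filtration ℕ mΩ) {W : ℕ → Ω → ℝ≥0∞}
    (hW : ∀ t, Measurable[𝓕 t] (W t))
    (h : ∀ t F, MeasurableSet[𝓕 t] F → ∫⁻ ω in F, W (t + 1) ω ∂μ ≤ ∫⁻ ω in F, W t ω ∂μ)
    (c : ℝ≥0∞) : c * μ {ω | ∃ t, c ≤ W t ω} ≤ ∫⁻ ω, W 0 ω ∂μ := by
  set B : ℕ → Set Ω := fun t => ⋃ i ∈ Finset.range t, {ω | c ≤ W i ω} with hB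
  have hBsucc (t : ℕ) : MeasurableSet[𝓕 t] (B (t + 1)) :=
    Finset.measurableSet_biUnion _ fun i hi =>
      𝓕.mono (Nat.lt_succ_iff.1 (Finset.mem_range.1 hi)) _
        (measurableSet_le measurable_const (hW i))
  have hBmeas (t : ℕ) : MeasurableSet (B t) :=
    t.casesOn (by simp [hB]) fun t => 𝓕.le t _ (hBsucc t)
  have hmono : Monotone B := fun s t hst =>
    Set.biUnion_subset_biUnion_left (Finset.range_mono hst)
  have hstopped (t : ℕ) : ∫⁻ ω in (B t)ᶜ, W t ω ∂μ + c * μ (B t) ≤ ∫⁻ ω, W 0 ω ∂μ := by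
    induction t with
    | zero => simp [hB]
    | succ t ih =>
      calc ∫⁻ ω in (B (t + 1))ᶜ, W (t + 1) ω ∂μ + c * μ (B (t + 1))
          ≤ ∫⁻ ω in (B (t + 1))ᶜ, W t ω ∂μ + c * μ (B (t + 1)) := by
            gcongr ?_ + _
            exact h t _ (hBsucc t).compl
        _ ≤ ∫⁻ ω in (B t)ᶜ, W t ω ∂μ + c * μ (B t) := by
            refine setLIntegral_compl_add_mul_measure_le (hBmeas t) (hBmeas (t + 1))
              (hmono t.le_succ) fun ω ⟨hω, hωt⟩ => ?_
            simp only [hB, Finset.range_add_one, Finset.set_biUnion_insert] at hω hωt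
            exact hω.resolve_right hωt
        _ ≤ _ := ih
  have hunion : {ω | ∃ t, c ≤ W t ω} = ⋃ t, B t := by
    ext ω
    simp only [Set.mem_ofPred_eq, hB, Set.mem_iUnion, Finset.mem_range, exists_prop]
    exact ⟨fun ⟨t, ht⟩ => ⟨t + 1, t, t.lt_succ_self, ht⟩, fun ⟨_, i, _, hi⟩ => ⟨i, hi⟩⟩
  rw [hunion, hmono.measure_iUnion, ENNReal.mul_iSup]
  exact iSup_le fun t => le_add_self.trans (hstopped t)

lemma mul_measure_exists_le_prod_le (𝓕 : Filtration ℕ mΩ) {g : ℕ → Ω → ℝ≥0∞}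
    (hg : ∀ t, Measurable[𝓕 (t + 1)] (g t))
    (h : ∀ t F, MeasurableSet[𝓕 t] F → ∫⁻ ω in F, g t ω ∂μ ≤ μ F) (c : ℝ≥0∞) :
    c * μ {ω | ∃ t, c ≤ ∏ i ∈ Finset.range t, g i ω} ≤ μ Set.univ := by
  have hprod (t : ℕ) : Measurable[𝓕 t] fun ω => ∏ i ∈ Finset.range t, g i ω :=
    Finset.measurable_fun_prod _ fun i hi =>
      (hg i).mono (𝓕.mono (Finset.mem_range.1 hi)) le_rfl
  refine (mul_measure_exists_le_of_supermartingale 𝓕 hprod (fun t F hF => ?_) c).trans_eq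
    (by simp)
  have hFm := 𝓕.le t F hF
  rw [← lintegral_indicator hFm, ← lintegral_indicator hFm]
  refine le_of_eq_of_le (lintegral_congr fun ω => ?_) (lintegral_mul_le_of_setLIntegral_le (𝓕.le t)
    ((hg t).mono (𝓕.le _) le_rfl) (h t) ((hprod t).indicator hF))
  simp only [Set.indicator, Finset.prod_range_succ, ite_mul, zero_mul]

lemma measure_exists_le_sum_le [IsProbabilityMeasure μ] (𝓕 : Filtration ℕ mΩ) {Z : ℕ → Ω → ℝ}
    (hZ : ∀ t, Measurable[𝓕 (t + 1)] (Z t))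
    (h : ∀ t F, MeasurableSet[𝓕 t] F → ∫⁻ ω in F, ENNReal.ofReal (Real.exp (Z t ω)) ∂μ ≤ μ F)
    (ℓ : ℝ) :
    μ {ω | ∃ t, ℓ ≤ ∑ i ∈ Finset.range t, Z i ω} ≤ ENNReal.ofReal (Real.exp (-ℓ)) := by
  have hexp (ω : Ω) (t : ℕ) : ENNReal.ofReal (Real.exp ℓ)
      ≤ ∏ i ∈ Finset.range t, ENNReal.ofReal (Real.exp (Z i ω))
      ↔ ℓ ≤ ∑ i ∈ Finset.range t, Z i ω := by
    rw [← ENNReal.ofReal_prod_of_nonneg (fun i _ => (Real.exp_pos _).le), ← Real.exp_sum,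
      ENNReal.ofReal_le_ofReal_iff (Real.exp_pos _).le, Real.exp_le_exp]
  have hville := mul_measure_exists_le_prod_le (μ := μ) 𝓕
    (fun t => (Real.measurable_exp.comp (hZ t)).ennreal_ofReal) h (ENNReal.ofReal (Real.exp ℓ))
  simp only [Function.comp_apply, hexp, measure_univ] at hville
  rw [Real.exp_neg, ENNReal.ofReal_inv_of_pos (Real.exp_pos _)]
  exact ENNReal.le_inv_iff_mul_le.2 (mul_comm (μ _) _ ▸ hville)

end Ville

section Bernstein

/-- The logarithmic factor of `confWidth`. -/
def confLog (ε : ℝ) (n : ℕ) : ℝ :=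
  1.4 * Real.log (Real.log (max (Real.exp 1) (2 * n))) + Real.log (5.2 / ε)

/-- Width after `n` observations of a time-uniform confidence bound that fails with probability at
most `ε`; this is `phi` with its parameters combined into the failure probability `failProb`. -/
def confWidth (ε : ℝ) (n : ℕ) : ℝ := if n = 0 then 1 else min 1 √(0.52 / n * confLog ε n)

/-- Failure probability of a single confidence bound. -/
def failProb (card H Shat : ℕ) (δ : ℝ) : ℝ := δ / (card * (4 * Shat + 5 * H + 7))

lemma phi_eq_confWidth (card H Shat : ℕ) (δ : ℝ) :
    phi card H Shat δ = confWidth (failProb card H Shat δ) := by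
  ext n
  rw [phi, confWidth, confLog, failProb, div_div_eq_mul_div, mul_assoc 5.2]

variable {ε : ℝ}

lemma confWidth_zero (ε : ℝ) : confWidth ε 0 = 1 := if_pos rfl

lemma confWidth_nonneg (ε : ℝ) (n : ℕ) : 0 ≤ confWidth ε n := by
  rw [confWidth]
  split_ifs
  · exact zero_le_one
  · exact le_min zero_le_one (Real.sqrt_nonneg _)

lemma confWidth_le_one (ε : ℝ) (n : ℕ) : confWidth ε n ≤ 1 := by
  rw [confWidth]
  split_ifs
  · exact le_rfl
  · exact min_le_left _ _

lemma one_le_log_max_exp_one (x : ℝ) : 1 ≤ Real.log (max (Real.exp 1) x) :=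
  (Real.le_log_iff_exp_le (lt_max_of_lt_left (Real.exp_pos 1))).2 (le_max_left _ _)

lemma confLog_mono : Monotone (confLog ε) := fun m n h => by
  unfold confLog
  have hlog := one_le_log_max_exp_one (2 * m)
  gcongr

lemma confLog_pos (hε : 0 < ε) (hε1 : ε ≤ 1) (n : ℕ) : 0 < confLog ε n := by
  have hloglog : 0 ≤ Real.log (Real.log (max (Real.exp 1) (2 * n))) :=
    Real.log_nonneg (one_le_log_max_exp_one _)
  have hlog : 0 < Real.log (5.2 / ε) := Real.log_pos (by rw [lt_div_iff₀ hε]; linarith)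
  unfold confLog
  linarith

lemma sq_confWidth_le (hε : 0 < ε) (hε1 : ε ≤ 1) {n : ℕ} (hn : n ≠ 0) :
    confWidth ε n ^ 2 ≤ 0.52 / n * confLog ε n := by
  have hL := confLog_pos hε hε1 n
  calc confWidth ε n ^ 2 ≤ √(0.52 / n * confLog ε n) ^ 2 := by
        gcongr
        · exact confWidth_nonneg ε n
        · exact (if_neg hn).trans_le (min_le_right _ _)
    _ = 0.52 / n * confLog ε n := Real.sq_sqrt (by positivity)

lemma sq_confWidth_of_lt_one (hε : 0 < ε) (hε1 : ε ≤ 1) {n : ℕ} (h : confWidth ε n < 1) :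
    confWidth ε n ^ 2 = 0.52 / n * confLog ε n := by
  have hn : n ≠ 0 := by
    rintro rfl
    exact h.ne (confWidth_zero ε)
  have hL := confLog_pos hε hε1 n
  rw [confWidth, if_neg hn] at h ⊢
  rw [min_eq_right ((min_lt_iff.1 h).resolve_left (lt_irrefl _)).le, Real.sq_sqrt (by positivity)]

lemma exp_neg_confLog_two_pow_le (hε : 0 < ε) (hε1 : ε ≤ 1) (j : ℕ) :
    Real.exp (-(10 / 7 * confLog ε (2 ^ j)))
      ≤ ε / (5.2 * Real.log 2 ^ 2) * (1 / ((j + 1 : ℕ) : ℝ) ^ 2) := by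
  set l := Real.log (max (Real.exp 1) (2 * ((2 ^ j : ℕ) : ℝ))) with hl
  have : 0 < Real.log 2 := Real.log_pos one_lt_two
  have hjl : (j + 1 : ℕ) * Real.log 2 ≤ l := by
    rw [← Real.log_pow]
    refine Real.log_le_log (by positivity) ((le_max_right _ _).trans' ?_)
    push_cast
    rw [pow_succ']
  have hl0 : 0 < l := lt_of_lt_of_le (by positivity) hjl
  have hlogε : 0 ≤ Real.log (5.2 / ε) := Real.log_nonneg (by rw [le_div_iff₀ hε]; linarith)
  calc Real.exp (-(10 / 7 * confLog ε (2 ^ j))) ≤ Real.exp (-(Real.log (l ^ 2 * (5.2 / ε)))) := by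
        rw [Real.exp_le_exp, Real.log_mul (by positivity) (by positivity), Real.log_pow, confLog,
          ← hl]
        push_cast
        linarith
    _ = (l ^ 2 * (5.2 / ε))⁻¹ := by rw [Real.exp_neg, Real.exp_log (by positivity)]
    _ ≤ (((j + 1 : ℕ) * Real.log 2) ^ 2 * (5.2 / ε))⁻¹ := by gcongr
    _ = _ := by field_simp

lemma tsum_exp_neg_confLog_two_pow_le (hε : 0 < ε) (hε1 : ε ≤ 1) :
    ∑' j : ℕ, ENNReal.ofReal (Real.exp (-(10 / 7 * confLog ε (2 ^ j)))) ≤ ENNReal.ofReal ε := by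
  have hzeta : HasSum (fun n : ℕ => 1 / ((n + 1 : ℕ) : ℝ) ^ 2) (Real.pi ^ 2 / 6) := by
    simpa using (hasSum_nat_add_iff' 1).2 hasSum_zeta_two
  have hlog2 : 0.6931 < Real.log 2 := Real.log_two_gt_d9.trans' (by norm_num)
  have hpi : Real.pi ^ 2 / 6 ≤ 5.2 * Real.log 2 ^ 2 := by
    nlinarith [Real.pi_lt_d2, Real.pi_pos]
  set c := ε / (5.2 * Real.log 2 ^ 2)
  have hsum := hzeta.mul_left c
  calc ∑' j : ℕ, ENNReal.ofReal (Real.exp (-(10 / 7 * confLog ε (2 ^ j))))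
      ≤ ∑' j : ℕ, ENNReal.ofReal (c * (1 / ((j + 1 : ℕ) : ℝ) ^ 2)) := by
        gcongr with j
        exact exp_neg_confLog_two_pow_le hε hε1 j
    _ = ENNReal.ofReal (c * (Real.pi ^ 2 / 6)) := by
        rw [← ENNReal.ofReal_tsum_of_nonneg (fun j => by positivity) hsum.summable, hsum.tsum_eq]
    _ ≤ ENNReal.ofReal (c * (5.2 * Real.log 2 ^ 2)) := by gcongr
    _ = ENNReal.ofReal ε := by rw [div_mul_cancel₀ _ (by positivity)]

lemma le_of_inv_mul_sub_lt {b v ℓ n D : ℝ} (hb : 0 < b) (hn : n * v ≤ 2 * (b ^ 2 * ℓ))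
    (hD : b⁻¹ * D - n * (b⁻¹ ^ 2 * v) < ℓ) : D ≤ 3 * b * ℓ := by
  have hscaled := mul_lt_mul_of_pos_left hD (sq_pos_of_pos hb)
  have hcancel : b ^ 2 * (b⁻¹ * D - n * (b⁻¹ ^ 2 * v)) = b * D - n * v := by field_simp
  nlinarith

-- `2.1214 ≥ 3 / √2`, the largest value of `(d² + a²) / (d a)` for `a ≤ d ≤ √2 a`.
lemma sq_add_sq_le_mul {a d : ℝ} (ha : 0 ≤ a) (had : a ≤ d) (hda : d ^ 2 ≤ 2 * a ^ 2) :
    d ^ 2 + a ^ 2 ≤ 2.1214 * (d * a) := by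
  have hd : d ≤ 1.41422 * a := abs_le_of_sq_le_sq' (by nlinarith) (by positivity) |>.2
  nlinarith [mul_nonneg (sub_nonneg.2 had) (sub_nonneg.2 hd)]

lemma le_of_div_mul_sub_lt {s l a d D : ℝ} (hs : 0 < s) (hl : 0 < l) (ha : 0 < a) (had : a ≤ d)
    (hda : d ^ 2 ≤ 2 * a ^ 2) (hD : l / (a * s) * D - d ^ 2 * ((l / (a * s)) ^ 2 * s ^ 2) < l ^ 2) :
    D ≤ 2.1214 * s * (d * l) := by
  have hscaled := mul_lt_mul_of_pos_left hD (show 0 < a * s / l by positivity)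
  have hcancel : a * s / l * (l / (a * s) * D - d ^ 2 * ((l / (a * s)) ^ 2 * s ^ 2))
      = D - s * l / a * d ^ 2 := by field_simp
  calc D ≤ s * l / a * d ^ 2 + a * s / l * l ^ 2 := by linarith
    _ = s * l / a * (d ^ 2 + a ^ 2) := by field_simp
    _ ≤ s * l / a * (2.1214 * (d * a)) := by gcongr; exact sq_add_sq_le_mul ha.le had hda
    _ = 2.1214 * s * (d * l) := by field_simp

lemma exists_tilt {b v ℓ N : ℝ} (hb : 0 < b) (hv : 0 ≤ v) (hℓ : 0 < ℓ) (hN : 0 < N) :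
    ∃ t : ℝ, 0 ≤ t ∧ t * b ≤ 1 ∧ ∀ n D : ℝ, N ≤ n → n ≤ 2 * N → t * D - n * (t ^ 2 * v) < ℓ →
      D ≤ 2.1214 * √v * √(n * ℓ) + 3 * b * ℓ := by
  rcases le_or_gt (N * v) (b ^ 2 * ℓ) with hvar | hvar
  · refine ⟨b⁻¹, by positivity, (inv_mul_cancel₀ hb.ne').le, fun n D _ hnN hD => ?_⟩
    have hnv : n * v ≤ 2 * (b ^ 2 * ℓ) := by nlinarith
    exact (le_of_inv_mul_sub_lt hb hnv hD).trans (le_add_of_nonneg_left (by positivity))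
  · have hv0 : 0 < v := pos_of_mul_pos_right (lt_trans (by positivity) hvar) hN.le
    refine ⟨√ℓ / (√N * √v), by positivity, ?_, fun n D hNn hnN hD => ?_⟩
    · rw [div_mul_eq_mul_div, div_le_one (by positivity), ← Real.sqrt_mul hN.le]
      refine Real.le_sqrt_of_sq_le ?_
      rw [mul_pow, Real.sq_sqrt hℓ.le]
      linarith
    · have hn : 0 ≤ n := hN.le.trans hNn
      refine le_add_of_le_of_nonneg ?_ (by positivity)
      rw [Real.sqrt_mul hn]
      refine le_of_div_mul_sub_lt (Real.sqrt_pos.2 hv0) (Real.sqrt_pos.2 hℓ) (Real.sqrt_pos.2 hN)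
        (Real.sqrt_le_sqrt hNn) ?_ ?_
      · rwa [Real.sq_sqrt hn, Real.sq_sqrt hN.le]
      · rwa [Real.sq_sqrt hn, Real.sq_sqrt hv, Real.sq_sqrt hℓ.le]

lemma le_mul_confWidth_of_le (hε : 0 < ε) (hε1 : ε ≤ 1) {n m : ℕ} (hm : m ≤ n) {b v D : ℝ}
    (hb : 0 ≤ b) (hw : confWidth ε n < 1)
    (hD : D ≤ 2.1214 * √v * √(n * (10 / 7 * confLog ε m)) + 3 * b * (10 / 7 * confLog ε m)) :
    D ≤ n * (3.52 * √v * confWidth ε n + 8.25 * b * confWidth ε n ^ 2) := by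
  have hφ0 := confWidth_nonneg ε n
  have hφ := sq_confWidth_of_lt_one hε hε1 hw
  have hn : (0 : ℝ) < n := Nat.cast_pos.2 <| Nat.pos_of_ne_zero <| by
    rintro rfl
    exact hw.ne (confWidth_zero ε)
  set φ := confWidth ε n
  have hlog : confLog ε m ≤ n * φ ^ 2 / 0.52 := by
    rw [hφ]
    field_simp
    exact confLog_mono hm
  have hfirst : √(n * (10 / 7 * confLog ε m)) ≤ 3.52 / 2.1214 * (n * φ) := by
    refine Real.sqrt_le_iff.2 ⟨by positivity, ?_⟩
    calc n * (10 / 7 * confLog ε m) ≤ n * (10 / 7 * (n * φ ^ 2 / 0.52)) := by gcongr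
      _ = 10 / 7 / 0.52 * (n * φ) ^ 2 := by ring
      _ ≤ (3.52 / 2.1214) ^ 2 * (n * φ) ^ 2 := by gcongr; norm_num
      _ = (3.52 / 2.1214 * (n * φ)) ^ 2 := by ring
  have hsecond : 10 / 7 * confLog ε m ≤ 8.25 / 3 * (n * φ ^ 2) := by
    calc 10 / 7 * confLog ε m ≤ 10 / 7 * (n * φ ^ 2 / 0.52) := by gcongr
      _ = 10 / 7 / 0.52 * (n * φ ^ 2) := by ring
      _ ≤ 8.25 / 3 * (n * φ ^ 2) := mul_le_mul_of_nonneg_right (by norm_num) (by positivity)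
  calc D ≤ 2.1214 * √v * (3.52 / 2.1214 * (n * φ)) + 3 * b * (8.25 / 3 * (n * φ ^ 2)) := by
        refine hD.trans ?_
        gcongr
    _ = n * (3.52 * √v * φ + 8.25 * b * φ ^ 2) := by ring

variable {Ω : Type*}

open Classical in
lemma sum_indicator_mul_sub (O : ℕ → Set Ω) (Z : ℕ → Ω → ℝ) (l c : ℝ) (t : ℕ) (ω : Ω) :
    ∑ i ∈ Finset.range t, (O i).indicator (fun ω => l * Z i ω - c) ω
      = l * ∑ i ∈ Finset.range t, (O i).indicator (Z i) ω
        - {i ∈ Finset.range t | ω ∈ O i}.card * c := by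
  simp only [Set.indicator, Finset.card_filter, Nat.cast_sum, Finset.mul_sum, Finset.sum_mul,
    ← Finset.sum_sub_distrib]
  refine Finset.sum_congr rfl fun i _ => ?_
  split_ifs <;> simp

open Classical in
/-- Event that the sum of the increments `Z i` over the times `i` at which `O i` occurs violates,
at some time, its Bernstein bound with range `b` and conditional variance `v`. -/
def BernsteinFail (ε b v : ℝ) (O : ℕ → Set Ω) (Z : ℕ → Ω → ℝ) : Set Ω :=
  {ω | ∃ t n : ℕ, {i ∈ Finset.range t | ω ∈ O i}.card = n ∧ confWidth ε n < 1 ∧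
    n * (3.52 * √v * confWidth ε n + 8.25 * b * confWidth ε n ^ 2)
      < ∑ i ∈ Finset.range t, (O i).indicator (Z i) ω}

open Classical in
/-- Two-sided version of `BernsteinFail`. -/
def BernsteinAbsFail (ε b v : ℝ) (O : ℕ → Set Ω) (Z : ℕ → Ω → ℝ) : Set Ω :=
  {ω | ∃ t n : ℕ, {i ∈ Finset.range t | ω ∈ O i}.card = n ∧ confWidth ε n < 1 ∧
    n * (3.52 * √v * confWidth ε n + 8.25 * b * confWidth ε n ^ 2)
      < |∑ i ∈ Finset.range t, (O i).indicator (Z i) ω|}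

lemma bernsteinAbsFail_eq_union (ε b v : ℝ) (O : ℕ → Set Ω) (Z : ℕ → Ω → ℝ) :
    BernsteinAbsFail ε b v O Z = BernsteinFail ε b v O Z ∪ BernsteinFail ε b v O (-Z) := by
  ext ω
  have hneg (t : ℕ) : ∑ i ∈ Finset.range t, (O i).indicator ((-Z) i) ω
      = -∑ i ∈ Finset.range t, (O i).indicator (Z i) ω := by
    simp only [Pi.neg_apply, Set.indicator_neg', Finset.sum_neg_distrib]
  simp only [BernsteinAbsFail, BernsteinFail, Set.mem_union, Set.mem_ofPred_eq, lt_abs, and_or_left,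
    exists_or, hneg]

variable [mΩ : MeasurableSpace Ω] {μ : Measure Ω}

lemma setLIntegral_exp_indicator_le {O F : Set Ω} (hO : MeasurableSet O) (hF : MeasurableSet F)
    {Y : Ω → ℝ} (h : ∫⁻ ω in F ∩ O, ENNReal.ofReal (Real.exp (Y ω)) ∂μ ≤ μ (F ∩ O)) :
    ∫⁻ ω in F, ENNReal.ofReal (Real.exp (O.indicator Y ω)) ∂μ ≤ μ F := by
  rw [← lintegral_inter_add_sdiff _ _ hO, ← measure_inter_add_sdiff F hO]
  refine add_le_add ?_ (le_of_eq ?_)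
  · refine h.trans_eq' (setLIntegral_congr_fun (hF.inter hO) fun ω hω => ?_)
    simp only [Set.indicator_of_mem hω.2]
  · rw [← setLIntegral_one]
    refine setLIntegral_congr_fun (hF.diff hO) fun ω hω => ?_
    simp only [Set.indicator_of_notMem hω.2, Real.exp_zero, ENNReal.ofReal_one]

-- Peeling: on the event that the number of observations lies in `[2 ^ j, 2 ^ (j + 1)]` the tilt of
-- `exists_tilt` makes the exponential supermartingale yield a bound of the order of `confWidth`.
lemma measure_bernsteinFail_le [IsProbabilityMeasure μ] (𝓕 : Filtration ℕ mΩ) (hε : 0 < ε)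
    (hε1 : ε ≤ 1) {O : ℕ → Set Ω} (hO : ∀ t, MeasurableSet[𝓕 t] (O t)) {Z : ℕ → Ω → ℝ}
    (hZ : ∀ t, Measurable[𝓕 (t + 1)] (Z t)) {b v : ℝ} (hb : 0 < b) (hv : 0 ≤ v)
    (hmgf : ∀ l : ℝ, 0 ≤ l → l * b ≤ 1 → ∀ t F, MeasurableSet[𝓕 t] F → F ⊆ O t →
      ∫⁻ ω in F, ENNReal.ofReal (Real.exp (l * Z t ω - l ^ 2 * v)) ∂μ ≤ μ F) :
    μ (BernsteinFail ε b v O Z) ≤ ENNReal.ofReal ε := by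
  classical
  set ℓ : ℕ → ℝ := fun j => 10 / 7 * confLog ε (2 ^ j)
  have hℓ (j : ℕ) : 0 < ℓ j := mul_pos (by norm_num) (confLog_pos hε hε1 _)
  choose l hl0 hlb hl using fun j : ℕ => exists_tilt hb hv (hℓ j) (N := (2 : ℝ) ^ j) (by positivity)
  set Y : ℕ → ℕ → Ω → ℝ := fun j t => (O t).indicator fun ω => l j * Z t ω - l j ^ 2 * v
  set B : ℕ → Set Ω := fun j => {ω | ∃ t, ℓ j ≤ ∑ i ∈ Finset.range t, Y j i ω}
  have hB (j : ℕ) : μ (B j) ≤ ENNReal.ofReal (Real.exp (-ℓ j)) := by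
    refine measure_exists_le_sum_le 𝓕 (fun t => ?_) (fun t F hF => ?_) _
    · exact (((hZ t).const_mul _).sub_const _).indicator (𝓕.mono t.le_succ _ (hO t))
    · exact setLIntegral_exp_indicator_le (𝓕.le t _ (hO t)) (𝓕.le t _ hF)
        (hmgf (l j) (hl0 j) (hlb j) t _ (hF.inter (hO t)) Set.inter_subset_right)
  suffices BernsteinFail ε b v O Z ⊆ ⋃ j, B j from (measure_mono this).trans <|
    (measure_iUnion_le B).trans <|
      (ENNReal.tsum_le_tsum hB).trans (tsum_exp_neg_confLog_two_pow_le hε hε1)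
  rintro ω ⟨t, n, hcard, hw, hlt⟩
  by_contra hnot
  have hn : n ≠ 0 := by
    rintro rfl
    exact hw.ne (confWidth_zero ε)
  set j := Nat.log 2 n
  have hjn : 2 ^ j ≤ n := Nat.pow_log_le_self 2 hn
  have hnj : n ≤ 2 * 2 ^ j := pow_succ' 2 j ▸ (Nat.lt_pow_succ_log_self one_lt_two n).le
  have hsmall : ∑ i ∈ Finset.range t, Y j i ω < ℓ j :=
    lt_of_not_ge fun hle => hnot (Set.mem_iUnion.2 ⟨j, t, hle⟩)
  rw [sum_indicator_mul_sub, hcard] at hsmall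
  exact hlt.not_ge <| le_mul_confWidth_of_le hε hε1 hjn hb.le hw <|
    hl j n _ (mod_cast hjn) (mod_cast hnj) hsmall

lemma measure_bernsteinAbsFail_le [IsProbabilityMeasure μ] (𝓕 : Filtration ℕ mΩ) (hε : 0 < ε)
    (hε1 : ε ≤ 1) {O : ℕ → Set Ω} (hO : ∀ t, MeasurableSet[𝓕 t] (O t)) {Z : ℕ → Ω → ℝ}
    (hZ : ∀ t, Measurable[𝓕 (t + 1)] (Z t)) {b v : ℝ} (hb : 0 < b) (hv : 0 ≤ v)
    (hmgf : ∀ l : ℝ, |l| * b ≤ 1 → ∀ t F, MeasurableSet[𝓕 t] F → F ⊆ O t →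
      ∫⁻ ω in F, ENNReal.ofReal (Real.exp (l * Z t ω - l ^ 2 * v)) ∂μ ≤ μ F) :
    μ (BernsteinAbsFail ε b v O Z) ≤ 2 * ENNReal.ofReal ε := by
  rw [bernsteinAbsFail_eq_union, two_mul]
  refine (measure_union_le _ _).trans (add_le_add ?_ ?_)
  · exact measure_bernsteinFail_le 𝓕 hε hε1 hO hZ hb hv fun l hl0 hl =>
      hmgf l (by rwa [abs_of_nonneg hl0])
  · refine measure_bernsteinFail_le 𝓕 hε hε1 hO (fun t => (hZ t).neg) hb hv
      fun l hl0 hl t F hF hFO => ?_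
    simpa only [Pi.neg_apply, mul_neg, neg_mul, neg_sq]
      using hmgf (-l) (by rwa [abs_neg, abs_of_nonneg hl0]) t F hF hFO

end Bernstein

section ExponentialMoments

open ProbabilityTheory

lemma exp_mul_sub_sub_le {x m b l v : ℝ} (hx : x ∈ Set.Icc 0 b) (hm : m ∈ Set.Icc 0 b)
    (hl : |l| * b ≤ 1) : Real.exp (l * (x - m) - l ^ 2 * v)
      ≤ Real.exp (-(l ^ 2 * v)) * (1 + l * (x - m) + l ^ 2 * (x - m) ^ 2) := by
  have hsmall : |l * (x - m)| ≤ 1 := by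
    rw [abs_mul]
    refine (mul_le_mul_of_nonneg_left ?_ (abs_nonneg l)).trans hl
    exact abs_sub_le_of_nonneg_of_le hx.1 hx.2 hm.1 hm.2
  rw [sub_eq_neg_add, Real.exp_add]
  gcongr
  linarith [(abs_le.1 (Real.abs_exp_sub_one_sub_id_le hsmall)).2, mul_pow l (x - m) 2]

lemma exp_neg_mul_one_add_le_one {a b : ℝ} (h : a ≤ b) : Real.exp (-b) * (1 + a) ≤ 1 := by
  rw [Real.exp_neg, inv_mul_le_iff₀ (Real.exp_pos _), mul_one]
  linarith [Real.add_one_le_exp b]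

lemma dotProduct_exp_le_one {ι : Type*} [Fintype ι] {p f : ι → ℝ} (hp : p ∈ stdSimplex ℝ ι)
    {b v l : ℝ} (hf : ∀ i, f i ∈ Set.Icc 0 b) (hv : wvar p f ≤ v) (hl : |l| * b ≤ 1) :
    (p ⬝ᵥ fun i => Real.exp (l * (f i - p ⬝ᵥ f) - l ^ 2 * v)) ≤ 1 := by
  have hm := dotProduct_mem_Icc_zero hp hf
  have hexpand : (fun i => Real.exp (-(l ^ 2 * v))
        * (1 + l * (f i - p ⬝ᵥ f) + l ^ 2 * (f i - p ⬝ᵥ f) ^ 2))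
      = Real.exp (-(l ^ 2 * v)) • ((fun _ => 1) + l • (f - fun _ => p ⬝ᵥ f)
        + l ^ 2 • fun i => (f i - p ⬝ᵥ f) ^ 2) := rfl
  calc (p ⬝ᵥ fun i => Real.exp (l * (f i - p ⬝ᵥ f) - l ^ 2 * v))
      ≤ p ⬝ᵥ fun i => Real.exp (-(l ^ 2 * v))
        * (1 + l * (f i - p ⬝ᵥ f) + l ^ 2 * (f i - p ⬝ᵥ f) ^ 2) :=
        dotProduct_le_dotProduct_of_nonneg_left (fun i => exp_mul_sub_sub_le (hf i) hm hl) hp.1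
    _ = Real.exp (-(l ^ 2 * v)) * (1 + l ^ 2 * wvar p f) := by
        rw [hexpand]
        simp only [dotProduct_smul, dotProduct_add, dotProduct_sub, dotProduct_const hp,
          ← wvar_eq_dotProduct_sub_sq hp, smul_eq_mul, sub_self, mul_zero, add_zero]
    _ ≤ 1 := exp_neg_mul_one_add_le_one (by gcongr)

variable {E : Type*} [MeasurableSpace E] {ν : Measure E} [IsProbabilityMeasure ν] {f : E → ℝ}

lemma integral_mem_Icc_zero {b : ℝ} (hf : AEMeasurable f ν) (hfb : ∀ᵐ x ∂ν, f x ∈ Set.Icc 0 b) :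
    ν[f] ∈ Set.Icc 0 b := by
  refine ⟨integral_nonneg_of_ae (hfb.mono fun x hx => hx.1), ?_⟩
  calc ν[f] ≤ ∫ _, b ∂ν :=
        integral_mono_ae (Integrable.of_mem_Icc 0 b hf hfb) (integrable_const b)
          (hfb.mono fun x hx => hx.2)
    _ = b := by simp

lemma lintegral_exp_le_one {b v l : ℝ} (hf : AEMeasurable f ν)
    (hfb : ∀ᵐ x ∂ν, f x ∈ Set.Icc 0 b) (hv : Var[f; ν] ≤ v) (hl : |l| * b ≤ 1) :
    ∫⁻ x, ENNReal.ofReal (Real.exp (l * (f x - ν[f]) - l ^ 2 * v)) ∂ν ≤ 1 := by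
  set q : E → ℝ := fun x =>
    Real.exp (-(l ^ 2 * v)) * (1 + l * (f x - ν[f]) + l ^ 2 * (f x - ν[f]) ^ 2)
  have hfL : MemLp f 2 ν := memLp_of_bounded hfb hf.aestronglyMeasurable 2
  have hdev : Integrable (fun x => f x - ν[f]) ν :=
    (hfL.integrable one_le_two).sub (integrable_const _)
  have hsq : Integrable (fun x => (f x - ν[f]) ^ 2) ν := (hfL.sub (memLp_const _)).integrable_sq
  have hlin : Integrable (fun x => 1 + l * (f x - ν[f])) ν :=
    (integrable_const 1).add (hdev.const_mul l)
  have hq : Integrable q ν := (hlin.add (hsq.const_mul _)).const_mul _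
  have hle : ∀ᵐ x ∂ν, Real.exp (l * (f x - ν[f]) - l ^ 2 * v) ≤ q x :=
    hfb.mono fun x hx => exp_mul_sub_sub_le hx (integral_mem_Icc_zero hf hfb) hl
  have hqint : ν[q] = Real.exp (-(l ^ 2 * v)) * (1 + l ^ 2 * Var[f; ν]) := by
    simp only [q]
    rw [integral_const_mul, integral_add hlin (hsq.const_mul _),
      integral_add (integrable_const 1) (hdev.const_mul l), integral_const_mul, integral_const_mul,
      integral_sub (hfL.integrable one_le_two) (integrable_const _), variance_eq_integral hf]
    simp
  calc ∫⁻ x, ENNReal.ofReal (Real.exp (l * (f x - ν[f]) - l ^ 2 * v)) ∂ν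
      ≤ ∫⁻ x, ENNReal.ofReal (q x) ∂ν :=
        lintegral_mono_ae (hle.mono fun x hx => ENNReal.ofReal_le_ofReal hx)
    _ = ENNReal.ofReal ν[q] :=
        (ofReal_integral_eq_lintegral_ofReal hq
          (hle.mono fun x hx => (Real.exp_pos _).le.trans hx)).symm
    _ ≤ 1 := by
        rw [hqint, ENNReal.ofReal_le_one]
        exact exp_neg_mul_one_add_le_one (by gcongr)

lemma sq_sub_mem_Icc_zero_one {x m : ℝ} (hx : x ∈ Set.Icc 0 1) (hm : m ∈ Set.Icc 0 1) :
    (x - m) ^ 2 ∈ Set.Icc 0 1 :=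
  ⟨sq_nonneg _, (sq_le_one_iff_abs_le_one _).2 <|
    abs_sub_le_of_nonneg_of_le hx.1 hx.2 hm.1 hm.2⟩

lemma ae_sq_sub_integral_mem_Icc (hf : AEMeasurable f ν) (hfb : ∀ᵐ x ∂ν, f x ∈ Set.Icc 0 1) :
    ∀ᵐ x ∂ν, (f x - ν[f]) ^ 2 ∈ Set.Icc 0 1 :=
  hfb.mono fun _ hx => sq_sub_mem_Icc_zero_one hx (integral_mem_Icc_zero hf hfb)

lemma variance_sq_sub_integral_le (hf : AEMeasurable f ν) (hfb : ∀ᵐ x ∂ν, f x ∈ Set.Icc 0 1) :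
    Var[fun x => (f x - ν[f]) ^ 2; ν] ≤ Var[f; ν] := by
  have hsq := ae_sq_sub_integral_mem_Icc hf hfb
  have hmeas : AEMeasurable (fun x => (f x - ν[f]) ^ 2) ν := (hf.sub_const _).pow_const 2
  calc Var[fun x => (f x - ν[f]) ^ 2; ν] ≤ ∫ x, ((f x - ν[f]) ^ 2) ^ 2 ∂ν :=
        variance_le_expectation_sq hmeas.aestronglyMeasurable
    _ ≤ ∫ x, (f x - ν[f]) ^ 2 ∂ν :=
        integral_mono_of_nonneg (ae_of_all _ fun _ => sq_nonneg _)
          (Integrable.of_mem_Icc 0 1 hmeas hsq)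
          (hsq.mono fun x hx => pow_le_of_le_one hx.1 hx.2 two_ne_zero)
    _ = Var[f; ν] := (variance_eq_integral hf).symm

end ExponentialMoments

section Values

open ProbabilityTheory

variable {X : Finset (S × A)}

/-- Transition probabilities as real weights. -/
def MDP.transProb (M : MDP X) (x : X) (s : S) : ℝ := (M.P x s).toReal

/-- Value of `π` with `j` steps to go in an episode of length `H`. -/
def MDP.valueToGo [Fintype S] (M : MDP X) (H : ℕ) (π : Policy X) : ℕ → S → ℝ
  | 0, _ => 0
  | j + 1, s => M.meanReward (π.pair (H - (j + 1)) s)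
      + M.transProb (π.pair (H - (j + 1)) s) ⬝ᵥ M.valueToGo H π j

/-- Optimal value with `j` steps to go, defined by the Bellman recursion. -/
def MDP.optValueToGo [Fintype S] (M : MDP X) : ℕ → S → ℝ
  | 0, _ => 0
  | j + 1, s => ⨆ a : {a : A // (s, a) ∈ X},
      (M.meanReward ⟨(s, a.1), a.2⟩ + M.transProb ⟨(s, a.1), a.2⟩ ⬝ᵥ M.optValueToGo j)

variable (M : MDP X)

lemma MDP.ae_mem_Icc (x : X) : ∀ᵐ r ∂M.PR x, r ∈ Set.Icc (0 : ℝ) 1 := M.PR_bdd x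

lemma MDP.meanReward_mem_Icc (x : X) : M.meanReward x ∈ Set.Icc (0 : ℝ) 1 :=
  have := M.PR_prob x
  integral_mem_Icc_zero aemeasurable_id (M.ae_mem_Icc x)

variable [Fintype S]

lemma MDP.transProb_mem_stdSimplex (x : X) : M.transProb x ∈ stdSimplex ℝ S := by
  refine ⟨fun s => ENNReal.toReal_nonneg, ?_⟩
  simp only [MDP.transProb]
  rw [← ENNReal.toReal_sum fun s _ => (M.P x).apply_ne_top s,
    ← tsum_fintype (L := .unconditional S), (M.P x).tsum_coe, ENNReal.toReal_one]

lemma MDP.le_optValueToGo_succ (j : ℕ) (s : S) (a : A) (ha : (s, a) ∈ X) :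
    M.meanReward ⟨(s, a), ha⟩ + M.transProb ⟨(s, a), ha⟩ ⬝ᵥ M.optValueToGo j
      ≤ M.optValueToGo (j + 1) s := by
  have : Finite {a : A // (s, a) ∈ X} :=
    Finite.of_injective (fun a => (⟨(s, a.1), a.2⟩ : X)) fun a b h => by
      ext
      simpa using h
  exact le_ciSup (f := fun a : {a : A // (s, a) ∈ X} =>
    M.meanReward ⟨(s, a.1), a.2⟩ + M.transProb ⟨(s, a.1), a.2⟩ ⬝ᵥ M.optValueToGo j)
    (Set.finite_range _).bddAbove ⟨a, ha⟩

lemma MDP.optValueToGo_mem_Icc (hX : ∀ s, ∃ a, (s, a) ∈ X) (j : ℕ) :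
    ∀ s, M.optValueToGo j s ∈ Set.Icc (0 : ℝ) j := by
  induction j with
  | zero => simp [MDP.optValueToGo]
  | succ j ih =>
    refine fun s => ⟨?_, ?_⟩
    · obtain ⟨a, ha⟩ := hX s
      refine le_trans ?_ (M.le_optValueToGo_succ j s a ha)
      exact add_nonneg (M.meanReward_mem_Icc _).1
        (dotProduct_nonneg_of_nonneg (M.transProb_mem_stdSimplex _).1 fun s => (ih s).1)
    · have : Nonempty {a : A // (s, a) ∈ X} := nonempty_subtype.2 (hX s)
      refine ciSup_le fun a => ?_
      push_cast
      rw [add_comm]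
      exact add_le_add
        (dotProduct_le_of_forall_le (M.transProb_mem_stdSimplex _) fun s => (ih s).2)
        (M.meanReward_mem_Icc _).2

lemma MDP.valueToGo_mem_Icc (H : ℕ) (π : Policy X) (j : ℕ) :
    ∀ s, M.valueToGo H π j s ∈ Set.Icc 0 (M.optValueToGo j s) := by
  induction j with
  | zero => simp [MDP.optValueToGo, MDP.valueToGo]
  | succ j ih =>
    refine fun s => ⟨?_, ?_⟩
    · exact add_nonneg (M.meanReward_mem_Icc _).1
        (dotProduct_nonneg_of_nonneg (M.transProb_mem_stdSimplex _).1 fun s => (ih s).1)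
    · refine le_trans ?_ (M.le_optValueToGo_succ j s _ (π (H - (j + 1)) s).2)
      exact add_le_add le_rfl (dotProduct_le_dotProduct_of_nonneg_left (fun s => (ih s).2)
        (M.transProb_mem_stdSimplex _).1)

lemma MDP.sum_stateLaw_succ_mul (π : Policy X) (s : S) (h : ℕ) (f : S → ℝ) :
    ∑ s', (M.stateLaw π s (h + 1) s').toReal * f s'
      = ∑ s', (M.stateLaw π s h s').toReal * M.transProb (π.pair h s') ⬝ᵥ f := by
  have hsucc (s' : S) : (M.stateLaw π s (h + 1) s').toReal
      = ∑ s'', (M.stateLaw π s h s'').toReal * M.transProb (π.pair h s'') s' := by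
    rw [MDP.stateLaw, PMF.bind_apply, tsum_fintype, ENNReal.toReal_sum fun s'' _ =>
      ENNReal.mul_ne_top (PMF.apply_ne_top _ _) (PMF.apply_ne_top _ _)]
    simp only [ENNReal.toReal_mul, MDP.transProb]
  simp only [hsucc, dotProduct, Finset.sum_mul, Finset.mul_sum, mul_assoc]
  exact Finset.sum_comm

lemma MDP.valueToGo_eq_sum_range_add (H : ℕ) (π : Policy X) (s : S) {m : ℕ} (hm : m ≤ H) :
    M.valueToGo H π H s
      = ∑ h ∈ Finset.range m, ∑ s', (M.stateLaw π s h s').toReal * M.meanReward (π.pair h s')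
        + ∑ s', (M.stateLaw π s m s').toReal * M.valueToGo H π (H - m) s' := by
  induction m with
  | zero =>
    classical
    simp [MDP.stateLaw, PMF.pure_apply, apply_ite ENNReal.toReal]
  | succ m ih =>
    rw [ih (by omega), Finset.sum_range_succ, add_assoc, M.sum_stateLaw_succ_mul,
      ← Finset.sum_add_distrib]
    congr 1
    refine Finset.sum_congr rfl fun s' _ => ?_
    rw [show H - m = H - (m + 1) + 1 by omega, MDP.valueToGo,
      show H - (H - (m + 1) + 1) = m by omega, mul_add]

lemma MDP.value_eq_valueToGo (H : ℕ) (π : Policy X) (s : S) :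
    M.value H π s = M.valueToGo H π H s := by
  rw [M.valueToGo_eq_sum_range_add H π s le_rfl, MDP.value]
  simp [MDP.valueToGo]

lemma MDP.value_le_optValueToGo (H : ℕ) (π : Policy X) (s : S) :
    M.value H π s ≤ M.optValueToGo H s :=
  (M.value_eq_valueToGo H π s).trans_le (M.valueToGo_mem_Icc H π H s).2

lemma MDP.value_le_optValue (H : ℕ) (π : Policy X) (s : S) : M.value H π s ≤ M.optValue H s :=
  le_ciSup (f := fun π : Policy X => M.value H π s)
    ⟨M.optValueToGo H s, Set.forall_mem_range.2 fun π => M.value_le_optValueToGo H π s⟩ π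

lemma MDP.optValue_le_optValueToGo [Nonempty (Policy X)] (H : ℕ) (s : S) :
    M.optValue H s ≤ M.optValueToGo H s :=
  ciSup_le fun π => M.value_le_optValueToGo H π s

end Values

section Planning

open ProbabilityTheory

variable {X : Finset (S × A)} [Fintype S]

/-- The estimates of the model `st` are within their confidence bounds of width `confWidth ε`;
`dev_r2` controls the empirical variance of the rewards around their true mean. -/
structure GoodStats (M : MDP X) (H Shat : ℕ) (ε : ℝ) (st : Stats X) : Prop where
  P_mem : ∀ x, st.P x ∈ stdSimplex ℝ S
  r_mem : ∀ x, st.r x ∈ Set.Icc 0 1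
  r2_le : ∀ x, st.r2 x ≤ 1
  dev_P : ∀ x, st.n x ≠ 0 →
    DevBound (M.transProb x) (st.P x) (M.transProb x) 3.52 8.25 (confWidth ε (st.n x)) Shat
  dev_r : ∀ x, st.n x ≠ 0 → |st.r x - M.meanReward x|
    ≤ 3.52 * √Var[id; M.PR x] * confWidth ε (st.n x) + 8.25 * confWidth ε (st.n x) ^ 2
  dev_r2 : ∀ x, st.n x ≠ 0 →
    |st.r2 x - 2 * M.meanReward x * st.r x + M.meanReward x ^ 2 - Var[id; M.PR x]|
      ≤ 3.52 * √Var[id; M.PR x] * confWidth ε (st.n x) + 8.25 * confWidth ε (st.n x) ^ 2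
  dev_opt : ∀ x, st.n x ≠ 0 → ∀ j < H,
    |st.P x ⬝ᵥ M.optValueToGo j - M.transProb x ⬝ᵥ M.optValueToGo j|
      ≤ 3.52 * wsd (M.transProb x) (M.optValueToGo j) * confWidth ε (st.n x)
        + 8.25 * j * confWidth ε (st.n x) ^ 2

/-- Upper and lower value bounds `V` with `j` steps to go that are valid for `M` and for the
value `f` of the played policy. -/
structure ValidBounds (M : MDP X) (j : ℕ) (f : S → ℝ) (V : (S → ℝ) × (S → ℝ)) : Prop where
  lower_nonneg : 0 ≤ V.2
  lower_le : V.2 ≤ f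
  le_opt : f ≤ M.optValueToGo j
  opt_le : M.optValueToGo j ≤ V.1
  upper_le : ∀ s, V.1 s ≤ j

lemma sqrt_natCast_le_self (n : ℕ) : √(n : ℝ) ≤ n :=
  Real.sqrt_le_iff.2 ⟨n.cast_nonneg, mod_cast Nat.le_self_pow two_ne_zero n⟩

variable {M : MDP X} {H Shat : ℕ} {ε δ : ℝ} {st : Stats X} {x : X} {j : ℕ} {f : S → ℝ}
  {V : (S → ℝ) × (S → ℝ)}

lemma ValidBounds.lower_le_upper (hV : ValidBounds M j f V) : V.2 ≤ V.1 :=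
  hV.lower_le.trans (hV.le_opt.trans hV.opt_le)

lemma ValidBounds.opt_mem_Icc (hV : ValidBounds M j f V) (s : S) :
    M.optValueToGo j s ∈ Set.Icc (0 : ℝ) j :=
  ⟨(hV.lower_nonneg.trans (hV.lower_le.trans hV.le_opt)) s, (hV.opt_le s).trans (hV.upper_le s)⟩

lemma ValidBounds.upper_sub_opt_mem_Icc (hV : ValidBounds M j f V) (s : S) :
    (V.1 - M.optValueToGo j) s ∈ Set.Icc (0 : ℝ) j :=
  ⟨sub_nonneg.2 (hV.opt_le s),
    (sub_le_self _ (hV.opt_mem_Icc s).1).trans (hV.upper_le s)⟩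

lemma ValidBounds.opt_sub_mem_Icc (hV : ValidBounds M j f V) (s : S) :
    (M.optValueToGo j - f) s ∈ Set.Icc (0 : ℝ) j :=
  ⟨sub_nonneg.2 (hV.le_opt s),
    (sub_le_self _ ((hV.lower_nonneg.trans hV.lower_le) s)).trans (hV.opt_mem_Icc s).2⟩

lemma ValidBounds.upper_sub_lower_mem_Icc (hV : ValidBounds M j f V) (s : S) :
    (V.1 - V.2) s ∈ Set.Icc (0 : ℝ) j :=
  ⟨sub_nonneg.2 (hV.lower_le_upper s),
    (sub_le_self _ (hV.lower_nonneg s)).trans (hV.upper_le s)⟩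

lemma GoodStats.dev_P_symm (hg : GoodStats M H Shat ε st) (hn : st.n x ≠ 0) :
    DevBound (st.P x) (M.transProb x) (st.P x) 3.52 26.4 (confWidth ε (st.n x)) Shat :=
  (hg.dev_P x hn).symm (c := 5.14) (confWidth_nonneg _ _) (hg.P_mem x).1 (by norm_num)
    (by norm_num) (by norm_num) (by norm_num)

-- The empirical variance differs from that of `dev_r2` by the square of the error of the mean, so
-- the deviation bounds control the true variance by the empirical one.
lemma GoodStats.sqrt_variance_le (hg : GoodStats M H Shat ε st) (hn : st.n x ≠ 0) :
    √Var[id; M.PR x] ≤ √(st.r2 x - st.r x ^ 2) + 8.9 * confWidth ε (st.n x) := by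
  have hφ := confWidth_nonneg ε (st.n x)
  have hsmall : |st.r x - M.meanReward x| ≤ 1 :=
    abs_sub_le_of_nonneg_of_le (hg.r_mem x).1 (hg.r_mem x).2 (M.meanReward_mem_Icc x).1
      (M.meanReward_mem_Icc x).2
  have hsq : (st.r x - M.meanReward x) ^ 2 ≤ |st.r x - M.meanReward x| := by
    rw [← sq_abs, sq]
    exact mul_le_of_le_one_left (abs_nonneg _) hsmall
  have hdev := hg.dev_r x hn
  have hdev2 := (abs_le.1 (hg.dev_r2 x hn)).1
  set φ := confWidth ε (st.n x)
  refine le_add_of_sq_le_sq_add (a := 7.04 * φ) (b := 16.5 * φ ^ 2) ?_ (Real.sqrt_nonneg _)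
    (by linarith) (by nlinarith)
  have hemp : st.r2 x - st.r x ^ 2 ≤ √(st.r2 x - st.r x ^ 2) ^ 2 :=
    (le_total 0 _).elim (fun h => (Real.sq_sqrt h).ge) fun h => h.trans (sq_nonneg _)
  have htrue := Real.sq_sqrt (variance_nonneg id (M.PR x))
  linarith

lemma GoodStats.abs_r_sub_le (hg : GoodStats M H Shat ε st) (hn : st.n x ≠ 0) :
    |st.r x - M.meanReward x| ≤ 3.52 * √(st.r2 x - st.r x ^ 2) * confWidth ε (st.n x)
      + 39.6 * confWidth ε (st.n x) ^ 2 := by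
  have hσ := mul_le_mul_of_nonneg_right (hg.sqrt_variance_le hn) (confWidth_nonneg ε (st.n x))
  linarith [hg.dev_r x hn, sq_nonneg (confWidth ε (st.n x))]

lemma GoodStats.abs_dotProduct_opt_sub_le (hg : GoodStats M H Shat ε st)
    (hV : ValidBounds M j f V) (hS : 1 ≤ Shat) (hn : st.n x ≠ 0) (hj : j < H) :
    |st.P x ⬝ᵥ M.optValueToGo j - M.transProb x ⬝ᵥ M.optValueToGo j|
      ≤ 3.52 * wsd (st.P x) (M.optValueToGo j) * confWidth ε (st.n x)
        + 26.6 * Shat * j * confWidth ε (st.n x) ^ 2 := by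
  have hφ := confWidth_nonneg ε (st.n x)
  have hsd := (hg.dev_P_symm hn).wsd_le (c := 5.2) (by norm_num) (by norm_num) hφ j.cast_nonneg
    hV.opt_mem_Icc (hg.P_mem x) (M.transProb_mem_stdSimplex x) (by norm_num) (by norm_num)
    (by norm_num)
  have hdev := hg.dev_opt x hn j hj
  set φ := confWidth ε (st.n x)
  have hS1 : (1 : ℝ) ≤ Shat := mod_cast hS
  calc |st.P x ⬝ᵥ M.optValueToGo j - M.transProb x ⬝ᵥ M.optValueToGo j|
      ≤ 3.52 * (wsd (st.P x) (M.optValueToGo j) + 5.2 * √Shat * j * φ) * φ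
          + 8.25 * j * φ ^ 2 := by
        refine hdev.trans ?_
        gcongr
    _ ≤ 3.52 * (wsd (st.P x) (M.optValueToGo j) + 5.2 * Shat * j * φ) * φ
          + 8.25 * (Shat * j) * φ ^ 2 := by
        gcongr
        · exact sqrt_natCast_le_self Shat
        · exact le_mul_of_one_le_left j.cast_nonneg hS1
    _ ≤ _ := by
        have : 0 ≤ Shat * j * φ ^ 2 := by positivity
        linarith

lemma bonus_eq (H Shat : ℕ) (δ : ℝ) (st : Stats X) (V : (S → ℝ) × (S → ℝ)) (x : X) :
    bonus H Shat δ st V x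
      = 4 * (√(st.r2 x - st.r x ^ 2) + wsd (st.P x) V.1)
          * confWidth (failProb X.card H Shat δ) (st.n x)
        + 53 * Shat * H ^ 2 * confWidth (failProb X.card H Shat δ) (st.n x) ^ 2
        + 1 / H * (st.P x ⬝ᵥ (V.1 - V.2)) := by
  rw [bonus, phi_eq_confWidth]
  rfl

lemma second_order_const_le {j H N : ℝ} (hj : 0 ≤ j) (hjH : j + 1 ≤ H) (hN : 1 ≤ N) :
    39.6 + 53 * (N * j) + 3.0976 * (j * H) + 3.0976 * (N * j * H) ≤ 53 * N * H ^ 2 := by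
  have hscaled : j * H ≤ N * (j * H) :=
    le_mul_of_one_le_left (mul_nonneg hj (by linarith)) hN
  have hbase : 39.6 + 53 * j + 6.2 * (j * H) ≤ 53 * H ^ 2 := by nlinarith
  nlinarith

/-- The estimates of `st` are within the confidence bounds whose width function is the `phi` of the
algorithm, run with confidence parameter `δ`. -/
abbrev GoodModel (M : MDP X) (H Shat : ℕ) (δ : ℝ) (st : Stats X) : Prop :=
  GoodStats M H Shat (failProb X.card H Shat δ) st

-- The `1 / H` part of the bonus pays for the gaps `V.1 - V*` and `V* - f` of the next step.
lemma GoodModel.sum_abs_sub_le_bonus (hg : GoodModel M H Shat δ st) (hS : 1 ≤ Shat)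
    (hn : st.n x ≠ 0) (hj : j < H) (hV : ValidBounds M j f V) :
    |st.r x - M.meanReward x|
      + |st.P x ⬝ᵥ M.optValueToGo j - M.transProb x ⬝ᵥ M.optValueToGo j|
      + |st.P x ⬝ᵥ (M.optValueToGo j - f) - M.transProb x ⬝ᵥ (M.optValueToGo j - f)|
      ≤ bonus H Shat δ st V x := by
  have hφ := confWidth_nonneg (failProb X.card H Shat δ) (st.n x)
  have hH : (0 : ℝ) < H := Nat.cast_pos.2 (Nat.zero_lt_of_lt hj)
  have hreward := hg.abs_r_sub_le hn
  have hopt := hg.abs_dotProduct_opt_sub_le hV hS hn hj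
  have hgap := (hg.dev_P_symm hn).abs_dotProduct_sub_le_absorb (by norm_num) (by norm_num) hφ
    j.cast_nonneg hV.opt_sub_mem_Icc hH
  rw [abs_sub_comm] at hgap
  rw [bonus_eq]
  set φ := confWidth (failProb X.card H Shat δ) (st.n x)
  have hsd := mul_wsd_le_mul_wsd_add (f := M.optValueToGo j) (hg.P_mem x) j.cast_nonneg
    hV.upper_sub_opt_mem_Icc (fun s => (abs_sub_comm _ _).trans_le
      (abs_of_nonneg (hV.upper_sub_opt_mem_Icc s).1).le) (t := 3.52 * φ) (by positivity) hH
  have hwidth : 1 / (H : ℝ) * (st.P x ⬝ᵥ (V.1 - M.optValueToGo j))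
        + 1 / (H : ℝ) * (st.P x ⬝ᵥ (M.optValueToGo j - f))
      ≤ 1 / (H : ℝ) * (st.P x ⬝ᵥ (V.1 - V.2)) := by
    rw [← mul_add, ← dotProduct_add, sub_add_sub_cancel]
    gcongr
    exact dotProduct_le_dotProduct_of_nonneg_left (sub_le_sub_left hV.lower_le _) (hg.P_mem x).1
  have hjH : (j + 1 : ℝ) ≤ H := mod_cast hj
  have hS1 : (1 : ℝ) ≤ Shat := mod_cast hS
  have hsecond := mul_le_mul_of_nonneg_right
    (second_order_const_le j.cast_nonneg hjH hS1) (sq_nonneg φ)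
  have hσ := mul_nonneg (Real.sqrt_nonneg (st.r2 x - st.r x ^ 2)) hφ
  have hσ' := mul_nonneg (wsd_nonneg (p := st.P x) (f := V.1)) hφ
  linarith

lemma second_order_le_bonus (hP : 0 ≤ st.P x) (hV : V.2 ≤ V.1) :
    53 * Shat * H ^ 2 * confWidth (failProb X.card H Shat δ) (st.n x) ^ 2
      ≤ bonus H Shat δ st V x := by
  have hφ := confWidth_nonneg (failProb X.card H Shat δ) (st.n x)
  have hwidth : 0 ≤ st.P x ⬝ᵥ (V.1 - V.2) := dotProduct_nonneg_of_nonneg hP (sub_nonneg.2 hV)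
  have hσ := wsd_nonneg (p := st.P x) (f := V.1)
  rw [bonus_eq, add_assoc, add_left_comm]
  exact le_add_of_nonneg_right (by positivity)

lemma le_bonus_of_n_eq_zero (hP : 0 ≤ st.P x) (hV : V.2 ≤ V.1) (hS : 1 ≤ Shat) (hj : j < H)
    (hn : st.n x = 0) : (j + 1 : ℝ) ≤ bonus H Shat δ st V x := by
  refine le_trans ?_ (second_order_le_bonus hP hV)
  have hS1 : (1 : ℝ) ≤ Shat := mod_cast hS
  have hjH : (j + 1 : ℝ) ≤ H := mod_cast hj
  have hHSH : (H : ℝ) ^ 2 ≤ Shat * H ^ 2 := le_mul_of_one_le_left (by positivity) hS1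
  rw [hn, confWidth_zero]
  nlinarith

lemma GoodModel.le_upperQ (hg : GoodModel M H Shat δ st) (hS : 1 ≤ Shat) (hj : j < H)
    (hV : ValidBounds M j f V) (x : X) :
    M.meanReward x + M.transProb x ⬝ᵥ M.optValueToGo j ≤ upperQ H Shat δ st (j + 1) V x := by
  have hle : M.transProb x ⬝ᵥ M.optValueToGo j ≤ j :=
    dotProduct_le_of_forall_le (M.transProb_mem_stdSimplex x) fun s => (hV.opt_mem_Icc s).2
  have hQ : M.meanReward x + M.transProb x ⬝ᵥ M.optValueToGo j ≤ (j : ℝ) + 1 := by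
    linarith [(M.meanReward_mem_Icc x).2]
  refine le_max_of_le_right (le_min ?_ (mod_cast hQ))
  change _ ≤ st.r x + st.P x ⬝ᵥ V.1 + _
  have hmono : st.P x ⬝ᵥ M.optValueToGo j ≤ st.P x ⬝ᵥ V.1 :=
    dotProduct_le_dotProduct_of_nonneg_left hV.opt_le (hg.P_mem x).1
  rcases eq_or_ne (st.n x) 0 with hn | hn
  · have hopt : 0 ≤ st.P x ⬝ᵥ M.optValueToGo j :=
      dotProduct_nonneg_of_nonneg (hg.P_mem x).1 fun s => (hV.opt_mem_Icc s).1
    linarith [le_bonus_of_n_eq_zero (δ := δ) (hg.P_mem x).1 hV.lower_le_upper hS hj hn,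
      (hg.r_mem x).1]
  · linarith [hg.sum_abs_sub_le_bonus hS hn hj hV, neg_abs_le (st.r x - M.meanReward x),
      neg_abs_le (st.P x ⬝ᵥ M.optValueToGo j - M.transProb x ⬝ᵥ M.optValueToGo j),
      abs_nonneg (st.P x ⬝ᵥ (M.optValueToGo j - f) - M.transProb x ⬝ᵥ (M.optValueToGo j - f))]

lemma GoodModel.lowerQ_le (hg : GoodModel M H Shat δ st) (hS : 1 ≤ Shat) (hj : j < H)
    (hV : ValidBounds M j f V) (x : X) :
    lowerQ H Shat δ st (j + 1) V x ≤ M.meanReward x + M.transProb x ⬝ᵥ f := by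
  have hf : 0 ≤ M.meanReward x + M.transProb x ⬝ᵥ f :=
    add_nonneg (M.meanReward_mem_Icc x).1 <| dotProduct_nonneg_of_nonneg
      (M.transProb_mem_stdSimplex x).1 (hV.lower_nonneg.trans hV.lower_le)
  refine max_le hf (min_le_of_left_le ?_)
  change st.r x + st.P x ⬝ᵥ V.2 - _ ≤ _
  rcases eq_or_ne (st.n x) 0 with hn | hn
  · have hlower : st.P x ⬝ᵥ V.2 ≤ j :=
      dotProduct_le_of_forall_le (hg.P_mem x) fun s =>
        (hV.lower_le_upper s).trans (hV.upper_le s)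
    linarith [le_bonus_of_n_eq_zero (δ := δ) (hg.P_mem x).1 hV.lower_le_upper hS hj hn,
      (hg.r_mem x).2]
  · have hmono : st.P x ⬝ᵥ V.2 ≤ st.P x ⬝ᵥ f :=
      dotProduct_le_dotProduct_of_nonneg_left hV.lower_le (hg.P_mem x).1
    have herr := hg.sum_abs_sub_le_bonus hS hn hj hV
    rw [dotProduct_sub, dotProduct_sub] at herr
    linarith [le_abs_self (st.r x - M.meanReward x),
      le_abs_self (st.P x ⬝ᵥ M.optValueToGo j - M.transProb x ⬝ᵥ M.optValueToGo j),
      neg_abs_le (st.P x ⬝ᵥ M.optValueToGo j - st.P x ⬝ᵥ f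
        - (M.transProb x ⬝ᵥ M.optValueToGo j - M.transProb x ⬝ᵥ f))]

lemma upperQ_mem_Icc (j : ℕ) (x : X) : upperQ H Shat δ st j V x ∈ Set.Icc (0 : ℝ) j :=
  ⟨le_max_left _ _, max_le j.cast_nonneg (min_le_right _ _)⟩

theorem GoodModel.validBounds (hg : GoodModel M H Shat δ st) (hS : 1 ≤ Shat) {π : Policy X}
    (hπ : IsGreedy H Shat δ st π) (hj : j ≤ H) :
    ValidBounds M j (M.valueToGo H π j) (valueBounds H Shat δ st π j) := by
  induction j with
  | zero => constructor <;> intro s <;> simp [valueBounds, MDP.valueToGo, MDP.optValueToGo]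
  | succ j ih =>
    have hV := ih (Nat.le_of_succ_le hj)
    refine ⟨fun s => le_max_left _ _, fun s => hg.lowerQ_le hS hj hV _,
      fun s => (M.valueToGo_mem_Icc H π _ s).2, fun s => ?_, fun s => (upperQ_mem_Icc _ _).2⟩
    have : Nonempty {a : A // (s, a) ∈ X} := ⟨π 0 s⟩
    exact ciSup_le fun a => (hg.le_upperQ hS hj hV _).trans (hπ j hj s a.1 a.2)

end Planning

section Recursion

variable {X : Finset (S × A)} [Fintype S] {M : MDP X} {H Shat : ℕ} {δ : ℝ} {st : Stats X} {x : X}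
  {j : ℕ} {f : S → ℝ} {V : (S → ℝ) × (S → ℝ)}

lemma clip_sub_clip_le {a b : ℝ} (h : b ≤ a) (c : ℝ) :
    max 0 (min a c) - max 0 (min b c) ≤ a - b := by
  have hmin := abs_min_sub_min_le_max a c b c
  rw [sub_self, abs_zero, max_eq_left (abs_nonneg _)] at hmin
  calc max 0 (min a c) - max 0 (min b c) ≤ |max 0 (min a c) - max 0 (min b c)| := le_abs_self _
    _ ≤ |min a c - min b c| := by simpa using abs_max_sub_max_le_max 0 (min a c) 0 (min b c)
    _ ≤ |a - b| := hmin
    _ = a - b := abs_of_nonneg (sub_nonneg.2 h)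

lemma upperQ_sub_lowerQ_le_add_bonus (hP : 0 ≤ st.P x) (hV : V.2 ≤ V.1) (j : ℕ) :
    upperQ H Shat δ st j V x - lowerQ H Shat δ st j V x
      ≤ st.P x ⬝ᵥ (V.1 - V.2) + 2 * bonus H Shat δ st V x := by
  have hbonus : 0 ≤ bonus H Shat δ st V x :=
    le_trans (by positivity) (second_order_le_bonus hP hV)
  have hmono : st.P x ⬝ᵥ V.2 ≤ st.P x ⬝ᵥ V.1 := dotProduct_le_dotProduct_of_nonneg_left hV hP
  have hclip := clip_sub_clip_le (a := st.r x + st.P x ⬝ᵥ V.1 + bonus H Shat δ st V x)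
    (b := st.r x + st.P x ⬝ᵥ V.2 - bonus H Shat δ st V x) (by linarith) j
  rw [dotProduct_sub]
  exact hclip.trans_eq (by ring)

lemma GoodModel.two_mul_bonus_le (hg : GoodModel M H Shat δ st) (hS : 1 ≤ Shat)
    (hn : st.n x ≠ 0) (hj : j < H) (hV : ValidBounds M j f V) :
    2 * bonus H Shat δ st V x
      ≤ 3 / H * (st.P x ⬝ᵥ (V.1 - V.2)) + 8 * confWidth (failProb X.card H Shat δ) (st.n x)
        + 8 * wsd (M.transProb x) f * confWidth (failProb X.card H Shat δ) (st.n x)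
        + 145.2 * (Shat * H ^ 2 * confWidth (failProb X.card H Shat δ) (st.n x) ^ 2) := by
  have hφ := confWidth_nonneg (failProb X.card H Shat δ) (st.n x)
  have hH : (0 : ℝ) < H := Nat.cast_pos.2 (Nat.zero_lt_of_lt hj)
  have hf (s : S) : f s ∈ Set.Icc (0 : ℝ) j :=
    ⟨(hV.lower_nonneg.trans hV.lower_le) s, (hV.le_opt s).trans (hV.opt_mem_Icc s).2⟩
  have hsd := (hg.dev_P x hn).wsd_le (c := 2.9) (by norm_num) (by norm_num) hφ j.cast_nonneg hf
    (M.transProb_mem_stdSimplex x) (hg.P_mem x) (by norm_num) (by norm_num) (by norm_num)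
  have hr : √(st.r2 x - st.r x ^ 2) ≤ 1 :=
    Real.sqrt_le_one.2 (by linarith [hg.r2_le x, sq_nonneg (st.r x)])
  rw [bonus_eq]
  set φ := confWidth (failProb X.card H Shat δ) (st.n x)
  have hwsd := mul_wsd_le_mul_wsd_add (f := V.1) (g := f) (hg.P_mem x) j.cast_nonneg
    hV.upper_sub_lower_mem_Icc (fun s => by
      rw [abs_of_nonneg (sub_nonneg.2 ((hV.le_opt.trans hV.opt_le) s))]
      exact sub_le_sub_left (hV.lower_le s) _) (t := 8 * φ) (by positivity) hH
  have hS1 : (1 : ℝ) ≤ Shat := mod_cast hS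
  have hjH : (j : ℝ) * H ≤ Shat * H ^ 2 := by
    have : (j : ℝ) ≤ H := mod_cast hj.le
    rw [sq, ← mul_assoc]
    gcongr
    exact this.trans (le_mul_of_one_le_left hH.le hS1)
  have hsqrt : √(Shat : ℝ) * j ≤ Shat * H ^ 2 := by
    have : (j : ℝ) ≤ H ^ 2 := mod_cast hj.le.trans (Nat.le_self_pow two_ne_zero H)
    gcongr
    exact sqrt_natCast_le_self Shat
  calc 2 * (4 * (√(st.r2 x - st.r x ^ 2) + wsd (st.P x) V.1) * φ + 53 * Shat * H ^ 2 * φ ^ 2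
        + 1 / H * (st.P x ⬝ᵥ (V.1 - V.2)))
      ≤ 8 * φ + (8 * φ * wsd (st.P x) f + (1 / H * (st.P x ⬝ᵥ (V.1 - V.2))
          + (8 * φ) ^ 2 / 4 * j * H)) + 106 * (Shat * H ^ 2 * φ ^ 2)
          + 2 / H * (st.P x ⬝ᵥ (V.1 - V.2)) := by
        linear_combination hwsd + 8 * mul_le_mul_of_nonneg_right hr hφ
    _ ≤ 8 * φ + (8 * φ * (wsd (M.transProb x) f + 2.9 * √Shat * j * φ)
          + (1 / H * (st.P x ⬝ᵥ (V.1 - V.2)) + (8 * φ) ^ 2 / 4 * j * H))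
          + 106 * (Shat * H ^ 2 * φ ^ 2) + 2 / H * (st.P x ⬝ᵥ (V.1 - V.2)) := by
        gcongr
    _ ≤ _ := by
        linear_combination 23.2 * φ ^ 2 * hsqrt + 16 * φ ^ 2 * hjH

lemma GoodModel.dotProduct_upper_sub_lower_le (hg : GoodModel M H Shat δ st) (hn : st.n x ≠ 0)
    (hj : j < H) (hV : ValidBounds M j f V) :
    st.P x ⬝ᵥ (V.1 - V.2)
      ≤ (1 + 1 / H) * (M.transProb x ⬝ᵥ (V.1 - V.2))
        + 11.4 * (Shat * H ^ 2 * confWidth (failProb X.card H Shat δ) (st.n x) ^ 2) := by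
  have hφ := confWidth_nonneg (failProb X.card H Shat δ) (st.n x)
  have hH : (1 : ℝ) ≤ H := mod_cast Nat.one_le_of_lt hj
  have hdev := (abs_le.1 ((hg.dev_P x hn).abs_dotProduct_sub_le_absorb (by norm_num)
    (by norm_num) hφ j.cast_nonneg hV.upper_sub_lower_mem_Icc
    (zero_lt_one.trans_le hH))).2
  set φ := confWidth (failProb X.card H Shat δ) (st.n x)
  have hcoef : (3.52 ^ 2 / 4 * H + 8.25) * (Shat * j * φ ^ 2) ≤ 11.4 * (Shat * H ^ 2 * φ ^ 2) := by
    have hjH : (j : ℝ) ≤ H := mod_cast hj.le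
    calc (3.52 ^ 2 / 4 * (H : ℝ) + 8.25) * (Shat * j * φ ^ 2)
        ≤ (3.52 ^ 2 / 4 * H + 8.25 * H) * (Shat * H * φ ^ 2) := by
          gcongr
          linarith
      _ ≤ _ := by
          have : 0 ≤ Shat * H ^ 2 * φ ^ 2 := by positivity
          linear_combination 0.0524 * this
  linear_combination hdev + hcoef

theorem GoodModel.upperQ_sub_lowerQ_le (hg : GoodModel M H Shat δ st) (hS : 1 ≤ Shat)
    (hn : st.n x ≠ 0) (hj : j < H) (hV : ValidBounds M j f V) :
    upperQ H Shat δ st (j + 1) V x - lowerQ H Shat δ st (j + 1) V x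
      ≤ (1 + 7 / H) * (M.transProb x ⬝ᵥ (V.1 - V.2))
        + 8 * confWidth (failProb X.card H Shat δ) (st.n x)
        + 8 * wsd (M.transProb x) f * confWidth (failProb X.card H Shat δ) (st.n x)
        + 191 * (Shat * H ^ 2 * confWidth (failProb X.card H Shat δ) (st.n x) ^ 2) := by
  have hH : (1 : ℝ) ≤ H := mod_cast Nat.one_le_of_lt hj
  have hw : 0 ≤ M.transProb x ⬝ᵥ (V.1 - V.2) := dotProduct_nonneg_of_nonneg
    (M.transProb_mem_stdSimplex x).1 fun s => (hV.upper_sub_lower_mem_Icc s).1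
  have hdev := hg.dotProduct_upper_sub_lower_le hn hj hV
  have hbonus := hg.two_mul_bonus_le hS hn hj hV
  have hQ := upperQ_sub_lowerQ_le_add_bonus (H := H) (Shat := Shat) (δ := δ) (hg.P_mem x).1
    hV.lower_le_upper (j + 1)
  set φ := confWidth (failProb X.card H Shat δ) (st.n x)
  set u : ℝ := 1 / H
  have hu : u ∈ Set.Icc (0 : ℝ) 1 := ⟨by positivity, div_le_one_of_le₀ hH (by positivity)⟩
  calc _ ≤ (1 + 3 * u) * (st.P x ⬝ᵥ (V.1 - V.2)) + 8 * φ + 8 * wsd (M.transProb x) f * φ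
          + 145.2 * (Shat * H ^ 2 * φ ^ 2) := by
        linear_combination hQ + hbonus
    _ ≤ (1 + 3 * u) * ((1 + u) * (M.transProb x ⬝ᵥ (V.1 - V.2)) + 11.4 * (Shat * H ^ 2 * φ ^ 2))
          + 8 * φ + 8 * wsd (M.transProb x) f * φ + 145.2 * (Shat * H ^ 2 * φ ^ 2) := by
        gcongr
    _ ≤ (1 + 7 * u) * (M.transProb x ⬝ᵥ (V.1 - V.2)) + 4 * (11.4 * (Shat * H ^ 2 * φ ^ 2))
          + 8 * φ + 8 * wsd (M.transProb x) f * φ + 145.2 * (Shat * H ^ 2 * φ ^ 2) := by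
        rw [mul_add, ← mul_assoc]
        gcongr
        · nlinarith [hu.1, hu.2]
        · linarith [hu.2]
    _ ≤ _ := by
        have : 0 ≤ Shat * H ^ 2 * φ ^ 2 := by positivity
        linear_combination 0.2 * this

end Recursion

section Summary

open ProbabilityTheory
open scoped BigOperators

lemma runAvg_eq_expect_insert {I : Finset ℕ} {t : ℕ} (ht : t ∉ I) {Z : ℕ → ℝ} {old : ℝ}
    (hold : I.Nonempty → old = 𝔼 i ∈ I, Z i) :
    runAvg (I.card + 1) old (Z t) = 𝔼 i ∈ insert t I, Z i := by
  rcases I.eq_empty_or_nonempty with rfl | hI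
  · simp [runAvg]
  · have hcard : (I.card : ℝ) ≠ 0 := Nat.cast_ne_zero.2 hI.card_ne_zero
    rw [hold hI, Finset.expect_eq_sum_div_card, Finset.expect_eq_sum_div_card,
      Finset.sum_insert ht, Finset.card_insert_of_notMem ht, runAvg]
    push_cast
    field_simp
    ring

/-- The mean of `Z` over `I` obeys the Bernstein bound with range `b` and variance `v`. -/
def BernsteinMean (ε b v : ℝ) (I : Finset ℕ) (Z : ℕ → ℝ) : Prop :=
  |𝔼 i ∈ I, Z i| ≤ 3.52 * √v * confWidth ε I.card + 8.25 * b * confWidth ε I.card ^ 2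

lemma BernsteinMean.abs_expect_sub_le {ε b v c : ℝ} {I : Finset ℕ} {Z : ℕ → ℝ}
    (h : BernsteinMean ε b v I fun i => Z i - c) (hI : I.Nonempty) :
    |𝔼 i ∈ I, Z i - c| ≤ 3.52 * √v * confWidth ε I.card + 8.25 * b * confWidth ε I.card ^ 2 := by
  rwa [BernsteinMean, Finset.expect_sub_distrib, Finset.expect_const hI] at h

lemma bernsteinMean_of_eq_zero {ε b v : ℝ} (hb : 0 ≤ b) {I : Finset ℕ} {Z : ℕ → ℝ}
    (hZ : ∀ i ∈ I, Z i = 0) : BernsteinMean ε b v I Z := by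
  have hφ := confWidth_nonneg ε I.card
  rw [BernsteinMean, Finset.expect_eq_zero hZ, abs_zero]
  positivity

open Classical in
lemma bernsteinMean_of_notMem_bernsteinAbsFail {Ω : Type*} {ε b v : ℝ} (hb : 0 ≤ b)
    {O : ℕ → Set Ω} {Z : ℕ → Ω → ℝ} {ω : Ω} (hω : ω ∉ BernsteinAbsFail ε b v O Z)
    (hZ : ∀ i, ω ∈ O i → |Z i ω| ≤ b) (t : ℕ) :
    BernsteinMean ε b v {i ∈ Finset.range t | ω ∈ O i} fun i => Z i ω := by
  set I := {i ∈ Finset.range t | ω ∈ O i} with hI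
  rcases I.eq_empty_or_nonempty with hemp | hne
  · exact bernsteinMean_of_eq_zero hb fun i hi => absurd hi (by simp [hemp])
  rcases (confWidth_le_one ε I.card).lt_or_eq with hlt | heq
  · have hcard : (0 : ℝ) < I.card := Nat.cast_pos.2 hne.card_pos
    have hsum : |∑ i ∈ I, Z i ω| ≤ I.card
        * (3.52 * √v * confWidth ε I.card + 8.25 * b * confWidth ε I.card ^ 2) := by
      rw [hI, Finset.sum_filter]
      exact le_of_not_gt fun hgt => hω ⟨t, _, rfl, hlt, hgt⟩
    rw [BernsteinMean, Finset.expect_eq_sum_div_card, abs_div, abs_of_pos hcard]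
    exact (div_le_iff₀' hcard).2 hsum
  · have habs : |𝔼 i ∈ I, Z i ω| ≤ b := (Finset.abs_expect_le _ _).trans <|
      Finset.expect_le hne fun i hi => hZ i (Finset.mem_filter.1 hi).2
    rw [BernsteinMean, heq]
    linarith [Real.sqrt_nonneg v]

variable {X : Finset (S × A)} [Fintype S]

open Classical in
/-- The model `st` consists of the empirical averages of the rewards `R i y` and successors `N i y`
over the observation times `i ∈ I y` of each pair `y`. -/
structure IsSummary (I : X → Finset ℕ) (R : ℕ → X → ℝ) (N : ℕ → X → S) (st : Stats X) :
    Prop where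
  n_eq : ∀ y, st.n y = (I y).card
  r_eq : ∀ y, st.r y = 𝔼 i ∈ I y, R i y
  r2_eq : ∀ y, st.r2 y = 𝔼 i ∈ I y, R i y ^ 2
  P_eq : ∀ y, (I y).Nonempty → ∀ s, st.P y s = 𝔼 i ∈ I y, if s = N i y then 1 else 0
  P_mem : ∀ y, I y = ∅ → st.P y ∈ stdSimplex ℝ S

variable {I : X → Finset ℕ} {R : ℕ → X → ℝ} {N : ℕ → X → S} {st : Stats X}

lemma isSummary_init (s₀ : S) : IsSummary (fun _ => ∅) R N (Stats.init s₀) where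
  n_eq _ := rfl
  r_eq _ := (Finset.expect_empty _).symm
  r2_eq _ := (Finset.expect_empty _).symm
  P_eq _ h := absurd h Finset.not_nonempty_empty
  P_mem y _ := by
    classical
    simpa only [Stats.init, eq_comm] using ite_eq_mem_stdSimplex ℝ s₀

lemma IsSummary.observe {G : Digraph X} {x : ℕ → X} {t : ℕ}
    (h : IsSummary (obsTimes G x t) R N st) :
    IsSummary (obsTimes G x (t + 1)) R N (st.observe G (x t) (R t) (N t)) := by
  classical
  have ht (y : X) : t ∉ obsTimes G x t y := fun hmem => (mem_obsTimes.1 hmem).1.false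
  constructor <;> intro y <;> rw [obsTimes_succ] <;>
    by_cases hy : Observes G (x t) y <;> simp only [Stats.observe, hy, if_true, if_false]
  · rw [h.n_eq, Finset.card_insert_of_notMem (ht y)]
  · exact h.n_eq y
  · rw [h.n_eq]
    exact runAvg_eq_expect_insert (ht y) fun _ => h.r_eq y
  · exact h.r_eq y
  · rw [h.n_eq]
    exact runAvg_eq_expect_insert (Z := fun i => R i y ^ 2) (ht y) fun _ => h.r2_eq y
  · exact h.r2_eq y
  · intro _ s
    rw [h.n_eq]
    exact runAvg_eq_expect_insert (Z := fun i => if s = N i y then 1 else 0) (ht y)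
      fun hI => h.P_eq y hI s
  · exact h.P_eq y
  · exact fun hemp => absurd hemp (Finset.insert_ne_empty _ _)
  · exact h.P_mem y

lemma IsSummary.nonempty (h : IsSummary I R N st) {y : X} (hn : st.n y ≠ 0) : (I y).Nonempty :=
  Finset.card_ne_zero.1 (h.n_eq y ▸ hn)

lemma IsSummary.dotProduct_eq (h : IsSummary I R N st) {y : X} (hI : (I y).Nonempty)
    (f : S → ℝ) : st.P y ⬝ᵥ f = 𝔼 i ∈ I y, f (N i y) := by
  classical
  simp only [dotProduct, h.P_eq y hI, Finset.expect_mul, ← Finset.expect_sum_comm, ite_mul,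
    one_mul, zero_mul, Finset.sum_ite_eq', Finset.mem_univ, if_true]

lemma IsSummary.P_mem_stdSimplex (h : IsSummary I R N st) (y : X) :
    st.P y ∈ stdSimplex ℝ S := by
  rcases (I y).eq_empty_or_nonempty with hI | hI
  · exact h.P_mem y hI
  · refine ⟨fun s => ?_, ?_⟩
    · rw [h.P_eq y hI]
      exact Finset.expect_nonneg fun i _ => by split_ifs <;> norm_num
    · rw [← dotProduct_one, h.dotProduct_eq hI]
      exact Finset.expect_const hI 1

open Classical in
/-- The observations at the times `I` are possible under `M`, and the averages that the algorithm
forms from them obey their Bernstein bounds. -/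
structure GoodObs (M : MDP X) (H : ℕ) (ε : ℝ) (I : X → Finset ℕ) (R : ℕ → X → ℝ)
    (N : ℕ → X → S) : Prop where
  reward_mem : ∀ y, ∀ i ∈ I y, R i y ∈ Set.Icc (0 : ℝ) 1
  next_mem : ∀ y, ∀ i ∈ I y, M.transProb y (N i y) ≠ 0
  reward : ∀ y, BernsteinMean ε 1 Var[id; M.PR y] (I y) fun i => R i y - M.meanReward y
  sq_reward : ∀ y, BernsteinMean ε 1 Var[id; M.PR y] (I y)
    fun i => (R i y - M.meanReward y) ^ 2 - Var[id; M.PR y]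
  opt : ∀ y, ∀ j < H, BernsteinMean ε j (wvar (M.transProb y) (M.optValueToGo j)) (I y)
    fun i => M.optValueToGo j (N i y) - M.transProb y ⬝ᵥ M.optValueToGo j
  next : ∀ y s, BernsteinMean ε 1 (M.transProb y s) (I y)
    fun i => (if s = N i y then 1 else 0) - M.transProb y s

variable {M : MDP X} {H Shat : ℕ} {ε : ℝ}

lemma GoodObs.devBound (hg : GoodObs M H ε I R N) (h : IsSummary I R N st) {y : X}
    (hsupp : (M.P y).support.ncard ≤ Shat) (hI : (I y).Nonempty) :
    DevBound (M.transProb y) (st.P y) (M.transProb y) 3.52 8.25 (confWidth ε (st.n y)) Shat where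
  nonneg := (M.transProb_mem_stdSimplex y).1
  abs_sub_le s := by
    rw [h.P_eq y hI, h.n_eq]
    simpa only [mul_one] using (hg.next y s).abs_expect_sub_le hI
  ncard_le := by
    refine (Set.ncard_le_ncard (fun s hs => ?_) (Set.toFinite _)).trans hsupp
    refine (PMF.mem_support_iff _ _).2 fun hzero => hs ?_
    have hp : M.transProb y s = 0 := by simp only [MDP.transProb, hzero, ENNReal.toReal_zero]
    rw [hp, h.P_eq y hI]
    exact Finset.expect_eq_zero fun i hi => if_neg fun hsN : s = N i y =>
      hg.next_mem y i hi (hsN ▸ hp)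

lemma GoodObs.goodStats (hg : GoodObs M H ε I R N) (h : IsSummary I R N st)
    (hsupp : ∀ y, (M.P y).support.ncard ≤ Shat) : GoodStats M H Shat ε st where
  P_mem := h.P_mem_stdSimplex
  r_mem y := by
    rw [h.r_eq]
    refine ⟨Finset.expect_nonneg fun i hi => (hg.reward_mem y i hi).1, ?_⟩
    rcases (I y).eq_empty_or_nonempty with hI | hI
    · simp only [hI, Finset.expect_empty, zero_le_one]
    · exact Finset.expect_le hI fun i hi => (hg.reward_mem y i hi).2
  r2_le y := by
    rw [h.r2_eq]
    rcases (I y).eq_empty_or_nonempty with hI | hI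
    · simp only [hI, Finset.expect_empty, zero_le_one]
    · exact Finset.expect_le hI fun i hi =>
        pow_le_one₀ (hg.reward_mem y i hi).1 (hg.reward_mem y i hi).2
  dev_P y hn := hg.devBound h (hsupp y) (h.nonempty hn)
  dev_r y hn := by
    rw [h.r_eq, h.n_eq]
    simpa only [mul_one] using (hg.reward y).abs_expect_sub_le (h.nonempty hn)
  dev_r2 y hn := by
    have hcentered : st.r2 y - 2 * M.meanReward y * st.r y + M.meanReward y ^ 2
        = 𝔼 i ∈ I y, (R i y - M.meanReward y) ^ 2 := by
      simp only [sub_sq', Finset.expect_sub_distrib, Finset.expect_add_distrib,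
        Finset.expect_const (h.nonempty hn), h.r_eq, h.r2_eq, Finset.mul_expect]
      ring_nf
    rw [hcentered, h.n_eq]
    simpa only [mul_one] using (hg.sq_reward y).abs_expect_sub_le (h.nonempty hn)
  dev_opt y hn j hj := by
    rw [h.dotProduct_eq (h.nonempty hn), h.n_eq]
    exact (hg.opt y j hj).abs_expect_sub_le (h.nonempty hn)

end Summary

section FiniteIndex

open scoped ENNReal

variable {Ω ι : Type*} {i : Ω → ι}

lemma measurable_apply_of_finite [Finite ι] {m : MeasurableSpace Ω}
    (hi : ∀ x, MeasurableSet[m] {ω | i ω = x}) {f : ι → Ω → ℝ} (hf : ∀ x, Measurable[m] (f x)) :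
    Measurable[m] fun ω => f (i ω) ω := by
  classical
  have := Fintype.ofFinite ι
  have hsum : (fun ω => f (i ω) ω) = fun ω => ∑ x, {ω | i ω = x}.indicator (f x) ω := by
    ext ω
    simp only [Set.indicator_apply, Set.mem_ofPred_eq, Finset.sum_ite_eq, Finset.mem_univ, if_true]
  rw [hsum]
  exact Finset.measurable_fun_sum _ fun x _ => (hf x).indicator (hi x)

lemma setLIntegral_apply_eq_sum [Fintype ι] [MeasurableSpace Ω] {μ : Measure Ω}
    (hi : ∀ x, MeasurableSet {ω | i ω = x}) {F : Set Ω} (hF : MeasurableSet F)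
    (f : ι → Ω → ℝ≥0∞) :
    ∫⁻ ω in F, f (i ω) ω ∂μ = ∑ x, ∫⁻ ω in F ∩ {ω | i ω = x}, f x ω ∂μ := by
  have hunion : F = ⋃ x ∈ (Finset.univ : Finset ι), F ∩ {ω | i ω = x} := by
    ext ω
    simp
  have hdisj : ((Finset.univ : Finset ι) : Set ι).PairwiseDisjoint fun x => F ∩ {ω | i ω = x} :=
    fun x _ y _ hxy => Set.disjoint_left.2 fun ω hx hy => hxy (hx.2.symm.trans hy.2)
  have hmeas (x : ι) := hF.inter (hi x)
  conv_lhs => rw [hunion]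
  rw [lintegral_biUnion_finset hdisj fun x _ => hmeas x]
  refine Finset.sum_congr rfl fun x _ => setLIntegral_congr_fun (hmeas x) fun ω hω => ?_
  simp only [show i ω = x from hω.2]

end FiniteIndex

lemma MDP.sum_P_mul_ofReal_le_one {X : Finset (S × A)} [Fintype S] (M : MDP X) (x : X)
    {g : S → ℝ} (hg : 0 ≤ g) (hle : M.transProb x ⬝ᵥ g ≤ 1) :
    ∑ s, M.P x s * ENNReal.ofReal (g s) ≤ 1 := by
  have hp := (M.transProb_mem_stdSimplex x).1
  have hofReal (s : S) : M.P x s * ENNReal.ofReal (g s)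
      = ENNReal.ofReal (M.transProb x s * g s) := by
    rw [ENNReal.ofReal_mul (hp s), MDP.transProb, ENNReal.ofReal_toReal ((M.P x).apply_ne_top s)]
  rw [Finset.sum_congr rfl fun s _ => hofReal s, ← ENNReal.ofReal_sum_of_nonneg fun s _ =>
    mul_nonneg (hp s) (hg s)]
  exact ENNReal.ofReal_le_one.2 hle

lemma mul_add_div_of_lt (k : ℕ) {h H : ℕ} (hh : h < H) : (k * H + h) / H = k := by
  rw [add_comm, Nat.add_mul_div_right _ _ (h.zero_le.trans_lt hh), Nat.div_eq_of_lt hh, zero_add]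

/-! ### The trajectory in global time -/

namespace Run

open scoped ENNReal

variable {X : Finset (S × A)} [Fintype S] {M : MDP X} {G : Digraph X} {H Shat : ℕ} {δ : ℝ}
  {s₀ : S} {Ω : Type*} [mΩ : MeasurableSpace Ω] {μ : Measure Ω}

/-- The pair played at the global time `t`, that is, in step `t % H` of episode `t / H`. -/
def play (ρ : Run M G H Shat δ s₀ μ) (t : ℕ) (ω : Ω) : X :=
  (ρ.policy (t / H) ω).pair (t % H) (ρ.state (t / H) (t % H) ω)

/-- The reward observed for `y` at the global time `t`. -/
def rewardAt (ρ : Run M G H Shat δ s₀ μ) (t : ℕ) (y : X) (ω : Ω) : ℝ :=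
  ρ.reward (t / H) (t % H) y ω

/-- The successor observed for `y` at the global time `t`. -/
def nextAt (ρ : Run M G H Shat δ s₀ μ) (t : ℕ) (y : X) (ω : Ω) : S :=
  ρ.next (t / H) (t % H) y ω

/-- The event that `y` is observed at the global time `t`. -/
def observedAt (ρ : Run M G H Shat δ s₀ μ) (t : ℕ) (y : X) : Set Ω :=
  {ω | Observes G (ρ.play t ω) y}

variable (ρ : Run M G H Shat δ s₀ μ)

lemma play_mul_add (k : ℕ) {h : ℕ} (hh : h < H) (ω : Ω) :
    ρ.play (k * H + h) ω = (ρ.policy k ω).pair h (ρ.state k h ω) := by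
  rw [play, Nat.mul_add_mod_of_lt hh, mul_add_div_of_lt k hh]

lemma measurableSet_policy_pair (k : ℕ) {h : ℕ} (hh : h < H) (s : S) (x : X) :
    MeasurableSet[ρ.𝓕 (k * H)] {ω | (ρ.policy k ω).pair h s = x} := by
  by_cases hs : s = x.1.1
  · subst hs
    simpa only [Policy.pair, Subtype.ext_iff, Prod.ext_iff, true_and]
      using ρ.policy_meas k h hh x.1.1 x.1.2
  · simp [Policy.pair, Subtype.ext_iff, Prod.ext_iff, hs]

lemma measurableSet_play (hH : 0 < H) (t : ℕ) (x : X) :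
    MeasurableSet[ρ.𝓕 t] {ω | ρ.play t ω = x} := by
  have hstate := ρ.state_meas (t / H) (t % H) (Nat.mod_lt t hH) x.1.1
  have hpair := ρ.𝓕.mono (Nat.div_mul_le_self t H) _
    (ρ.measurableSet_policy_pair (t / H) (Nat.mod_lt t hH) x.1.1 x)
  rw [Nat.div_add_mod'] at hstate
  convert hstate.inter hpair using 1
  ext ω
  refine ⟨fun h => ?_, fun h => ?_⟩
  · have hs : ρ.state (t / H) (t % H) ω = x.1.1 := congrArg (fun x : X => x.1.1) h
    exact ⟨hs, hs ▸ h⟩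
  · exact (congrArg _ h.1).trans h.2

lemma measurableSet_observedAt (hH : 0 < H) (t : ℕ) (y : X) :
    MeasurableSet[ρ.𝓕 t] (ρ.observedAt t y) := by
  have hunion : ρ.observedAt t y = ⋃ x ∈ {x : X | Observes G x y}, {ω | ρ.play t ω = x} := by
    ext ω
    simp [observedAt]
  rw [hunion]
  exact MeasurableSet.biUnion (Set.to_countable _) fun x _ => ρ.measurableSet_play hH t x

lemma measurable_rewardAt (hH : 0 < H) (t : ℕ) (y : X) :
    Measurable[ρ.𝓕 (t + 1)] (ρ.rewardAt t y) := by
  have h := ρ.reward_meas (t / H) (t % H) (Nat.mod_lt t hH) y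
  rwa [Nat.div_add_mod'] at h

lemma measurableSet_nextAt (hH : 0 < H) (t : ℕ) (y : X) (s : S) :
    MeasurableSet[ρ.𝓕 (t + 1)] {ω | ρ.nextAt t y ω = s} := by
  have h := ρ.next_meas (t / H) (t % H) (Nat.mod_lt t hH) y s
  rwa [Nat.div_add_mod'] at h

variable {t : ℕ} {y : X} {F : Set Ω}

lemma measure_inter_rewardAt (hH : 0 < H) (hF : MeasurableSet[ρ.𝓕 t] F)
    (hFy : F ⊆ ρ.observedAt t y) {B : Set ℝ} (hB : MeasurableSet B) :
    μ (F ∩ ρ.rewardAt t y ⁻¹' B) = μ F * M.PR y B :=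
  ρ.reward_law (t / H) (t % H) (Nat.mod_lt t hH) y F (by rwa [Nat.div_add_mod'])
    (fun _ hω => hFy hω) B hB

lemma measure_inter_nextAt (hH : 0 < H) (hF : MeasurableSet[ρ.𝓕 t] F)
    (hFy : F ⊆ ρ.observedAt t y) (s : S) :
    μ (F ∩ {ω | ρ.nextAt t y ω = s}) = μ F * M.P y s :=
  ρ.next_law (t / H) (t % H) (Nat.mod_lt t hH) y F (by rwa [Nat.div_add_mod'])
    (fun _ hω => hFy hω) s

lemma setLIntegral_rewardAt (hH : 0 < H) (hF : MeasurableSet[ρ.𝓕 t] F)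
    (hFy : F ⊆ ρ.observedAt t y) {g : ℝ → ℝ≥0∞} (hg : Measurable g) :
    ∫⁻ ω in F, g (ρ.rewardAt t y ω) ∂μ = μ F * ∫⁻ r, g r ∂M.PR y := by
  have hmeas : Measurable (ρ.rewardAt t y) := (ρ.measurable_rewardAt hH t y).mono (ρ.𝓕.le _) le_rfl
  have hlaw : (μ.restrict F).map (ρ.rewardAt t y) = μ F • M.PR y := by
    ext B hB
    rw [Measure.map_apply hmeas hB, Measure.restrict_apply (hmeas hB), Set.inter_comm,
      ρ.measure_inter_rewardAt hH hF hFy hB, Measure.smul_apply, smul_eq_mul]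
  rw [← lintegral_map hg hmeas, hlaw, lintegral_smul_measure, smul_eq_mul]

lemma setLIntegral_inter_nextAt (hH : 0 < H) (hF : MeasurableSet[ρ.𝓕 t] F)
    (hFy : F ⊆ ρ.observedAt t y) (s : S) {f : Ω → ℝ≥0∞} (hf : Measurable[ρ.𝓕 t] f) :
    ∫⁻ ω in F ∩ {ω | ρ.nextAt t y ω = s}, f ω ∂μ = M.P y s * ∫⁻ ω in F, f ω ∂μ := by
  have hle := ρ.𝓕.le t
  have htrim : (μ.restrict (F ∩ {ω | ρ.nextAt t y ω = s})).trim hle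
      = M.P y s • (μ.restrict F).trim hle := by
    refine @Measure.ext _ (ρ.𝓕 t) _ _ fun E hE => ?_
    rw [trim_measurableSet_eq hle hE, Measure.restrict_apply (hle _ hE), Measure.smul_apply,
      trim_measurableSet_eq hle hE, Measure.restrict_apply (hle _ hE), smul_eq_mul,
      ← Set.inter_assoc, ρ.measure_inter_nextAt hH (hE.inter hF)
        (Set.inter_subset_right.trans hFy), mul_comm]
  rw [← lintegral_trim hle hf, htrim, lintegral_smul_measure, lintegral_trim hle hf, smul_eq_mul]

lemma setLIntegral_nextAt (hH : 0 < H) (hF : MeasurableSet[ρ.𝓕 t] F)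
    (hFy : F ⊆ ρ.observedAt t y) {f : S → Ω → ℝ≥0∞} (hf : ∀ s, Measurable[ρ.𝓕 t] (f s)) :
    ∫⁻ ω in F, f (ρ.nextAt t y ω) ω ∂μ = ∫⁻ ω in F, ∑ s, M.P y s * f s ω ∂μ := by
  have hf' (s : S) : Measurable (f s) := (hf s).mono (ρ.𝓕.le t) le_rfl
  rw [setLIntegral_apply_eq_sum (fun s => ρ.𝓕.le _ _ (ρ.measurableSet_nextAt hH t y s))
    (ρ.𝓕.le _ _ hF), lintegral_finsetSum _ fun s _ => (hf' s).const_mul _]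
  refine Finset.sum_congr rfl fun s _ => ?_
  rw [ρ.setLIntegral_inter_nextAt hH hF hFy s (hf s), lintegral_const_mul _ (hf' s)]

lemma setLIntegral_play_nextAt_le (hH : 0 < H) (hF : MeasurableSet[ρ.𝓕 t] F)
    {f : X → S → Ω → ℝ≥0∞} (hf : ∀ x s, Measurable[ρ.𝓕 t] (f x s))
    (hle : ∀ x ω, ∑ s, M.P x s * f x s ω ≤ 1) :
    ∫⁻ ω in F, f (ρ.play t ω) (ρ.nextAt t (ρ.play t ω) ω) ω ∂μ ≤ μ F := by
  have hplay (x : X) := ρ.measurableSet_play hH t x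
  have hsum := setLIntegral_apply_eq_sum (μ := μ) (fun x => ρ.𝓕.le _ _ (hplay x)) (ρ.𝓕.le _ _ hF)
  rw [hsum fun x ω => f x (ρ.nextAt t x ω) ω, ← setLIntegral_one, hsum fun _ _ => 1]
  refine Finset.sum_le_sum fun x _ => ?_
  have hobs : F ∩ {ω | ρ.play t ω = x} ⊆ ρ.observedAt t x := fun ω hω => Or.inl hω.2.symm
  rw [ρ.setLIntegral_nextAt hH (hF.inter (hplay x)) hobs (hf x)]
  exact lintegral_mono (hle x)

end Run

/-! ### Measurability of the model and of the planning routine -/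

section MeasurableStats

variable {X : Finset (S × A)} {Ω : Type*} {m : MeasurableSpace Ω} {f : Ω → Stats X}

/-- The entries of the random model `f` are measurable, where `m` is the information available when
the model is formed. -/
structure MeasurableStats (m : MeasurableSpace Ω) (f : Ω → Stats X) : Prop where
  n : ∀ y, Measurable[m] fun ω => (f ω).n y
  r : ∀ y, Measurable[m] fun ω => (f ω).r y
  r2 : ∀ y, Measurable[m] fun ω => (f ω).r2 y
  P : ∀ y, Measurable[m] fun ω => (f ω).P y

lemma measurable_runAvg {n : Ω → ℕ} {a b : Ω → ℝ} (hn : Measurable[m] n) (ha : Measurable[m] a)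
    (hb : Measurable[m] b) : Measurable[m] fun ω => runAvg (n ω) (a ω) (b ω) := by
  have hn' : Measurable[m] fun ω => (n ω : ℝ) := measurable_from_nat.comp hn
  exact (((hn'.sub_const 1).div hn').mul ha).add ((hn'.const_div 1).mul hb)

lemma measurableStats_init (s₀ : S) : MeasurableStats m fun _ => (Stats.init s₀ : Stats X) :=
  ⟨fun _ => measurable_const, fun _ => measurable_const, fun _ => measurable_const,
    fun _ => measurable_const⟩

lemma MeasurableStats.mono {m' : MeasurableSpace Ω} (h : m ≤ m') (hf : MeasurableStats m f) :
    MeasurableStats m' f :=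
  ⟨fun y => (hf.n y).mono h le_rfl, fun y => (hf.r y).mono h le_rfl,
    fun y => (hf.r2 y).mono h le_rfl, fun y => (hf.P y).mono h le_rfl⟩

lemma MeasurableStats.observe (hf : MeasurableStats m f) {G : Digraph X} {x : Ω → X}
    {R : X → Ω → ℝ} {N : X → Ω → S} (hx : ∀ y, MeasurableSet[m] {ω | Observes G (x ω) y})
    (hR : ∀ y, Measurable[m] (R y)) (hN : ∀ y s, MeasurableSet[m] {ω | N y ω = s}) :
    MeasurableStats m fun ω => (f ω).observe G (x ω) (R · ω) (N · ω) := by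
  classical
  have hn (y : X) : Measurable[m] fun ω => (f ω).n y + 1 := (hf.n y).add_const 1
  refine ⟨fun y => Measurable.ite (hx y) (hn y) (hf.n y),
    fun y => Measurable.ite (hx y) (measurable_runAvg (hn y) (hf.r y) (hR y)) (hf.r y),
    fun y => Measurable.ite (hx y) (measurable_runAvg (hn y) (hf.r2 y) ((hR y).pow_const 2))
      (hf.r2 y), fun y => measurable_pi_iff.2 fun s => ?_⟩
  have hP : Measurable[m] fun ω => (f ω).P y s := (measurable_pi_apply s).comp (hf.P y)
  have hindicator : Measurable[m] fun ω => if s = N y ω then (1 : ℝ) else 0 :=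
    Measurable.ite (by simpa only [eq_comm] using hN y s) measurable_const measurable_const
  exact Measurable.ite (hx y) (measurable_runAvg (hn y) hP hindicator) hP

variable [Fintype S]

lemma measurable_dotProduct {p g : Ω → S → ℝ} (hp : Measurable[m] p) (hg : Measurable[m] g) :
    Measurable[m] fun ω => p ω ⬝ᵥ g ω :=
  Finset.measurable_fun_sum _ fun s _ =>
    ((measurable_pi_apply s).comp hp).mul ((measurable_pi_apply s).comp hg)

lemma measurable_wvar (p : S → ℝ) {g : Ω → S → ℝ} (hg : Measurable[m] g) :
    Measurable[m] fun ω => wvar p (g ω) :=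
  (measurable_dotProduct measurable_const (hg.pow_const 2)).sub
    ((measurable_dotProduct measurable_const hg).pow_const 2)

variable {V : Ω → (S → ℝ) × (S → ℝ)}

lemma measurable_bonus (hf : MeasurableStats m f) (hV : Measurable[m] V) (H Shat : ℕ) (δ : ℝ)
    (x : X) : Measurable[m] fun ω => bonus H Shat δ (f ω) (V ω) x := by
  have hphi : Measurable[m] fun ω => phi X.card H Shat δ ((f ω).n x) :=
    (measurable_from_nat (f := phi X.card H Shat δ)).comp (hf.n x)
  have hmean := measurable_dotProduct (hf.P x) hV.fst
  have hsq := measurable_dotProduct (hf.P x) (hV.fst.pow_const 2)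
  have hgap := measurable_dotProduct (hf.P x) (hV.fst.sub hV.snd)
  exact ((((((hf.r2 x).sub ((hf.r x).pow_const 2)).sqrt.add
    (hsq.sub (hmean.pow_const 2)).sqrt).const_mul 4).mul hphi).add
    ((hphi.pow_const 2).const_mul _)).add (hgap.const_mul _)

lemma measurable_upperQ (hf : MeasurableStats m f) (hV : Measurable[m] V) (H Shat : ℕ) (δ : ℝ)
    (j : ℕ) (x : X) : Measurable[m] fun ω => upperQ H Shat δ (f ω) j (V ω) x :=
  measurable_const.max ((((hf.r x).add (measurable_dotProduct (hf.P x) hV.fst)).add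
    (measurable_bonus hf hV H Shat δ x)).min measurable_const)

lemma measurable_lowerQ (hf : MeasurableStats m f) (hV : Measurable[m] V) (H Shat : ℕ) (δ : ℝ)
    (j : ℕ) (x : X) : Measurable[m] fun ω => lowerQ H Shat δ (f ω) j (V ω) x :=
  measurable_const.max ((((hf.r x).add (measurable_dotProduct (hf.P x) hV.snd)).sub
    (measurable_bonus hf hV H Shat δ x)).min measurable_const)

variable {π : Ω → Policy X} {H : ℕ}

lemma measurable_valueBounds (hf : MeasurableStats m f)
    (hπ : ∀ h < H, ∀ s x, MeasurableSet[m] {ω | (π ω).pair h s = x}) (Shat : ℕ) (δ : ℝ) {j : ℕ}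
    (hj : j ≤ H) : Measurable[m] fun ω => valueBounds H Shat δ (f ω) (π ω) j := by
  induction j with
  | zero => exact measurable_const
  | succ j ih =>
    have hV := ih (by lia)
    exact (measurable_pi_iff.2 fun s => measurable_apply_of_finite (hπ _ (by lia) s)
      (measurable_upperQ hf hV H Shat δ (j + 1))).prodMk <|
      measurable_pi_iff.2 fun s => measurable_apply_of_finite (hπ _ (by lia) s)
        (measurable_lowerQ hf hV H Shat δ (j + 1))

lemma MDP.measurable_valueToGo (M : MDP X)
    (hπ : ∀ h < H, ∀ s x, MeasurableSet[m] {ω | (π ω).pair h s = x}) {j : ℕ} (hj : j ≤ H) :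
    Measurable[m] fun ω => M.valueToGo H (π ω) j := by
  induction j with
  | zero => exact measurable_const
  | succ j ih =>
    refine measurable_pi_iff.2 fun s => measurable_apply_of_finite
      (f := fun x ω => M.meanReward x + M.transProb x ⬝ᵥ M.valueToGo H (π ω) j)
      (hπ _ (by lia) s) fun x => ?_
    exact (measurable_dotProduct measurable_const (ih (by lia))).const_add _

end MeasurableStats

namespace Run

variable {X : Finset (S × A)} [Fintype S] {M : MDP X} {G : Digraph X} {H Shat : ℕ} {δ : ℝ}
  {s₀ : S} {Ω : Type*} [mΩ : MeasurableSpace Ω] {μ : Measure Ω} (ρ : Run M G H Shat δ s₀ μ)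

/-- The model formed from all the observations made before the global time `t`, also within an
episode. -/
def modelAt (ρ : Run M G H Shat δ s₀ μ) : ℕ → Ω → Stats X
  | 0, _ => Stats.init s₀
  | t + 1, ω => (ρ.modelAt t ω).observe G (ρ.play t ω) (ρ.rewardAt t · ω) (ρ.nextAt t · ω)

lemma modelAt_mul_add (k : ℕ) {h : ℕ} (hh : h ≤ H) (ω : Ω) :
    ρ.modelAt (k * H + h) ω = (ρ.modelAt (k * H) ω).run G
      (fun h => (ρ.policy k ω).pair h (ρ.state k h ω)) (fun h y => ρ.reward k h y ω)
      (fun h y => ρ.next k h y ω) h := by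
  induction h with
  | zero => rfl
  | succ h ih =>
    have hlt : h < H := by lia
    rw [Stats.run, ← ih hlt.le, ← ρ.play_mul_add k hlt, ← add_assoc, modelAt]
    simp only [rewardAt, nextAt, mul_add_div_of_lt k hlt, Nat.mul_add_mod_of_lt hlt]

lemma stats_eq_modelAt (k : ℕ) (ω : Ω) : ρ.stats k ω = ρ.modelAt (k * H) ω := by
  induction k with
  | zero => rw [zero_mul]; rfl
  | succ k ih => rw [Nat.succ_mul, ρ.modelAt_mul_add k le_rfl, ← ih]; rfl

lemma isSummary_modelAt (t : ℕ) (ω : Ω) :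
    IsSummary (obsTimes G (ρ.play · ω) t) (ρ.rewardAt · · ω) (ρ.nextAt · · ω)
      (ρ.modelAt t ω) := by
  induction t with
  | zero => exact isSummary_init s₀
  | succ t ih => exact ih.observe

lemma measurableStats_modelAt (hH : 0 < H) (t : ℕ) :
    MeasurableStats (ρ.𝓕 t) (ρ.modelAt t) := by
  induction t with
  | zero => exact measurableStats_init s₀
  | succ t ih =>
    have hle := ρ.𝓕.mono t.le_succ
    exact (ih.mono hle).observe (fun y => hle _ (ρ.measurableSet_observedAt hH t y))
      (ρ.measurable_rewardAt hH t) (ρ.measurableSet_nextAt hH t)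

end Run

section ExponentialBounds

variable {ι : Type*} [Fintype ι] {p f : ι → ℝ}

lemma dotProduct_exp_one_sub_mul_sub_le_one (hp : p ∈ stdSimplex ℝ ι) {θ : ℝ} (hθ : θ ≤ 1)
    (hf : ∀ i, f i ∈ Set.Icc 0 θ) : (p ⬝ᵥ fun i => Real.exp ((1 - θ) * (p ⬝ᵥ f) - f i)) ≤ 1 := by
  set m := (1 - θ) * (p ⬝ᵥ f) with hm
  have hexp (i : ι) : Real.exp (m - f i) ≤ Real.exp m * (1 - (1 - θ) * f i) := by
    obtain ⟨hf0, hfθ⟩ := hf i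
    have hquad := Real.abs_exp_sub_one_sub_id_le (x := -f i)
      (by rw [abs_neg, abs_of_nonneg hf0]; exact hfθ.trans hθ)
    rw [sub_eq_add_neg, Real.exp_add]
    exact mul_le_mul_of_nonneg_left (by nlinarith [abs_le.1 hquad]) (Real.exp_pos _).le
  have hmean : (p ⬝ᵥ fun i => Real.exp m * (1 - (1 - θ) * f i)) = Real.exp m * (1 - m) := by
    have hlin : (fun i => Real.exp m * (1 - (1 - θ) * f i))
        = Real.exp m • ((fun _ => 1) - (1 - θ) • f) := rfl
    rw [hlin, dotProduct_smul, dotProduct_sub, dotProduct_const hp, dotProduct_smul, smul_eq_mul,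
      smul_eq_mul, hm]
  calc p ⬝ᵥ (fun i => Real.exp (m - f i)) ≤ Real.exp m * (1 - m) :=
        hmean ▸ dotProduct_le_dotProduct_of_nonneg_left hexp hp.1
    _ ≤ Real.exp m * Real.exp (-m) :=
        mul_le_mul_of_nonneg_left (Real.one_sub_le_exp_neg m) (Real.exp_pos _).le
    _ = 1 := by rw [← Real.exp_add, add_neg_cancel, Real.exp_zero]

lemma wvar_sq_le (hp : p ∈ stdSimplex ℝ ι) {B : ℝ} (hf : ∀ i, f i ∈ Set.Icc 0 B) :
    wvar p (f ^ 2) ≤ 4 * B ^ 2 * wvar p f := by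
  have hmean := dotProduct_mem_Icc_zero hp hf
  refine (wvar_le_dotProduct_sub_const_sq hp ((p ⬝ᵥ f) ^ 2)).trans ?_
  rw [wvar_eq_dotProduct_sub_sq hp, ← smul_eq_mul (4 * B ^ 2), ← dotProduct_smul]
  refine dotProduct_le_dotProduct_of_nonneg_left (fun i => ?_) hp.1
  have hsum : (f i + p ⬝ᵥ f) ^ 2 ≤ 4 * B ^ 2 := by
    obtain ⟨⟨hf0, hfB⟩, hm0, hmB⟩ := And.intro (hf i) hmean
    nlinarith
  calc (f i ^ 2 - (p ⬝ᵥ f) ^ 2) ^ 2 = (f i + p ⬝ᵥ f) ^ 2 * (f i - p ⬝ᵥ f) ^ 2 := by ring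
    _ ≤ 4 * B ^ 2 * (f i - p ⬝ᵥ f) ^ 2 := mul_le_mul_of_nonneg_right hsum (sq_nonneg _)

end ExponentialBounds

/-! ### Concentration along the trajectory -/

namespace Run

variable {X : Finset (S × A)} [Fintype S] {M : MDP X} {G : Digraph X} {H Shat : ℕ} {δ : ℝ}
  {s₀ : S} {Ω : Type*} [mΩ : MeasurableSpace Ω] {μ : Measure Ω}
  (ρ : Run M G H Shat δ s₀ μ)

lemma ae_rewardAt_mem_Icc (hH : 0 < H) :
    ∀ᵐ ω ∂μ, ∀ i y, ω ∈ ρ.observedAt i y → ρ.rewardAt i y ω ∈ Set.Icc (0 : ℝ) 1 := by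
  refine ae_all_iff.2 fun i => ae_all_iff.2 fun y => ?_
  have hnull := ρ.measure_inter_rewardAt hH (ρ.measurableSet_observedAt hH i y) subset_rfl
    (measurableSet_Icc (a := (0 : ℝ)) (b := 1)).compl
  rw [M.PR_bdd y, mul_zero] at hnull
  exact measure_mono_null (fun ω hω => by simpa using hω) hnull

lemma ae_transProb_nextAt_ne_zero (hH : 0 < H) :
    ∀ᵐ ω ∂μ, ∀ i y, ω ∈ ρ.observedAt i y → M.transProb y (ρ.nextAt i y ω) ≠ 0 := by
  have hnull (i : ℕ) (y : X) (s : S) (hs : M.transProb y s = 0) :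
      μ (ρ.observedAt i y ∩ {ω | ρ.nextAt i y ω = s}) = 0 := by
    have hP : M.P y s = 0 :=
      ((ENNReal.toReal_eq_zero_iff _).1 hs).resolve_right ((M.P y).apply_ne_top s)
    rw [ρ.measure_inter_nextAt hH (ρ.measurableSet_observedAt hH i y) subset_rfl, hP, mul_zero]
  refine ae_all_iff.2 fun i => ae_all_iff.2 fun y => ?_
  refine measure_mono_null (fun ω hω => ?_) <|
    (measure_biUnion_null_iff (Set.to_countable {s | M.transProb y s = 0})).2 (hnull i y)
  simpa [and_comm] using hω

variable [IsProbabilityMeasure μ]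

lemma measure_exists_le_sum_nextAt_play_le (hH : 0 < H) {u : ℕ → X → Ω → S → ℝ}
    (hu : ∀ t x, Measurable[ρ.𝓕 t] (u t x))
    (hexp : ∀ t x ω, (M.transProb x ⬝ᵥ fun s => Real.exp (u t x ω s)) ≤ 1) (ℓ : ℝ) :
    μ {ω | ∃ T, ℓ ≤ ∑ t ∈ Finset.range T, u t (ρ.play t ω) ω (ρ.nextAt t (ρ.play t ω) ω)}
      ≤ ENNReal.ofReal (Real.exp (-ℓ)) := by
  have hu' (t : ℕ) (x : X) (s : S) : Measurable[ρ.𝓕 t] fun ω => u t x ω s :=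
    (measurable_pi_apply s).comp (hu t x)
  refine measure_exists_le_sum_le (Z := fun t ω => u t (ρ.play t ω) ω (ρ.nextAt t (ρ.play t ω) ω))
    ρ.𝓕 (fun t => ?_) (fun t F hF => ?_) ℓ
  · have hle := ρ.𝓕.mono t.le_succ
    exact measurable_apply_of_finite (f := fun x ω => u t x ω (ρ.nextAt t x ω))
      (fun x => hle _ (ρ.measurableSet_play hH t x)) fun x =>
      measurable_apply_of_finite (f := fun s ω => u t x ω s) (ρ.measurableSet_nextAt hH t x)
        fun s => (hu' t x s).mono hle le_rfl
  · exact ρ.setLIntegral_play_nextAt_le hH hF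
      (f := fun x s ω => ENNReal.ofReal (Real.exp (u t x ω s)))
      (fun x s => (Real.measurable_exp.comp (hu' t x s)).ennreal_ofReal)
      fun x ω => M.sum_P_mul_ofReal_le_one x (fun s => (Real.exp_pos _).le) (hexp t x ω)

variable {f : ℕ → Ω → S → ℝ} {B : ℝ}

lemma measure_exists_le_sum_one_sub_mul_sub_le (hH : 0 < H) (hf : ∀ t, Measurable[ρ.𝓕 t] (f t))
    (hB : 0 < B) (hfB : ∀ t ω s, f t ω s ∈ Set.Icc 0 B) {θ : ℝ} (hθ0 : 0 < θ) (hθ : θ ≤ 1)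
    (ℓ : ℝ) :
    μ {ω | ∃ T, B / θ * ℓ ≤ ∑ t ∈ Finset.range T, ((1 - θ) * (M.transProb (ρ.play t ω) ⬝ᵥ f t ω)
      - f t ω (ρ.nextAt t (ρ.play t ω) ω))} ≤ ENNReal.ofReal (Real.exp (-ℓ)) := by
  refine (measure_mono ?_).trans <| ρ.measure_exists_le_sum_nextAt_play_le hH
    (u := fun t x ω s => (1 - θ) * (M.transProb x ⬝ᵥ (θ / B) • f t ω) - ((θ / B) • f t ω) s)
    (fun t x => ?_) (fun t x ω => ?_) ℓ
  · rintro ω ⟨T, hT⟩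
    refine ⟨T, ?_⟩
    calc ℓ = θ / B * (B / θ * ℓ) := by field_simp
      _ ≤ _ := mul_le_mul_of_nonneg_left hT (by positivity)
      _ = _ := by
        rw [Finset.mul_sum]
        refine Finset.sum_congr rfl fun t _ => ?_
        rw [dotProduct_smul, Pi.smul_apply, smul_eq_mul, smul_eq_mul]
        ring
  · have hscaled := (measurable_const_smul (θ / B)).comp (hf t)
    refine @measurable_pi_lambda _ _ _ (ρ.𝓕 t) _ _ fun s => ?_
    exact ((measurable_dotProduct measurable_const hscaled).const_mul _).sub
      ((measurable_pi_apply s).comp hscaled)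
  · refine dotProduct_exp_one_sub_mul_sub_le_one (M.transProb_mem_stdSimplex x) hθ fun s =>
      ⟨mul_nonneg (by positivity) (hfB t ω s).1, ?_⟩
    calc θ / B * f t ω s ≤ θ / B * B := mul_le_mul_of_nonneg_left (hfB t ω s).2 (by positivity)
      _ = θ := div_mul_cancel₀ θ hB.ne'

lemma measure_exists_le_sum_mul_sub_sub_wvar_le (hH : 0 < H) (hf : ∀ t, Measurable[ρ.𝓕 t] (f t))
    (hfB : ∀ t ω s, f t ω s ∈ Set.Icc 0 B) {l : ℝ} (hl : |l| * B ≤ 1) (ℓ : ℝ) :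
    μ {ω | ∃ T, ℓ ≤ ∑ t ∈ Finset.range T,
      (l * (f t ω (ρ.nextAt t (ρ.play t ω) ω) - M.transProb (ρ.play t ω) ⬝ᵥ f t ω)
        - l ^ 2 * wvar (M.transProb (ρ.play t ω)) (f t ω))} ≤ ENNReal.ofReal (Real.exp (-ℓ)) := by
  refine ρ.measure_exists_le_sum_nextAt_play_le hH (u := fun t x ω s =>
    l * (f t ω s - M.transProb x ⬝ᵥ f t ω) - l ^ 2 * wvar (M.transProb x) (f t ω))
    (fun t x => ?_) (fun t x ω => ?_) ℓ
  · refine @measurable_pi_lambda _ _ _ (ρ.𝓕 t) _ _ fun s => ?_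
    exact ((((measurable_pi_apply s).comp (hf t)).sub
      (measurable_dotProduct measurable_const (hf t))).const_mul _).sub
        ((measurable_wvar _ (hf t)).const_mul _)
  · exact dotProduct_exp_le_one (M.transProb_mem_stdSimplex x) (hfB t ω) le_rfl hl

/-! ### Concentration of the observations -/

variable {ε b v : ℝ}

lemma measure_bernsteinAbsFail_nextAt_le (hH : 0 < H) (hε : 0 < ε) (hε1 : ε ≤ 1) (y : X)
    {g : S → ℝ} (hb : 0 < b) (hg : ∀ s, g s ∈ Set.Icc 0 b) (hv : wvar (M.transProb y) g ≤ v) :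
    μ (BernsteinAbsFail ε b v (ρ.observedAt · y)
      fun t ω => g (ρ.nextAt t y ω) - M.transProb y ⬝ᵥ g) ≤ 2 * ENNReal.ofReal ε := by
  have hp := M.transProb_mem_stdSimplex y
  refine measure_bernsteinAbsFail_le ρ.𝓕 hε hε1 (ρ.measurableSet_observedAt hH · y) (fun t => ?_)
    hb ((wvar_nonneg hp).trans hv) fun l hl t F hF hFy => ?_
  · exact (measurable_apply_of_finite (f := fun s _ => g s) (ρ.measurableSet_nextAt hH t y)
      fun s => measurable_const).sub_const _
  · rw [ρ.setLIntegral_nextAt hH hF hFy (f := fun s _ => ENNReal.ofReal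
      (Real.exp (l * (g s - M.transProb y ⬝ᵥ g) - l ^ 2 * v))) fun s => measurable_const,
      ← setLIntegral_one]
    exact lintegral_mono fun _ => M.sum_P_mul_ofReal_le_one y (fun s => (Real.exp_pos _).le)
      (dotProduct_exp_le_one hp hg hv hl)

open ProbabilityTheory in
lemma measure_bernsteinAbsFail_rewardAt_le (hH : 0 < H) (hε : 0 < ε) (hε1 : ε ≤ 1) (y : X)
    {g : ℝ → ℝ} (hg : Measurable g) (hb : 0 < b) (hgb : ∀ᵐ r ∂M.PR y, g r ∈ Set.Icc 0 b)
    (hv : Var[g; M.PR y] ≤ v) :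
    μ (BernsteinAbsFail ε b v (ρ.observedAt · y)
      fun t ω => g (ρ.rewardAt t y ω) - (M.PR y)[g]) ≤ 2 * ENNReal.ofReal ε := by
  have := M.PR_prob y
  refine measure_bernsteinAbsFail_le ρ.𝓕 hε hε1 (ρ.measurableSet_observedAt hH · y)
    (fun t => (hg.comp (ρ.measurable_rewardAt hH t y)).sub_const _)
    hb ((variance_nonneg _ _).trans hv) fun l hl t F hF hFy => ?_
  have hlaw := ρ.setLIntegral_rewardAt hH hF hFy (g := fun r => ENNReal.ofReal
    (Real.exp (l * (g r - (M.PR y)[g]) - l ^ 2 * v))) (by fun_prop)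
  exact hlaw.trans_le <| mul_le_of_le_one_right' (lintegral_exp_le_one hg.aemeasurable hgb hv hl)

end Run

section UnionBound

open scoped ENNReal

lemma measure_biUnion_le_ncard_mul {Ω ι : Type*} [MeasurableSpace Ω] {μ : Measure Ω} {s : Set ι}
    (hs : s.Finite) {E : ι → Set Ω} {c : ℝ≥0∞} (h : ∀ i ∈ s, μ (E i) ≤ c) :
    μ (⋃ i ∈ s, E i) ≤ s.ncard * c := by
  have hunion : ⋃ i ∈ s, E i = ⋃ i ∈ hs.toFinset, E i := by simp only [hs.mem_toFinset]
  rw [hunion, Set.ncard_eq_toFinset_card s hs, ← nsmul_eq_mul]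
  exact (measure_biUnion_finset_le _ _).trans <|
    Finset.sum_le_card_nsmul _ _ _ fun i hi => h i (hs.mem_toFinset.1 hi)

end UnionBound

open ProbabilityTheory in
lemma MDP.variance_PR_mem_Icc {X : Finset (S × A)} (M : MDP X) (y : X) :
    Var[id; M.PR y] ∈ Set.Icc (0 : ℝ) 1 := by
  have := M.PR_prob y
  rw [variance_eq_integral aemeasurable_id]
  exact integral_mem_Icc_zero (by fun_prop)
    (ae_sq_sub_integral_mem_Icc aemeasurable_id (M.ae_mem_Icc y))

namespace Run

open ProbabilityTheory

variable {X : Finset (S × A)} [Fintype S] {M : MDP X} {G : Digraph X} {H Shat : ℕ} {δ : ℝ}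
  {s₀ : S} {Ω : Type*} [mΩ : MeasurableSpace Ω] {μ : Measure Ω}
  (ρ : Run M G H Shat δ s₀ μ)

open Classical in
/-- The event that some Bernstein bound for the observations of `y` fails. Bounds that hold
surely, namely for `j = 0` steps to go and for impossible successors, are left out. -/
def bernsteinFailAt (ε : ℝ) (y : X) : Set Ω :=
  BernsteinAbsFail ε 1 Var[id; M.PR y] (ρ.observedAt · y)
      (fun t ω => ρ.rewardAt t y ω - M.meanReward y)
    ∪ BernsteinAbsFail ε 1 Var[id; M.PR y] (ρ.observedAt · y)
      (fun t ω => (ρ.rewardAt t y ω - M.meanReward y) ^ 2 - Var[id; M.PR y])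
    ∪ (⋃ j ∈ Set.Ico 1 H, BernsteinAbsFail ε j (wvar (M.transProb y) (M.optValueToGo j))
      (ρ.observedAt · y)
      fun t ω => M.optValueToGo j (ρ.nextAt t y ω) - M.transProb y ⬝ᵥ M.optValueToGo j)
    ∪ ⋃ s ∈ (M.P y).support, BernsteinAbsFail ε 1 (M.transProb y s) (ρ.observedAt · y)
      fun t ω => (if s = ρ.nextAt t y ω then 1 else 0) - M.transProb y s

variable [IsProbabilityMeasure μ] {ε : ℝ}

lemma measure_bernsteinAbsFail_reward_le (hH : 0 < H) (hε : 0 < ε) (hε1 : ε ≤ 1) (y : X) :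
    μ (BernsteinAbsFail ε 1 Var[id; M.PR y] (ρ.observedAt · y)
      fun t ω => ρ.rewardAt t y ω - M.meanReward y) ≤ 2 * ENNReal.ofReal ε :=
  ρ.measure_bernsteinAbsFail_rewardAt_le hH hε hε1 y measurable_id zero_lt_one
    (M.ae_mem_Icc y) le_rfl

lemma measure_bernsteinAbsFail_sq_reward_le (hH : 0 < H) (hε : 0 < ε) (hε1 : ε ≤ 1) (y : X) :
    μ (BernsteinAbsFail ε 1 Var[id; M.PR y] (ρ.observedAt · y)
      fun t ω => (ρ.rewardAt t y ω - M.meanReward y) ^ 2 - Var[id; M.PR y])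
      ≤ 2 * ENNReal.ofReal ε := by
  have := M.PR_prob y
  have hmean : Var[id; M.PR y] = (M.PR y)[fun r => (r - M.meanReward y) ^ 2] :=
    variance_eq_integral aemeasurable_id
  nth_rw 2 [hmean]
  exact ρ.measure_bernsteinAbsFail_rewardAt_le hH hε hε1 y (g := fun r => (r - M.meanReward y) ^ 2)
    (by fun_prop) zero_lt_one (ae_sq_sub_integral_mem_Icc aemeasurable_id (M.ae_mem_Icc y))
    (variance_sq_sub_integral_le aemeasurable_id (M.ae_mem_Icc y))

lemma measure_bernsteinAbsFail_opt_le (hX : ∀ s, ∃ a, (s, a) ∈ X) (hH : 0 < H) (hε : 0 < ε)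
    (hε1 : ε ≤ 1) (y : X) {j : ℕ} (hj : 0 < j) :
    μ (BernsteinAbsFail ε j (wvar (M.transProb y) (M.optValueToGo j)) (ρ.observedAt · y)
      fun t ω => M.optValueToGo j (ρ.nextAt t y ω) - M.transProb y ⬝ᵥ M.optValueToGo j)
      ≤ 2 * ENNReal.ofReal ε :=
  ρ.measure_bernsteinAbsFail_nextAt_le hH hε hε1 y (Nat.cast_pos.2 hj)
    (M.optValueToGo_mem_Icc hX j) le_rfl

open Classical in
lemma measure_bernsteinAbsFail_next_le (hH : 0 < H) (hε : 0 < ε) (hε1 : ε ≤ 1) (y : X) (s : S) :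
    μ (BernsteinAbsFail ε 1 (M.transProb y s) (ρ.observedAt · y)
      fun t ω => (if s = ρ.nextAt t y ω then 1 else 0) - M.transProb y s)
      ≤ 2 * ENNReal.ofReal ε := by
  set g : S → ℝ := fun s' => if s = s' then 1 else 0
  have hmean : M.transProb y ⬝ᵥ g = M.transProb y s := by
    simp only [g, dotProduct, mul_ite, mul_one, mul_zero, Finset.sum_ite_eq, Finset.mem_univ,
      if_true]
  have hsq : g ^ 2 = g := funext fun s' => by simp [g]
  have hvar : wvar (M.transProb y) g ≤ M.transProb y s := by
    rw [← hmean]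
    simpa only [wvar, hsq] using sub_le_self _ (sq_nonneg _)
  have hg (s' : S) : g s' ∈ Set.Icc (0 : ℝ) 1 := by simp only [g]; split_ifs <;> simp
  simpa only [hmean] using ρ.measure_bernsteinAbsFail_nextAt_le hH hε hε1 y zero_lt_one hg hvar

lemma measure_bernsteinFailAt_le (hX : ∀ s, ∃ a, (s, a) ∈ X) (hH : 0 < H) (hε : 0 < ε)
    (hε1 : ε ≤ 1) {y : X} (hsupp : (M.P y).support.ncard ≤ Shat) :
    μ (ρ.bernsteinFailAt ε y) ≤ (4 + 2 * H + 2 * Shat) * ENNReal.ofReal ε := by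
  have hIco : (Set.Ico 1 H).ncard ≤ H := by
    rw [← Finset.coe_Ico, Set.ncard_coe_finset, Nat.card_Ico]
    exact Nat.sub_le H 1
  refine (measure_union_le _ _).trans <| (add_le_add ((measure_union_le _ _).trans <| add_le_add
    ((measure_union_le _ _).trans <| add_le_add
      (ρ.measure_bernsteinAbsFail_reward_le hH hε hε1 y)
      (ρ.measure_bernsteinAbsFail_sq_reward_le hH hε hε1 y))
    (measure_biUnion_le_ncard_mul (Set.finite_Ico 1 H) fun j hj =>
      ρ.measure_bernsteinAbsFail_opt_le hX hH hε hε1 y hj.1))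
    (measure_biUnion_le_ncard_mul (Set.toFinite _) fun s _ =>
      ρ.measure_bernsteinAbsFail_next_le hH hε hε1 y s)).trans ?_
  calc _ ≤ 2 * ENNReal.ofReal ε + 2 * ENNReal.ofReal ε + H * (2 * ENNReal.ofReal ε)
        + Shat * (2 * ENNReal.ofReal ε) := by gcongr
    _ = (4 + 2 * H + 2 * Shat) * ENNReal.ofReal ε := by ring

omit [IsProbabilityMeasure μ] in
lemma goodObs_of_notMem_bernsteinFailAt (hX : ∀ s, ∃ a, (s, a) ∈ X) {ω : Ω}
    (hreward : ∀ i y, ω ∈ ρ.observedAt i y → ρ.rewardAt i y ω ∈ Set.Icc (0 : ℝ) 1)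
    (hnext : ∀ i y, ω ∈ ρ.observedAt i y → M.transProb y (ρ.nextAt i y ω) ≠ 0)
    (hω : ∀ y, ω ∉ ρ.bernsteinFailAt ε y) (t : ℕ) :
    GoodObs M H ε (obsTimes G (ρ.play · ω) t) (ρ.rewardAt · · ω) (ρ.nextAt · · ω) := by
  have habs {b x m : ℝ} (hx : x ∈ Set.Icc 0 b) (hm : m ∈ Set.Icc 0 b) : |x - m| ≤ b :=
    abs_sub_le_of_nonneg_of_le hx.1 hx.2 hm.1 hm.2
  simp only [bernsteinFailAt, Set.mem_union, Set.mem_iUnion, not_or, not_exists] at hω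
  refine ⟨fun y i hi => hreward i y (mem_obsTimes.1 hi).2,
    fun y i hi => hnext i y (mem_obsTimes.1 hi).2, fun y => ?_, fun y => ?_, fun y j hj => ?_,
    fun y s => ?_⟩
  · exact bernsteinMean_of_notMem_bernsteinAbsFail zero_le_one (hω y).1.1.1
      (fun i hi => habs (hreward i y hi) (M.meanReward_mem_Icc y)) t
  · exact bernsteinMean_of_notMem_bernsteinAbsFail zero_le_one (hω y).1.1.2 (fun i hi =>
      habs (sq_sub_mem_Icc_zero_one (hreward i y hi) (M.meanReward_mem_Icc y))
        (M.variance_PR_mem_Icc y)) t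
  · have hopt := M.optValueToGo_mem_Icc hX j
    rcases Nat.eq_zero_or_pos j with rfl | hj0
    · exact bernsteinMean_of_eq_zero (Nat.cast_nonneg 0) fun i _ => by
        simp [MDP.optValueToGo, dotProduct]
    · exact bernsteinMean_of_notMem_bernsteinAbsFail (Nat.cast_nonneg j) ((hω y).1.2 j ⟨hj0, hj⟩)
        (fun i _ => habs (hopt _) (dotProduct_mem_Icc_zero (M.transProb_mem_stdSimplex y) hopt)) t
  · by_cases hs : s ∈ (M.P y).support
    · have hp := mem_Icc_of_mem_stdSimplex (M.transProb_mem_stdSimplex y) s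
      exact bernsteinMean_of_notMem_bernsteinAbsFail zero_le_one ((hω y).2 s hs)
        (fun i _ => habs (by split_ifs <;> simp) hp) t
    · have hp : M.transProb y s = 0 := by
        rw [MDP.transProb, ((M.P y).apply_eq_zero_iff s).2 hs, ENNReal.toReal_zero]
      refine bernsteinMean_of_eq_zero zero_le_one fun i hi => ?_
      have hne : s ≠ ρ.nextAt i y ω := fun h => hnext i y (mem_obsTimes.1 hi).2 (h ▸ hp)
      rw [if_neg hne, hp, sub_zero]

lemma measure_not_goodObs_le (hX : ∀ s, ∃ a, (s, a) ∈ X) (hH : 0 < H) (hε : 0 < ε)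
    (hε1 : ε ≤ 1) (hsupp : ∀ y, (M.P y).support.ncard ≤ Shat) :
    μ {ω | ¬ ∀ t, GoodObs M H ε (obsTimes G (ρ.play · ω) t) (ρ.rewardAt · · ω) (ρ.nextAt · · ω)}
      ≤ X.card * ((4 + 2 * H + 2 * Shat) * ENNReal.ofReal ε) := by
  calc _ ≤ μ (⋃ y ∈ (Set.univ : Set X), ρ.bernsteinFailAt ε y) := by
        refine measure_mono_ae ?_
        filter_upwards [ρ.ae_rewardAt_mem_Icc hH, ρ.ae_transProb_nextAt_ne_zero hH]
          with ω hreward hnext hbad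
        by_contra hω
        exact hbad <| ρ.goodObs_of_notMem_bernsteinFailAt hX hreward hnext fun y hy =>
          hω <| Set.mem_biUnion (Set.mem_univ y) hy
    _ ≤ _ := by
        simpa using measure_biUnion_le_ncard_mul Set.finite_univ fun y _ =>
          ρ.measure_bernsteinFailAt_le hX hH hε hε1 (hsupp y)

end Run

/-! ### The good event -/

/-- Weight of the gap between the value bounds at step `h`. It grows by a factor that absorbs the
factor `1 + 7 / H` by which the expected gap of the next step enters the gap of this step. -/
def stepWeight (H h : ℕ) : ℝ := (1 + 16 / H) ^ h

lemma one_le_stepWeight (H h : ℕ) : 1 ≤ stepWeight H h :=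
  one_le_pow₀ (le_add_of_nonneg_right (by positivity))

lemma stepWeight_le_exp {H h : ℕ} (hh : h ≤ H) : stepWeight H h ≤ Real.exp 16 := by
  have hbase : 1 ≤ 1 + 16 / (H : ℝ) := le_add_of_nonneg_right (by positivity)
  calc stepWeight H h ≤ (1 + 16 / (H : ℝ)) ^ H := pow_le_pow_right₀ hbase hh
    _ ≤ Real.exp (16 / H) ^ H := by
      gcongr
      linarith [Real.add_one_le_exp (16 / (H : ℝ))]
    _ = Real.exp (H * (16 / H)) := (Real.exp_nat_mul _ H).symm
    _ ≤ Real.exp 16 := Real.exp_le_exp.2 <| by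
      rw [mul_div_left_comm]
      exact mul_le_of_le_one_right (by norm_num) (div_self_le_one _)

lemma stepWeight_mul_le {H : ℕ} (hH : 0 < H) (h : ℕ) :
    stepWeight H h * (1 + 7 / H) ≤ stepWeight H (h + 1) * (1 - 1 / (2 * H)) := by
  have hH1 : (1 : ℝ) ≤ H := mod_cast hH
  have hinv : (H : ℝ)⁻¹ ≤ 1 := inv_le_one_of_one_le₀ hH1
  have hinv0 : 0 < (H : ℝ)⁻¹ := by positivity
  rw [stepWeight, stepWeight, pow_succ, mul_assoc, one_div, mul_inv]
  simp only [div_eq_mul_inv]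
  gcongr
  nlinarith

lemma failProb_pos {card H Shat : ℕ} {δ : ℝ} (hc : 0 < card) (hδ : 0 < δ) :
    0 < failProb card H Shat δ := by
  rw [failProb]
  positivity

lemma failProb_le_one {card H Shat : ℕ} {δ : ℝ} (hc : 0 < card) (hδ1 : δ ≤ 1) :
    failProb card H Shat δ ≤ 1 := by
  have hc1 : (1 : ℝ) ≤ card := mod_cast hc
  have hfactor : (1 : ℝ) ≤ 4 * Shat + 5 * H + 7 :=
    le_add_of_nonneg_of_le (by positivity) (by norm_num)
  exact div_le_one_of_le₀ (hδ1.trans (one_le_mul_of_one_le_of_one_le hc1 hfactor)) (by positivity)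

-- The budget: `4 + 2 H + 2 Ŝ` bounds for the observations of each pair, and two for the trajectory.
lemma card_mul_add_add_le {card H Shat : ℕ} {δ : ℝ} (hc : 0 < card) (hδ : 0 < δ) :
    card * ((4 + 2 * H + 2 * Shat) * ENNReal.ofReal (failProb card H Shat δ))
      + (ENNReal.ofReal (failProb card H Shat δ) + ENNReal.ofReal (failProb card H Shat δ))
      ≤ ENNReal.ofReal δ := by
  have hε := (failProb_pos (H := H) (Shat := Shat) hc hδ).le
  have hc1 : (1 : ℝ) ≤ card := mod_cast hc
  have hcount : (card * (4 + 2 * H + 2 * Shat) + 2 : ℝ) ≤ card * (4 * Shat + 5 * H + 7) := by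
    have : (0 : ℝ) ≤ card * (3 * H + 2 * Shat) := by positivity
    nlinarith
  have hcast : card * ((4 + 2 * H + 2 * Shat) * ENNReal.ofReal (failProb card H Shat δ))
      + (ENNReal.ofReal (failProb card H Shat δ) + ENNReal.ofReal (failProb card H Shat δ))
      = (card * (4 + 2 * H + 2 * Shat) + 2 : ℕ) * ENNReal.ofReal (failProb card H Shat δ) := by
    push_cast
    ring
  rw [hcast, ← ENNReal.ofReal_natCast, ← ENNReal.ofReal_mul (Nat.cast_nonneg _)]
  refine ENNReal.ofReal_le_ofReal ?_
  push_cast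
  calc _ ≤ (card * (4 * Shat + 5 * H + 7)) * failProb card H Shat δ :=
        mul_le_mul_of_nonneg_right hcount hε
    _ = δ := mul_div_cancel₀ _ (by positivity)

namespace Run

variable {X : Finset (S × A)} [Fintype S] {M : MDP X} {G : Digraph X} {H Shat : ℕ} {δ : ℝ}
  {s₀ : S} {Ω : Type*} [mΩ : MeasurableSpace Ω] {μ : Measure Ω}
  (ρ : Run M G H Shat δ s₀ μ) {ω : Ω}

/-- Value bounds of episode `k` at step `h`. -/
def boundsAt (ρ : Run M G H Shat δ s₀ μ) (k h : ℕ) (ω : Ω) : (S → ℝ) × (S → ℝ) :=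
  valueBounds H Shat δ (ρ.stats k ω) (ρ.policy k ω) (H - h)

/-- Weighted gap between the value bounds of episode `k` at step `h`. The absolute value makes it
nonnegative also where the bounds are not valid. -/
def weightedGap (ρ : Run M G H Shat δ s₀ μ) (k h : ℕ) (ω : Ω) : S → ℝ :=
  stepWeight H h • |(ρ.boundsAt k h ω).1 - (ρ.boundsAt k h ω).2|

/-- Value, from step `h` on, of the policy played in episode `k`. -/
def valueAt (ρ : Run M G H Shat δ s₀ μ) (k h : ℕ) (ω : Ω) : S → ℝ :=
  M.valueToGo H (ρ.policy k ω) (H - h)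

lemma abs_boundsAt_sub_le (k h : ℕ) (s : S) :
    |(ρ.boundsAt k h ω).1 s - (ρ.boundsAt k h ω).2 s| ≤ (H - h : ℕ) := by
  rw [boundsAt]
  cases H - h with
  | zero => simp [valueBounds]
  | succ j =>
    exact abs_sub_le_of_nonneg_of_le (le_max_left _ _) (upperQ_mem_Icc _ _).2 (le_max_left _ _)
      (max_le (Nat.cast_nonneg _) (min_le_right _ _))

lemma weightedGap_nonneg (k h : ℕ) : 0 ≤ ρ.weightedGap k h ω :=
  smul_nonneg (zero_le_one.trans (one_le_stepWeight H h)) (abs_nonneg _)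

lemma weightedGap_le (k : ℕ) {h : ℕ} (hh : h ≤ H) (s : S) :
    ρ.weightedGap k h ω s ≤ Real.exp 16 * H :=
  mul_le_mul (stepWeight_le_exp hh)
    ((ρ.abs_boundsAt_sub_le k h s).trans (mod_cast Nat.sub_le H h)) (abs_nonneg _)
    (Real.exp_pos 16).le

lemma weightedGap_self (k : ℕ) : ρ.weightedGap k H ω = 0 := by
  ext s
  simp [weightedGap, boundsAt, valueBounds]

lemma valueAt_mem_Icc (hX : ∀ s, ∃ a, (s, a) ∈ X) (k h : ℕ) (s : S) :
    ρ.valueAt k h ω s ∈ Set.Icc (0 : ℝ) H := by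
  have hval := M.valueToGo_mem_Icc H (ρ.policy k ω) (H - h) s
  have hopt := (M.optValueToGo_mem_Icc hX (H - h) s).2
  exact ⟨hval.1, hval.2.trans (hopt.trans (mod_cast Nat.sub_le H h))⟩

lemma valueAt_self (k : ℕ) : ρ.valueAt k H ω = 0 := by
  ext s
  simp [valueAt, MDP.valueToGo]

lemma measurable_weightedGap (hH : 0 < H) (t h : ℕ) :
    Measurable[ρ.𝓕 t] (ρ.weightedGap (t / H) h) := by
  have hstats : MeasurableStats (ρ.𝓕 (t / H * H)) (ρ.stats (t / H)) := by
    rw [funext (ρ.stats_eq_modelAt (t / H))]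
    exact ρ.measurableStats_modelAt hH _
  have hbounds := (measurable_valueBounds hstats (fun _ hh s x =>
    ρ.measurableSet_policy_pair _ hh s x) Shat δ (Nat.sub_le H h)).mono
      (ρ.𝓕.mono (Nat.div_mul_le_self t H)) le_rfl
  refine @measurable_pi_lambda _ _ _ (ρ.𝓕 t) _ _ fun s => ?_
  exact (measurable_abs.comp <| ((measurable_pi_apply s).comp hbounds.fst).sub
    ((measurable_pi_apply s).comp hbounds.snd)).const_mul (stepWeight H h)

lemma measurable_valueAt (t h : ℕ) : Measurable[ρ.𝓕 t] (ρ.valueAt (t / H) h) :=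
  (M.measurable_valueToGo (fun _ hh s x => ρ.measurableSet_policy_pair _ hh s x)
    (Nat.sub_le H h)).mono (ρ.𝓕.mono (Nat.div_mul_le_self t H)) le_rfl

/-- The deviation bounds on which the analysis of a single run rests. -/
structure GoodRun (ρ : Run M G H Shat δ s₀ μ) (ω : Ω) : Prop where
  obs : ∀ t, GoodObs M H (failProb X.card H Shat δ) (obsTimes G (ρ.play · ω) t)
    (ρ.rewardAt · · ω) (ρ.nextAt · · ω)
  gap : ∀ T, ∑ t ∈ Finset.range T,
    ((1 - 1 / (2 * H)) * (M.transProb (ρ.play t ω) ⬝ᵥ ρ.weightedGap (t / H) (t % H + 1) ω)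
      - ρ.weightedGap (t / H) (t % H + 1) ω (ρ.nextAt t (ρ.play t ω) ω))
    ≤ Real.exp 16 * H / (1 / (2 * H)) * -Real.log (failProb X.card H Shat δ)
  sqValue : ∀ T, ∑ t ∈ Finset.range T,
    (M.transProb (ρ.play t ω) ⬝ᵥ ρ.valueAt (t / H) (t % H + 1) ω ^ 2
      - ρ.valueAt (t / H) (t % H + 1) ω (ρ.nextAt t (ρ.play t ω) ω) ^ 2)
    ≤ 8 * H ^ 2 * -Real.log (failProb X.card H Shat δ)
      + 1 / 2 * ∑ t ∈ Finset.range T,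
        wvar (M.transProb (ρ.play t ω)) (ρ.valueAt (t / H) (t % H + 1) ω)

variable [IsProbabilityMeasure μ]

lemma measure_gap_fail_le (hH : 0 < H) (ℓ : ℝ) :
    μ {ω | ∃ T, Real.exp 16 * H / (1 / (2 * H)) * ℓ ≤ ∑ t ∈ Finset.range T,
      ((1 - 1 / (2 * H)) * (M.transProb (ρ.play t ω) ⬝ᵥ ρ.weightedGap (t / H) (t % H + 1) ω)
        - ρ.weightedGap (t / H) (t % H + 1) ω (ρ.nextAt t (ρ.play t ω) ω))}
      ≤ ENNReal.ofReal (Real.exp (-ℓ)) := by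
  have hH1 : (1 : ℝ) ≤ H := mod_cast hH
  exact ρ.measure_exists_le_sum_one_sub_mul_sub_le hH
    (fun t => ρ.measurable_weightedGap hH t _) (by positivity)
    (fun t ω s => ⟨ρ.weightedGap_nonneg _ _ s, ρ.weightedGap_le _ (Nat.mod_lt t hH) s⟩)
    (by positivity) (div_le_one_of_le₀ (by linarith) (by positivity)) ℓ

-- Bernstein's inequality for the squared values, whose variance is at most `4 H²` times the
-- variance of the values.
lemma measure_sqValue_fail_le (hX : ∀ s, ∃ a, (s, a) ∈ X) (hH : 0 < H) (ℓ : ℝ) :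
    μ {ω | ∃ T, 8 * H ^ 2 * ℓ + 1 / 2 * ∑ t ∈ Finset.range T,
        wvar (M.transProb (ρ.play t ω)) (ρ.valueAt (t / H) (t % H + 1) ω)
      ≤ ∑ t ∈ Finset.range T, (M.transProb (ρ.play t ω) ⬝ᵥ ρ.valueAt (t / H) (t % H + 1) ω ^ 2
        - ρ.valueAt (t / H) (t % H + 1) ω (ρ.nextAt t (ρ.play t ω) ω) ^ 2)}
      ≤ ENNReal.ofReal (Real.exp (-ℓ)) := by
  have : (0 : ℝ) < H := mod_cast hH
  set l : ℝ := 1 / (8 * H ^ 2) with hl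
  have hl0 : 0 < l := by positivity
  have hlH : l * (8 * H ^ 2) = 1 := one_div_mul_cancel (by positivity)
  refine (measure_mono ?_).trans <| ρ.measure_exists_le_sum_mul_sub_sub_wvar_le hH
    (f := fun t ω => ρ.valueAt (t / H) (t % H + 1) ω ^ 2) (B := H ^ 2) (l := -l)
    (fun t => (ρ.measurable_valueAt t _).pow_const 2)
    (fun t ω s => ⟨sq_nonneg _, pow_le_pow_left₀ (ρ.valueAt_mem_Icc hX _ _ s).1
      (ρ.valueAt_mem_Icc hX _ _ s).2 2⟩) (by rw [abs_neg, abs_of_pos hl0]; nlinarith) ℓ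
  rintro ω ⟨T, hT⟩
  refine ⟨T, ?_⟩
  have hscaled := mul_le_mul_of_nonneg_left hT hl0.le
  rw [mul_add, ← mul_assoc, hlH, one_mul, Finset.mul_sum, Finset.mul_sum, Finset.mul_sum,
    ← le_sub_iff_add_le, ← Finset.sum_sub_distrib] at hscaled
  refine hscaled.trans (Finset.sum_le_sum fun t _ => ?_)
  have hvar := mul_le_mul_of_nonneg_left (wvar_sq_le (M.transProb_mem_stdSimplex (ρ.play t ω))
    (ρ.valueAt_mem_Icc hX (ω := ω) (t / H) (t % H + 1))) (sq_nonneg l)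
  have hcoef : l ^ 2 * (4 * H ^ 2) = l * (1 / 2) := by rw [hl]; field_simp; norm_num
  rw [← mul_assoc, hcoef] at hvar
  rw [Pi.pow_apply]
  linarith

lemma measure_not_goodRun_le (hX : ∀ s, ∃ a, (s, a) ∈ X) (hH : 0 < H) (hδ : 0 < δ) (hδ1 : δ ≤ 1)
    (hsupp : ∀ y, (M.P y).support.ncard ≤ Shat) :
    μ {ω | ¬ ρ.GoodRun ω} ≤ ENNReal.ofReal δ := by
  obtain ⟨a, ha⟩ := hX s₀
  have hcard : 0 < X.card := Finset.card_pos.2 ⟨_, ha⟩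
  have hgap := ρ.measure_gap_fail_le hH (-Real.log (failProb X.card H Shat δ))
  have hsq := ρ.measure_sqValue_fail_le hX hH (-Real.log (failProb X.card H Shat δ))
  have hε : 0 < failProb X.card H Shat δ := failProb_pos hcard hδ
  rw [neg_neg, Real.exp_log hε] at hgap hsq
  refine (measure_mono fun ω hω => ?_).trans <| (measure_union_le _ _).trans <| (add_le_add
    (ρ.measure_not_goodObs_le hX hH hε (failProb_le_one hcard hδ1) hsupp)
    ((measure_union_le _ _).trans (add_le_add hgap hsq))).trans (card_mul_add_add_le hcard hδ)
  by_contra hnot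
  simp only [Set.mem_union, not_or, Set.mem_ofPred_eq, not_exists, not_le, not_not] at hnot
  exact hω ⟨hnot.1, fun T => (hnot.2.1 T).le, fun T => (hnot.2.2 T).le⟩

theorem ofReal_one_sub_le_measure_goodRun (hX : ∀ s, ∃ a, (s, a) ∈ X) (hH : 0 < H) (hδ : 0 < δ)
    (hδ1 : δ ≤ 1) (hsupp : ∀ y, (M.P y).support.ncard ≤ Shat) :
    ENNReal.ofReal (1 - δ) ≤ μ {ω | ρ.GoodRun ω} := by
  have hcover : 1 ≤ μ {ω | ρ.GoodRun ω} + μ {ω | ¬ ρ.GoodRun ω} := by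
    rw [← measure_univ (μ := μ), ← Set.compl_ofPred]
    exact measure_univ_le_add_compl _
  rw [ENNReal.ofReal_sub 1 hδ.le, ENNReal.ofReal_one]
  exact tsub_le_iff_right.2 <| hcover.trans <|
    add_le_add_right (ρ.measure_not_goodRun_le hX hH hδ hδ1 hsupp) _

end Run

/-! ### Sums along the trajectory -/

lemma sum_range_mul_eq_sum_sum (f : ℕ → ℝ) (T H : ℕ) :
    ∑ t ∈ Finset.range (T * H), f t
      = ∑ k ∈ Finset.range T, ∑ h ∈ Finset.range H, f (k * H + h) := by
  induction T with
  | zero => simp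
  | succ T ih => rw [Nat.succ_mul, Finset.sum_range_add, ih, Finset.sum_range_succ]

namespace Run

variable {X : Finset (S × A)} [Fintype S] {M : MDP X} {G : Digraph X} {H Shat : ℕ} {δ : ℝ}
  {s₀ : S} {Ω : Type*} [mΩ : MeasurableSpace Ω] {μ : Measure Ω}
  (ρ : Run M G H Shat δ s₀ μ) {ω : Ω}

lemma sum_state_zero_eq {v : ℕ → ℕ → S → ℝ} (hv : ∀ k, v k H = 0) (T : ℕ) :
    ∑ k ∈ Finset.range T, v k 0 (ρ.state k 0 ω)
      = ∑ t ∈ Finset.range (T * H), (v (t / H) (t % H) (ρ.state (t / H) (t % H) ω)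
        - v (t / H) (t % H + 1) (ρ.nextAt t (ρ.play t ω) ω)) := by
  rw [sum_range_mul_eq_sum_sum]
  refine Finset.sum_congr rfl fun k _ => ?_
  have htelescope := Finset.sum_range_sub' (fun h => v k h (ρ.state k h ω)) H
  rw [hv, Pi.zero_apply, sub_zero] at htelescope
  rw [← htelescope]
  refine Finset.sum_congr rfl fun h hh => ?_
  have hh := Finset.mem_range.1 hh
  rw [nextAt, ρ.play_mul_add k hh, mul_add_div_of_lt k hh, Nat.mul_add_mod_of_lt hh]
  rcases (Nat.succ_le_of_lt hh).lt_or_eq with hlt | heq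
  · rw [ρ.state_succ k h hlt ω]
  · rw [show h + 1 = H from heq, hv, Pi.zero_apply, Pi.zero_apply]

lemma boundsAt_eq (k : ℕ) {h : ℕ} (hh : h < H) :
    ρ.boundsAt k h ω
      = (fun s => upperQ H Shat δ (ρ.stats k ω) (H - (h + 1) + 1) (ρ.boundsAt k (h + 1) ω)
          ((ρ.policy k ω).pair h s),
        fun s => lowerQ H Shat δ (ρ.stats k ω) (H - (h + 1) + 1) (ρ.boundsAt k (h + 1) ω)
          ((ρ.policy k ω).pair h s)) := by
  rw [boundsAt, show H - h = H - (h + 1) + 1 by lia, valueBounds,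
    show H - (H - (h + 1) + 1) = h by lia, boundsAt]

lemma valueAt_eq (k : ℕ) {h : ℕ} (hh : h < H) (s : S) :
    ρ.valueAt k h ω s = M.meanReward ((ρ.policy k ω).pair h s)
      + M.transProb ((ρ.policy k ω).pair h s) ⬝ᵥ ρ.valueAt k (h + 1) ω := by
  rw [valueAt, show H - h = H - (h + 1) + 1 by lia, MDP.valueToGo,
    show H - (H - (h + 1) + 1) = h by lia, valueAt]

/-- Number of observations, at the start of the current episode, of the pair played at time `t`:
the plan of an episode is based on these. -/
def startCount (t : ℕ) (ω : Ω) : ℕ := (ρ.stats (t / H) ω).n (ρ.play t ω)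

/-- Confidence width with which the pair played at time `t` enters the plan. -/
def playWidth (t : ℕ) (ω : Ω) : ℝ := confWidth (failProb X.card H Shat δ) (ρ.startCount t ω)

/-- Conditional variance, at time `t`, of the value of the next state. -/
def playVar (t : ℕ) (ω : Ω) : ℝ :=
  wvar (M.transProb (ρ.play t ω)) (ρ.valueAt (t / H) (t % H + 1) ω)

/-- Bound for what the step at time `t` adds to the gap between the value bounds. Below `H`
observations the trivial bound is used: the counts may double within an episode then. -/
def stepCost (t : ℕ) (ω : Ω) : ℝ :=
  if ρ.startCount t ω < H then (H : ℝ)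
  else 8 * ρ.playWidth t ω + 8 * (√(ρ.playVar t ω) * ρ.playWidth t ω)
    + 191 * (Shat * H ^ 2 * ρ.playWidth t ω ^ 2)

lemma playVar_nonneg (t : ℕ) : 0 ≤ ρ.playVar t ω := wvar_nonneg (M.transProb_mem_stdSimplex _)

lemma stepCost_nonneg (t : ℕ) : 0 ≤ ρ.stepCost t ω := by
  have hφ : 0 ≤ ρ.playWidth t ω := confWidth_nonneg _ _
  unfold stepCost
  split_ifs <;> positivity

variable {ρ}

lemma GoodRun.goodModel (hg : ρ.GoodRun ω) (hsupp : ∀ y, (M.P y).support.ncard ≤ Shat) (k : ℕ) :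
    GoodModel M H Shat δ (ρ.stats k ω) := by
  rw [ρ.stats_eq_modelAt]
  exact (hg.obs (k * H)).goodStats (ρ.isSummary_modelAt (k * H) ω) hsupp

lemma GoodRun.validBounds (hg : ρ.GoodRun ω) (hsupp : ∀ y, (M.P y).support.ncard ≤ Shat)
    (hS : 1 ≤ Shat) (k h : ℕ) :
    ValidBounds M (H - h) (ρ.valueAt k h ω) (ρ.boundsAt k h ω) :=
  (hg.goodModel hsupp k).validBounds hS (ρ.greedy k ω) (Nat.sub_le H h)

lemma GoodRun.abs_boundsAt_sub_le_add_stepCost (hg : ρ.GoodRun ω)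
    (hsupp : ∀ y, (M.P y).support.ncard ≤ Shat) (hS : 1 ≤ Shat) (hH : 0 < H) (t : ℕ) :
    |((ρ.boundsAt (t / H) (t % H) ω).1 - (ρ.boundsAt (t / H) (t % H) ω).2)
        (ρ.state (t / H) (t % H) ω)|
      ≤ (1 + 7 / H) * (M.transProb (ρ.play t ω) ⬝ᵥ
          |(ρ.boundsAt (t / H) (t % H + 1) ω).1 - (ρ.boundsAt (t / H) (t % H + 1) ω).2|)
        + ρ.stepCost t ω := by
  have hh := Nat.mod_lt t hH
  have hnext := hg.validBounds hsupp hS (t / H) (t % H + 1)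
  by_cases hn : ρ.startCount t ω < H
  · rw [stepCost, if_pos hn]
    refine (ρ.abs_boundsAt_sub_le _ _ _).trans <| le_add_of_nonneg_of_le ?_ (mod_cast Nat.sub_le ..)
    exact mul_nonneg (by positivity) <| dotProduct_nonneg_of_nonneg
      (M.transProb_mem_stdSimplex _).1 (abs_nonneg _)
  · rw [stepCost, if_neg hn, abs_of_nonneg
      ((hg.validBounds hsupp hS (t / H) (t % H)).upper_sub_lower_mem_Icc _).1,
      abs_of_nonneg (sub_nonneg.2 hnext.lower_le_upper), ← add_assoc, ← add_assoc, ← mul_assoc,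
      ρ.boundsAt_eq (t / H) hh]
    exact (hg.goodModel hsupp (t / H)).upperQ_sub_lowerQ_le hS
      (Nat.ne_zero_of_lt (hH.trans_le (not_lt.1 hn))) (by lia) hnext

lemma GoodRun.weightedGap_le_add_stepCost (hg : ρ.GoodRun ω)
    (hsupp : ∀ y, (M.P y).support.ncard ≤ Shat) (hS : 1 ≤ Shat) (hH : 0 < H) (t : ℕ) :
    ρ.weightedGap (t / H) (t % H) ω (ρ.state (t / H) (t % H) ω)
      ≤ (1 - 1 / (2 * H)) * (M.transProb (ρ.play t ω) ⬝ᵥ ρ.weightedGap (t / H) (t % H + 1) ω)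
        + Real.exp 16 * ρ.stepCost t ω := by
  set w := stepWeight H (t % H)
  have hw : 0 ≤ w := zero_le_one.trans (one_le_stepWeight H _)
  set g := M.transProb (ρ.play t ω) ⬝ᵥ
    |(ρ.boundsAt (t / H) (t % H + 1) ω).1 - (ρ.boundsAt (t / H) (t % H + 1) ω).2|
  have hgap : 0 ≤ g :=
    dotProduct_nonneg_of_nonneg (M.transProb_mem_stdSimplex _).1 (abs_nonneg _)
  calc ρ.weightedGap (t / H) (t % H) ω (ρ.state (t / H) (t % H) ω)
      ≤ w * ((1 + 7 / H) * g + ρ.stepCost t ω) :=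
        mul_le_mul_of_nonneg_left (hg.abs_boundsAt_sub_le_add_stepCost hsupp hS hH t) hw
    _ = w * (1 + 7 / H) * g + w * ρ.stepCost t ω := by ring
    _ ≤ stepWeight H (t % H + 1) * (1 - 1 / (2 * H)) * g + Real.exp 16 * ρ.stepCost t ω :=
        add_le_add (mul_le_mul_of_nonneg_right (stepWeight_mul_le hH _) hgap)
          (mul_le_mul_of_nonneg_right (stepWeight_le_exp (Nat.mod_lt t hH).le)
            (ρ.stepCost_nonneg t))
    _ = _ := by
        rw [weightedGap, dotProduct_smul, smul_eq_mul]
        ring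

lemma GoodRun.certSize_le_sum_stepCost (hg : ρ.GoodRun ω)
    (hsupp : ∀ y, (M.P y).support.ncard ≤ Shat) (hS : 1 ≤ Shat) (hH : 0 < H) (T : ℕ) :
    ρ.certSize T ω ≤ Real.exp 16 * (2 * (H ^ 2 * -Real.log (failProb X.card H Shat δ))
      + ∑ t ∈ Finset.range (T * H), ρ.stepCost t ω) := by
  have hgap_zero (k : ℕ) :
      ρ.upper k ω - ρ.lower k ω = ρ.weightedGap k 0 ω (ρ.state k 0 ω) := by
    rw [weightedGap, stepWeight, pow_zero, one_smul,
      abs_of_nonneg (sub_nonneg.2 (hg.validBounds hsupp hS k 0).lower_le_upper)]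
    rfl
  calc ρ.certSize T ω
      = ∑ t ∈ Finset.range (T * H), (ρ.weightedGap (t / H) (t % H) ω
            (ρ.state (t / H) (t % H) ω)
          - ρ.weightedGap (t / H) (t % H + 1) ω (ρ.nextAt t (ρ.play t ω) ω)) := by
        simp only [certSize, hgap_zero]
        exact ρ.sum_state_zero_eq (v := (ρ.weightedGap · · ω)) ρ.weightedGap_self T
    _ ≤ ∑ t ∈ Finset.range (T * H), ((1 - 1 / (2 * H))
            * (M.transProb (ρ.play t ω) ⬝ᵥ ρ.weightedGap (t / H) (t % H + 1) ω)
          - ρ.weightedGap (t / H) (t % H + 1) ω (ρ.nextAt t (ρ.play t ω) ω)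
          + Real.exp 16 * ρ.stepCost t ω) :=
        Finset.sum_le_sum fun t _ => by linarith [hg.weightedGap_le_add_stepCost hsupp hS hH t]
    _ ≤ Real.exp 16 * H / (1 / (2 * H)) * -Real.log (failProb X.card H Shat δ)
          + Real.exp 16 * ∑ t ∈ Finset.range (T * H), ρ.stepCost t ω := by
        rw [Finset.sum_add_distrib, ← Finset.mul_sum]
        exact add_le_add (hg.gap _) le_rfl
    _ = _ := by
        rw [div_div_eq_mul_div, div_one]
        ring

-- The value of the current state is the mean value of the next one plus a reward in `[0, 1]`.
lemma playVar_add_sq_valueAt_le (hX : ∀ s, ∃ a, (s, a) ∈ X) (hH : 0 < H) (t : ℕ) :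
    ρ.playVar t ω + ρ.valueAt (t / H) (t % H) ω (ρ.state (t / H) (t % H) ω) ^ 2
      ≤ M.transProb (ρ.play t ω) ⬝ᵥ ρ.valueAt (t / H) (t % H + 1) ω ^ 2 + 2 * H := by
  have hv := ρ.valueAt_mem_Icc (ω := ω) hX (t / H) (t % H) (ρ.state (t / H) (t % H) ω)
  have hr := M.meanReward_mem_Icc (ρ.play t ω)
  have heq : ρ.valueAt (t / H) (t % H) ω (ρ.state (t / H) (t % H) ω)
      = M.meanReward (ρ.play t ω)
        + M.transProb (ρ.play t ω) ⬝ᵥ ρ.valueAt (t / H) (t % H + 1) ω :=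
    ρ.valueAt_eq (t / H) (Nat.mod_lt t hH) _
  set v := ρ.valueAt (t / H) (t % H) ω (ρ.state (t / H) (t % H) ω)
  set r := M.meanReward (ρ.play t ω)
  rw [playVar, wvar, ← sub_eq_of_eq_add' heq]
  nlinarith [mul_le_mul hr.2 hv.2 hv.1 zero_le_one]

lemma GoodRun.sum_playVar_le (hg : ρ.GoodRun ω) (hX : ∀ s, ∃ a, (s, a) ∈ X) (hH : 0 < H)
    (T : ℕ) : ∑ t ∈ Finset.range (T * H), ρ.playVar t ω
      ≤ 16 * H ^ 2 * -Real.log (failProb X.card H Shat δ) + 4 * H ^ 2 * T := by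
  have hnonneg : 0 ≤ ∑ k ∈ Finset.range T, ρ.valueAt k 0 ω (ρ.state k 0 ω) ^ 2 :=
    Finset.sum_nonneg fun _ _ => sq_nonneg _
  have htelescope := ρ.sum_state_zero_eq (ω := ω) (v := fun k h => ρ.valueAt k h ω ^ 2)
    (fun k => by rw [ρ.valueAt_self, zero_pow two_ne_zero]) T
  have hsum := Finset.sum_le_sum fun t (_ : t ∈ Finset.range (T * H)) =>
    playVar_add_sq_valueAt_le (ρ := ρ) (ω := ω) hX hH t
  have hdev := hg.sqValue (T * H)
  simp only [Pi.pow_apply, Finset.sum_add_distrib, Finset.sum_sub_distrib, Finset.sum_const,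
    Finset.card_range, nsmul_eq_mul, Nat.cast_mul] at htelescope hsum hdev
  simp only [playVar] at hsum ⊢
  linarith

lemma startCount_eq_obsCount (t : ℕ) :
    ρ.startCount t ω = obsCount G (ρ.play · ω) (t / H * H) (ρ.play t ω) := by
  rw [startCount, ρ.stats_eq_modelAt, (ρ.isSummary_modelAt (t / H * H) ω).n_eq, obsCount]

lemma startCount_le (t : ℕ) : ρ.startCount t ω ≤ t := by
  rw [startCount_eq_obsCount]
  exact (obsCount_le _ _ _ _).trans (Nat.div_mul_le_self t H)

lemma obsCount_lt_startCount_add (hH : 0 < H) (t : ℕ) :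
    obsCount G (ρ.play · ω) t (ρ.play t ω) < ρ.startCount t ω + H := by
  have hadd := obsCount_add_le G (ρ.play · ω) (ρ.play t ω) (t / H * H) (t % H)
  rw [Nat.div_add_mod' t H, ← startCount_eq_obsCount] at hadd
  exact hadd.trans_lt (Nat.add_lt_add_left (Nat.mod_lt t hH) _)

lemma card_startCount_lt_le (hG : ∀ x, ¬ G.Adj x x) (hH : 0 < H) (n : ℕ) :
    {t ∈ Finset.range n | ρ.startCount t ω < H}.card ≤ 2 * H * masNumber G := by
  refine (Finset.card_le_card fun t ht => ?_).trans
    (card_obsCount_lt_le hG (ρ.play · ω) (2 * H) n)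
  rw [Finset.mem_filter] at ht ⊢
  have hlt := obsCount_lt_startCount_add (ρ := ρ) (ω := ω) hH t
  exact ⟨ht.1, by lia⟩

lemma sq_playWidth_le (hH : 0 < H) (hε : 0 < failProb X.card H Shat δ)
    (hε1 : failProb X.card H Shat δ ≤ 1) {n t : ℕ} (ht : t < n) (hn : H ≤ ρ.startCount t ω) :
    ρ.playWidth t ω ^ 2 ≤ 1.56 * confLog (failProb X.card H Shat δ) n
      * (1 / (obsCount G (ρ.play · ω) t (ρ.play t ω) + 1)) := by
  have hcount := obsCount_lt_startCount_add (ρ := ρ) (ω := ω) hH t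
  have hobs : (obsCount G (ρ.play · ω) t (ρ.play t ω) + 1 : ℝ) ≤ 3 * ρ.startCount t ω := by
    norm_cast
    lia
  have hpos : (0 : ℝ) < ρ.startCount t ω := mod_cast hH.trans_le hn
  have hL := confLog_pos hε hε1 n
  calc ρ.playWidth t ω ^ 2
      ≤ 0.52 / ρ.startCount t ω * confLog (failProb X.card H Shat δ) (ρ.startCount t ω) :=
        sq_confWidth_le hε hε1 (Nat.ne_zero_of_lt (hH.trans_le hn))
    _ ≤ 0.52 / ρ.startCount t ω * confLog (failProb X.card H Shat δ) n := by
        gcongr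
        exact confLog_mono ((startCount_le t).trans ht.le)
    _ = 1.56 * confLog (failProb X.card H Shat δ) n * (1 / (3 * ρ.startCount t ω)) := by
        field_simp
        norm_num
    _ ≤ _ := by gcongr

lemma sum_sq_playWidth_le (hG : ∀ x, ¬ G.Adj x x) (hH : 0 < H)
    (hε : 0 < failProb X.card H Shat δ) (hε1 : failProb X.card H Shat δ ≤ 1) (n : ℕ) :
    ∑ t ∈ Finset.range n with ¬ ρ.startCount t ω < H, ρ.playWidth t ω ^ 2
      ≤ 1.56 * confLog (failProb X.card H Shat δ) n * (masNumber G * Real.log (n + 1) + 1) := by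
  have hL := confLog_pos hε hε1 n
  calc ∑ t ∈ Finset.range n with ¬ ρ.startCount t ω < H, ρ.playWidth t ω ^ 2
      ≤ ∑ t ∈ Finset.range n with ¬ ρ.startCount t ω < H,
          1.56 * confLog (failProb X.card H Shat δ) n
            * (1 / (obsCount G (ρ.play · ω) t (ρ.play t ω) + 1)) := by
        refine Finset.sum_le_sum fun t ht => ?_
        rw [Finset.mem_filter, Finset.mem_range, not_lt] at ht
        exact sq_playWidth_le hH hε hε1 ht.1 ht.2
    _ ≤ ∑ t ∈ Finset.range n, 1.56 * confLog (failProb X.card H Shat δ) n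
            * (1 / (obsCount G (ρ.play · ω) t (ρ.play t ω) + 1)) :=
        Finset.sum_le_sum_of_subset_of_nonneg (Finset.filter_subset _ _) fun t _ _ => by positivity
    _ ≤ _ := by
        rw [← Finset.mul_sum]
        gcongr
        exact sum_one_div_obsCount_succ_le hG _ n

lemma sum_stepCost_of_startCount_lt_le (hG : ∀ x, ¬ G.Adj x x) (hH : 0 < H) (n : ℕ) :
    ∑ t ∈ Finset.range n with ρ.startCount t ω < H, ρ.stepCost t ω ≤ 2 * masNumber G * H ^ 2 := by
  have hcard : ({t ∈ Finset.range n | ρ.startCount t ω < H}.card : ℝ) ≤ 2 * H * masNumber G :=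
    mod_cast card_startCount_lt_le (ρ := ρ) (ω := ω) hG hH n
  have hcost (t) (ht : t ∈ {t ∈ Finset.range n | ρ.startCount t ω < H}) : ρ.stepCost t ω = H :=
    if_pos (Finset.mem_filter.1 ht).2
  calc ∑ t ∈ Finset.range n with ρ.startCount t ω < H, ρ.stepCost t ω
      = {t ∈ Finset.range n | ρ.startCount t ω < H}.card * (H : ℝ) := by
        rw [Finset.sum_congr rfl hcost, Finset.sum_const, nsmul_eq_mul]
    _ ≤ 2 * H * masNumber G * H := by gcongr
    _ = 2 * masNumber G * H ^ 2 := by ring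

lemma sum_stepCost_of_le_startCount_le {n : ℕ} {Φ Q : ℝ}
    (hΦ : ∑ t ∈ Finset.range n with ¬ ρ.startCount t ω < H, ρ.playWidth t ω ^ 2 ≤ Φ)
    (hQ : ∑ t ∈ Finset.range n, ρ.playVar t ω ≤ Q) :
    ∑ t ∈ Finset.range n with ¬ ρ.startCount t ω < H, ρ.stepCost t ω
      ≤ 8 * (√n * √Φ) + 8 * (√Q * √Φ) + 191 * (Shat * H ^ 2 * Φ) := by
  set J := {t ∈ Finset.range n | ¬ ρ.startCount t ω < H}
  have hsum : ∑ t ∈ J, ρ.stepCost t ω = 8 * ∑ t ∈ J, 1 * ρ.playWidth t ω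
      + 8 * ∑ t ∈ J, √(ρ.playVar t ω) * ρ.playWidth t ω
      + 191 * (Shat * H ^ 2 * ∑ t ∈ J, ρ.playWidth t ω ^ 2) := by
    simp only [Finset.mul_sum, one_mul, ← Finset.sum_add_distrib]
    exact Finset.sum_congr rfl fun t ht => if_neg (Finset.mem_filter.1 ht).2
  have hcount : ∑ t ∈ J, 1 * ρ.playWidth t ω ≤ √n * √Φ := by
    refine (Real.sum_mul_le_sqrt_mul_sqrt J (fun _ => 1) _).trans ?_
    gcongr
    simp only [one_pow, Finset.sum_const, nsmul_eq_mul, mul_one]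
    exact mod_cast (Finset.card_filter_le _ _).trans_eq (Finset.card_range n)
  have hvar : ∑ t ∈ J, √(ρ.playVar t ω) * ρ.playWidth t ω ≤ √Q * √Φ := by
    refine (Real.sum_mul_le_sqrt_mul_sqrt J _ _).trans ?_
    simp only [Real.sq_sqrt (ρ.playVar_nonneg _)]
    gcongr
    exact (Finset.sum_le_sum_of_subset_of_nonneg (Finset.filter_subset _ _)
      fun t _ _ => ρ.playVar_nonneg t).trans hQ
  rw [hsum]
  gcongr

end Run

/-! ### The rate -/

/-- The logarithm `ln (e |X| H T / δ)` of the rate. -/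
def rateLog (card H T : ℕ) (δ : ℝ) : ℝ := Real.log (Real.exp 1 * card * H * T / δ)

section RateLog

variable {card H Shat T : ℕ} {δ : ℝ}

lemma rateLog_eq (hc : 0 < card) (hH : 0 < H) (hT : 0 < T) (hδ : 0 < δ) :
    rateLog card H T δ
      = 1 + Real.log card + Real.log H + Real.log T - Real.log δ := by
  rw [rateLog, Real.log_div (by positivity) hδ.ne', Real.log_mul (by positivity) (by positivity),
    Real.log_mul (by positivity) (by positivity), Real.log_mul (by positivity) (by positivity),
    Real.log_exp]

lemma one_add_log_add_log_le_rateLog (hc : 0 < card) (hH : 0 < H) (hT : 0 < T) (hδ : 0 < δ)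
    (hδ1 : δ ≤ 1) : 1 + Real.log T + Real.log H ≤ rateLog card H T δ := by
  rw [rateLog_eq hc hH hT hδ]
  linarith [Real.log_natCast_nonneg card, Real.log_nonpos hδ.le hδ1]

lemma one_le_rateLog (hc : 0 < card) (hH : 0 < H) (hT : 0 < T) (hδ : 0 < δ) (hδ1 : δ ≤ 1) :
    1 ≤ rateLog card H T δ :=
  le_trans (by linarith [Real.log_natCast_nonneg T, Real.log_natCast_nonneg H])
    (one_add_log_add_log_le_rateLog hc hH hT hδ hδ1)

lemma neg_log_failProb_le (hc : 0 < card) (hH : 0 < H) (hShat : Shat ≤ card) (hδ : 0 < δ) :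
    -Real.log (failProb card H Shat δ)
      ≤ 2.8 + 2 * Real.log card + Real.log H - Real.log δ := by
  have hlog16 : Real.log 16 ≤ 2.8 := by
    rw [show (16 : ℝ) = 2 ^ 4 by norm_num, Real.log_pow]
    push_cast
    linarith [Real.log_two_lt_d9]
  have hterms : (4 * Shat + 5 * H + 7 : ℝ) ≤ 16 * (card * H) := by
    norm_cast
    nlinarith
  have hlog := Real.log_le_log (by positivity) hterms
  rw [Real.log_mul (by norm_num) (by positivity), Real.log_mul (by positivity) (by positivity)]
    at hlog
  rw [failProb, Real.log_div hδ.ne' (by positivity), Real.log_mul (by positivity) (by positivity)]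
  linarith

lemma neg_log_failProb_le_rateLog (hc : 0 < card) (hH : 0 < H) (hT : 0 < T) (hShat : Shat ≤ card)
    (hδ : 0 < δ) (hδ1 : δ ≤ 1) :
    -Real.log (failProb card H Shat δ) ≤ 3 * rateLog card H T δ := by
  rw [rateLog_eq hc hH hT hδ]
  linarith [neg_log_failProb_le hc hH hShat hδ, Real.log_nonpos hδ.le hδ1,
    Real.log_natCast_nonneg card, Real.log_natCast_nonneg H, Real.log_natCast_nonneg T]

lemma log_mul_le_one_add (hH : 0 < H) (hT : 0 < T) {a : ℝ} (ha : 0 < a)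
    (hle : a ≤ Real.exp 1 * (T * H)) : Real.log a ≤ 1 + Real.log T + Real.log H := by
  have hlog := Real.log_le_log ha hle
  rwa [Real.log_mul (by positivity) (by positivity), Real.log_exp,
    Real.log_mul (by positivity) (by positivity), ← add_assoc] at hlog

lemma log_mul_add_one_le_rateLog (hc : 0 < card) (hH : 0 < H) (hT : 0 < T) (hδ : 0 < δ)
    (hδ1 : δ ≤ 1) : Real.log ((T * H : ℕ) + 1) ≤ rateLog card H T δ := by
  refine (log_mul_le_one_add hH hT (by positivity) ?_).trans
    (one_add_log_add_log_le_rateLog hc hH hT hδ hδ1)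
  have hTH : (1 : ℝ) ≤ T * H := mod_cast Nat.mul_pos hT hH
  push_cast
  nlinarith [Real.exp_one_gt_d9]

lemma confLog_failProb_le_rateLog (hc : 0 < card) (hH : 0 < H) (hT : 0 < T) (hShat : Shat ≤ card)
    (hδ : 0 < δ) (hδ1 : δ ≤ 1) :
    confLog (failProb card H Shat δ) (T * H) ≤ 5 * rateLog card H T δ := by
  have hTH : (1 : ℝ) ≤ T * H := mod_cast Nat.mul_pos hT hH
  have hinner : Real.log (max (Real.exp 1) (2 * (T * H : ℕ))) ≤ 1 + Real.log T + Real.log H := by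
    refine log_mul_le_one_add hH hT (lt_max_of_lt_left (Real.exp_pos 1)) (max_le ?_ ?_)
    · nlinarith [Real.exp_pos 1]
    · push_cast
      nlinarith [Real.exp_one_gt_d9]
  have hloglog := Real.log_le_sub_one_of_pos
    (zero_lt_one.trans_le (one_le_log_max_exp_one (2 * (T * H : ℕ))))
  have hlog5 : Real.log 5.2 ≤ 2.1 := by
    refine (Real.log_le_log (by norm_num) (by norm_num : (5.2 : ℝ) ≤ 2 ^ 3)).trans ?_
    rw [Real.log_pow]
    push_cast
    linarith [Real.log_two_lt_d9]
  rw [confLog, Real.log_div (by norm_num) (failProb_pos hc hδ).ne', rateLog_eq hc hH hT hδ]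
  linarith [neg_log_failProb_le hc hH hShat hδ, Real.log_nonpos hδ.le hδ1,
    Real.log_natCast_nonneg card, Real.log_natCast_nonneg H, Real.log_natCast_nonneg T]

end RateLog

section RateArithmetic

variable {m N H T y : ℝ}

lemma width_sum_rate_le {L l : ℝ} (hm : 1 ≤ m) (hy : 1 ≤ y) (hl : 0 ≤ l) (hL : L ≤ 5 * y)
    (hly : l ≤ y) : 1.56 * L * (m * l + 1) ≤ 16 * (m * y ^ 2) := by
  have hmy : m * l + 1 ≤ 2 * (m * y) := by nlinarith
  calc 1.56 * L * (m * l + 1) ≤ 8 * y * (2 * (m * y)) :=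
        mul_le_mul (by linarith) hmy (by positivity) (by positivity)
    _ = 16 * (m * y ^ 2) := by ring

lemma sqrt_mul_sqrt_rate_le (hm : 0 ≤ m) (hH : 1 ≤ H) (hT : 0 ≤ T) (hy : 0 ≤ y) :
    √(T * H) * √(16 * (m * y ^ 2)) ≤ 4 * (√(m * H ^ 2 * T) * y) := by
  rw [← Real.sqrt_mul (by positivity)]
  refine Real.sqrt_le_iff.2 ⟨by positivity, ?_⟩
  calc T * H * (16 * (m * y ^ 2)) ≤ T * H ^ 2 * (16 * (m * y ^ 2)) := by
        gcongr
        exact le_self_pow₀ hH two_ne_zero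
    _ = (4 * (√(m * H ^ 2 * T) * y)) ^ 2 := by
        rw [mul_pow, mul_pow, Real.sq_sqrt (by positivity)]
        ring

lemma sqrt_var_mul_sqrt_rate_le {l : ℝ} (hm : 1 ≤ m) (hN : 1 ≤ N) (hH : 1 ≤ H) (hT : 0 ≤ T)
    (hy : 1 ≤ y) (hl : l ≤ 3 * y) :
    √(16 * H ^ 2 * l + 4 * H ^ 2 * T) * √(16 * (m * y ^ 2))
      ≤ 8 * (√(m * H ^ 2 * T) * y) + 28 * (m * N * H ^ 2 * y ^ 3) := by
  set K := m * N * H ^ 2 * y ^ 3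
  have hK : m * H ^ 2 * y ^ 3 ≤ K := by
    calc m * H ^ 2 * y ^ 3 = m * 1 * H ^ 2 * y ^ 3 := by ring
      _ ≤ m * N * H ^ 2 * y ^ 3 := by gcongr
  have hK1 : 1 ≤ K := by
    refine le_trans ?_ hK
    bound
  rw [← Real.sqrt_mul' _ (by positivity)]
  refine Real.sqrt_le_iff.2 ⟨by positivity, ?_⟩
  calc (16 * H ^ 2 * l + 4 * H ^ 2 * T) * (16 * (m * y ^ 2))
      ≤ (16 * H ^ 2 * (3 * y) + 4 * H ^ 2 * T) * (16 * (m * y ^ 2)) := by gcongr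
    _ = 768 * (m * H ^ 2 * y ^ 3) + (8 * (√(m * H ^ 2 * T) * y)) ^ 2 := by
        rw [mul_pow, mul_pow, Real.sq_sqrt (by positivity)]
        ring
    _ ≤ (28 * K) ^ 2 + (8 * (√(m * H ^ 2 * T) * y)) ^ 2 := by
        gcongr
        nlinarith
    _ ≤ (8 * (√(m * H ^ 2 * T) * y) + 28 * K) ^ 2 := by
        have : 0 ≤ √(m * H ^ 2 * T) * y * K := by positivity
        nlinarith

lemma total_cost_le_rate {l : ℝ} (hm : 1 ≤ m) (hN : 1 ≤ N) (hH : 1 ≤ H) (hT : 0 ≤ T) (hy : 1 ≤ y)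
    (hl : l ≤ 3 * y) :
    2 * (H ^ 2 * l) + (2 * m * H ^ 2 + (8 * (√(T * H) * √(16 * (m * y ^ 2)))
        + 8 * (√(16 * H ^ 2 * l + 4 * H ^ 2 * T) * √(16 * (m * y ^ 2)))
        + 191 * (N * H ^ 2 * (16 * (m * y ^ 2)))))
      ≤ 3300 * (√(m * H ^ 2 * T) * y + m * N * H ^ 2 * y ^ 3) := by
  have hcount := sqrt_mul_sqrt_rate_le (m := m) (by positivity) hH hT (by positivity : 0 ≤ y)
  have hvar := sqrt_var_mul_sqrt_rate_le hm hN hH hT hy hl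
  have hmN : 1 ≤ m * N := one_le_mul_of_one_le_of_one_le hm hN
  have hlog : H ^ 2 * l ≤ 3 * (m * N * H ^ 2 * y ^ 3) :=
    calc H ^ 2 * l ≤ H ^ 2 * (3 * y) := by gcongr
      _ = 3 * (1 * H ^ 2 * y) := by ring
      _ ≤ 3 * (m * N * H ^ 2 * y ^ 3) := by
        gcongr
        exact le_self_pow₀ hy three_ne_zero
  have hfew : m * H ^ 2 ≤ m * N * H ^ 2 * y ^ 3 :=
    calc m * H ^ 2 = m * 1 * H ^ 2 * 1 := by ring
      _ ≤ m * N * H ^ 2 * y ^ 3 := by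
        gcongr
        exact one_le_pow₀ hy
  have hsq : N * H ^ 2 * (16 * (m * y ^ 2)) ≤ 16 * (m * N * H ^ 2 * y ^ 3) :=
    calc N * H ^ 2 * (16 * (m * y ^ 2)) = 16 * (m * N * H ^ 2 * y ^ 2) := by ring
      _ ≤ 16 * (m * N * H ^ 2 * y ^ 3) := by
        gcongr
        exact Nat.le_succ 2
  have hZ : 0 ≤ √(m * H ^ 2 * T) * y := by positivity
  have hK : 0 ≤ m * N * H ^ 2 * y ^ 3 := by positivity
  linarith

end RateArithmetic

namespace Run

variable {X : Finset (S × A)} [Fintype S] {M : MDP X} {G : Digraph X} {H Shat : ℕ} {δ : ℝ}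
  {s₀ : S} {Ω : Type*} [mΩ : MeasurableSpace Ω] {μ : Measure Ω}
  {ρ : Run M G H Shat δ s₀ μ} {ω : Ω}

lemma GoodRun.certificate (hg : ρ.GoodRun ω) (hsupp : ∀ y, (M.P y).support.ncard ≤ Shat)
    (hS : 1 ≤ Shat) (k : ℕ) :
    ρ.lower k ω ≤ ρ.playedValue k ω ∧ ρ.playedValue k ω ≤ ρ.bestValue k ω ∧
      ρ.bestValue k ω ≤ ρ.upper k ω := by
  have : Nonempty (Policy X) := ⟨ρ.policy k ω⟩
  have hbounds := hg.validBounds hsupp hS k 0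
  refine ⟨?_, M.value_le_optValue H _ _, (M.optValue_le_optValueToGo H _).trans (hbounds.opt_le _)⟩
  rw [playedValue, M.value_eq_valueToGo]
  exact hbounds.lower_le _

lemma sum_stepCost_le {Φ Q : ℝ} (hG : ∀ x, ¬ G.Adj x x) (hH : 0 < H) (n : ℕ)
    (hΦ : ∑ t ∈ Finset.range n with ¬ ρ.startCount t ω < H, ρ.playWidth t ω ^ 2 ≤ Φ)
    (hQ : ∑ t ∈ Finset.range n, ρ.playVar t ω ≤ Q) :
    ∑ t ∈ Finset.range n, ρ.stepCost t ω ≤ 2 * masNumber G * H ^ 2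
      + (8 * (√n * √Φ) + 8 * (√Q * √Φ) + 191 * (Shat * H ^ 2 * Φ)) := by
  rw [← Finset.sum_filter_add_sum_filter_not (Finset.range n) (ρ.startCount · ω < H)]
  exact add_le_add (sum_stepCost_of_startCount_lt_le hG hH n)
    (sum_stepCost_of_le_startCount_le hΦ hQ)

lemma GoodRun.certSize_le (hg : ρ.GoodRun ω) (hX : ∀ s, ∃ a, (s, a) ∈ X)
    (hsupp : ∀ y, (M.P y).support.ncard ≤ Shat) (hG : ∀ x, ¬ G.Adj x x) (hH : 0 < H)
    (hS : 1 ≤ Shat) (hShat : Shat ≤ X.card) (hδ : 0 < δ) (hδ1 : δ ≤ 1) (T : ℕ) :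
    ρ.certSize T ω ≤ 3300 * Real.exp 16 * boundRate (masNumber G) X.card H Shat δ T := by
  rcases T.eq_zero_or_pos with rfl | hT
  · simp [certSize, boundRate]
  have hc : 0 < X.card := hS.trans hShat
  have hmas : (1 : ℝ) ≤ masNumber G := mod_cast one_le_masNumber hG (ρ.play 0 ω)
  have hy := one_le_rateLog hc hH hT hδ hδ1
  have hΦ := (sum_sq_playWidth_le (ρ := ρ) (ω := ω) hG hH (failProb_pos hc hδ)
    (failProb_le_one hc hδ1) (T * H)).trans <| width_sum_rate_le hmas hy
      (Real.log_nonneg (le_add_of_nonneg_left (Nat.cast_nonneg _)))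
      (confLog_failProb_le_rateLog hc hH hT hShat hδ hδ1)
      (log_mul_add_one_le_rateLog hc hH hT hδ hδ1)
  have hcost := sum_stepCost_le hG hH (T * H) hΦ (hg.sum_playVar_le hX hH T)
  push_cast at hcost
  calc ρ.certSize T ω
      ≤ Real.exp 16 * (2 * (H ^ 2 * -Real.log (failProb X.card H Shat δ))
          + ∑ t ∈ Finset.range (T * H), ρ.stepCost t ω) :=
        hg.certSize_le_sum_stepCost hsupp hS hH T
    _ ≤ Real.exp 16 * (3300 * boundRate (masNumber G) X.card H Shat δ T) := by
        gcongr
        exact (add_le_add_right hcost _).trans <| total_cost_le_rate hmas (mod_cast hS)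
          (mod_cast hH) T.cast_nonneg hy (neg_log_failProb_le_rateLog hc hH hT hShat hδ hδ1)
    _ = 3300 * Real.exp 16 * boundRate (masNumber G) X.card H Shat δ T := by ring

lemma GoodRun.regret_le_certSize (hg : ρ.GoodRun ω) (hsupp : ∀ y, (M.P y).support.ncard ≤ Shat)
    (hS : 1 ≤ Shat) (T : ℕ) : ρ.regret T ω ≤ ρ.certSize T ω :=
  Finset.sum_le_sum fun k _ =>
    have ⟨hlower, _, hupper⟩ := hg.certificate hsupp hS k
    sub_le_sub hupper hlower

end Run

lemma MDP.one_le_of_forall_ncard_support_le {X : Finset (S × A)} [Finite S] (M : MDP X) {n : ℕ}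
    (x : X) (hsupp : ∀ y, (M.P y).support.ncard ≤ n) : 1 ≤ n :=
  ((Set.ncard_pos (Set.toFinite _)).2 (M.P x).support_nonempty).trans_le (hsupp x)

lemma card_le_card_of_forall_exists_mem [Fintype S] {X : Finset (S × A)}
    (hX : ∀ s, ∃ a, (s, a) ∈ X) : Fintype.card S ≤ X.card := by
  choose a ha using hX
  exact Finset.card_le_card_of_injOn (fun s => (s, a s)) (fun s _ => ha s)
    fun s _ t _ h => congrArg Prod.fst h

end FeedbackRL

end

theorem theorem1 :
    ∃ C : ℝ, 0 < C ∧
      ∀ (S : Type*) (A : Type*) [Fintype S] (X : Finset (S × A)),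
        (∀ s : S, ∃ a : A, (s, a) ∈ X) →
      ∀ (M : FeedbackRL.MDP X) (G : Digraph X), (∀ x, ¬ G.Adj x x) →
      ∀ H : ℕ, 1 ≤ H →
      ∀ Shat : ℕ, (∀ x, (M.P x).support.ncard ≤ Shat) → Shat ≤ Fintype.card S →
      ∀ δ : ℝ, 0 < δ → δ ≤ 1 →
      ∀ (s₀ : S) (Ω : Type*) [MeasurableSpace Ω] (μ : MeasureTheory.Measure Ω)
        [MeasureTheory.IsProbabilityMeasure μ]
        (ρ : FeedbackRL.Run M G H Shat δ s₀ μ),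
        ENNReal.ofReal (1 - δ) ≤ μ {ω |
          (∀ k, ρ.lower k ω ≤ ρ.playedValue k ω ∧ ρ.playedValue k ω ≤ ρ.bestValue k ω ∧
            ρ.bestValue k ω ≤ ρ.upper k ω) ∧
          ∀ T : ℕ,
            ρ.certSize T ω ≤
              C * FeedbackRL.boundRate (FeedbackRL.masNumber G) X.card H Shat δ T ∧
            ρ.regret T ω ≤
              C * FeedbackRL.boundRate (FeedbackRL.masNumber G) X.card H Shat δ T} := by
  refine ⟨3300 * Real.exp 16, by positivity, ?_⟩
  intro S A _ X hX M G hG H hH Shat hsupp hShat δ hδ hδ1 s₀ Ω _ μ _ ρ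
  obtain ⟨a, ha⟩ := hX s₀
  have hS : 1 ≤ Shat := M.one_le_of_forall_ncard_support_le ⟨(s₀, a), ha⟩ hsupp
  have hcard : Shat ≤ X.card := hShat.trans (FeedbackRL.card_le_card_of_forall_exists_mem hX)
  refine (ρ.ofReal_one_sub_le_measure_goodRun hX hH hδ hδ1 hsupp).trans
    (MeasureTheory.measure_mono fun ω hω => ⟨hω.certificate hsupp hS, fun T => ?_⟩)
  have hsize := hω.certSize_le hX hsupp hG hH hS hcard hδ hδ1 T
  exact ⟨hsize, (hω.regret_le_certSize hsupp hS T).trans hsize⟩
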